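/- **Setting.** Let $n\ge 1$ agents minimize $f=\frac1n\sum_{i=1}^n f_i$ over $\mathbb R^d$, where $f_i(\theta)=\mathbb E_{\zeta\sim\mu_i}[f_i(\theta;\zeta)]$ is continuously differentiable and $f^\star=\inf f>-\infty$. Assume: 1. $\|\nabla f_i(\theta;\zeta)-\nabla f_i(\theta';\zeta)\|\le L\|\theta-\theta'\|$ for all $\theta,\theta'$ and $\mu_i$-almost every $\zeta$, with $L\ge0$. 2. ${\bf W}\in\mathbb R_+^{n\times n}$ is doubly stochastic with $W_{ij}=0$ whenever $i\neq j$ are not adjacent in a given undirected graph; ${\bf U}\in\mathbb R^{n\times(n-1)}$ has orthonormal columns with ${\bf U}{\bf U}^\top={\bf I}-\frac1n{\bf 1}{\bf 1}^\top$; and, in spectral norm, $\|{\bf U}^\top{\bf W}{\bf U}\|\le1-\rho$ and $\|{\bf W}-{\bf I}\|\le\bar\omega$, with $\rho\in(0,1]$, $\bar\omega\in(0,2]$. 3. $\mathbb E_{\zeta\sim\mu_i}[\nabla f_i(\theta;\zeta)]=\nabla f_i(\theta)$ and $\mathbb E_{\zeta\sim\mu_i}\|\nabla f_i(\theta;\zeta)-\nabla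 f_i(\theta)\|^2\le\sigma^2$ for all $i,\theta$, with $\sigma\ge0$. 4. The random compressor $\mathcal Q(x)=\tilde{\mathcal Q}(x;\xi)$, $\xi\sim\pi_x$, satisfies $\mathbb E\|x-\mathcal Q(x)\|^2\le(1-\delta)\|x\|^2$ for all $x$, with $\delta\in(0,1]$. 5. (Polyak–Łojasiewicz) $\|\nabla f(\theta)\|^2\ge2\mu\,[f(\theta)-f^\star]$ for all $\theta$, with $\mu>0$. **Algorithm (DoCoM-SGT).** Start from $\theta_i^0=\hat\theta_i^0=\theta^0$ (deterministic), $v_i^0=g_i^0=\frac1{b_0}\sum_{r=1}^{b_0}\nabla f_i(\theta^0;\zeta_i^{0,r})$ with independent samples $\zeta_i^{0,r}\sim\mu_i$ and $b_0\ge1$, and $\hat g_i^0=0$. For $t\ge 0$ iterate $$\begin{aligned} \hat\theta_i^{t+1}&=\hat\theta_i^t+\mathcal Q(\theta_i^t-\eta g_i^t-\hat\theta_i^t),\\ \theta_i^{t+1}&=\theta_i^t-\eta g_i^t+\gamma\textstyle\sum_jW_{ij}(\hat\theta_j^{t+1}-\hat\theta_i^{t+1}),\\ v_i^{t+1}&=\beta\nabla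 f_i(\theta_i^{t+1};\zeta_i^{t+1})+(1-\beta)\big[v_i^t+\nabla f_i(\theta_i^{t+1};\zeta_i^{t+1})-\nabla f_i(\theta_i^t;\zeta_i^{t+1})\big],\\ \hat g_i^{t+1}&=\hat g_i^t+\mathcal Q(g_i^t+v_i^{t+1}-v_i^t-\hat g_i^t),\\ g_i^{t+1}&=g_i^t+v_i^{t+1}-v_i^t+\gamma\textstyle\sum_jW_{ij}(\hat g_j^{t+1}-\hat g_i^{t+1}). \end{aligned}$$ The samples $\zeta_i^{t+1}\sim\mu_i$ are independent of each other and of everything drawn before, and each compressor call at a point $x$ uses a seed with conditional law $\pi_x$ given everything drawn before. (In the first round of iteration $t$, "before" means before that round. In the second round it includes $\zeta^{t+1}$. The seeds of different agents within one round may be dependent.) **Constants.** Let $\bar\theta^t=\frac1n\sum_i\theta_i^t$, $\Delta^t=\mathbb E[f(\bar\theta^t)]-f^\star$, $\overline G_0=\frac1n\sum_i\mathbb E\|g_i^0\|^2$, $\bar\beta=\min\{\frac{\rho\gamma}8,\frac{\delta\gamma}8,\beta\}$, $\tilde\beta=\min\{\eta\mu,\bar\beta/2\}$, $$\mathbb C_\sigma=4+\tfrac{\eta^2}{\gamma^3}\tfrac{672L^2n}{\rho^3}+\tfrac{\eta^2}{\gamma}\tfrac{6L^2n\rho^4\delta}{25\bar\omega^2}+\tfrac{\eta^2}{\gamma^2}\tfrac{4L^2n}{\bar\omega^2},$$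 $$\mathbb C_{\bar g}=8(1-\beta)^2L^2(1-\rho\gamma)^2+\tfrac{L^2n}{\rho\gamma}\big(96+\tfrac{141}{400}\tfrac{\rho^2}{\bar\omega^2}\big).$$ Write $V^t$, $G^t$, $\hat G^t$, $\Theta^t$, $\hat\Theta^t$ for the $n\times d$ matrices with rows $v_i^t$, $g_i^t$, $\hat g_i^t$, $\theta_i^t$, $\hat\theta_i^t$, and $\nabla F^t$ for the matrix with rows $\nabla f_i(\theta_i^t)$. Let $\bar v^t$ and $\overline{\nabla F}^t$ be the averages of the rows of $V^t$ and $\nabla F^t$. Define $$\begin{aligned}{\tt V}^0=\mathbb E\Big[&L^2\|{\bf U}^\top\Theta^0\|_F^2+n\|\bar v^0-\overline{\nabla F}^0\|^2+\tfrac1n\|V^0-\nabla F^0\|_F^2\\&+a\|{\bf U}^\top G^0\|_F^2+b\|G^0-\hat G^0\|_F^2+c\|\Theta^0-\eta G^0-\hat\Theta^0\|_F^2\Big]\end{aligned}$$ with $a=\frac{96L^2\eta^2}{\rho^2\gamma^2}$, $b=\frac{\eta^2}{\gamma(1-\gamma)}\frac{3072\bar\omega^2L^2}{\delta\rho^3}$,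 $c=\frac{\gamma}{1-\gamma}\frac{48L^2\bar\omega^2}{\delta\rho}$. Call $(\eta,\gamma,\beta)$ *admissible* if $\eta>0$, $\gamma\in(0,1]$, $\beta\in(0,1)$, $$\gamma\le\gamma_\infty:=\min\Big\{\tfrac1{4\rho},\tfrac{\rho n}{64\bar\omega^2},\tfrac{\delta}{10\bar\omega},\tfrac{\delta\rho\sqrt{1-\gamma}}{259\bar\omega^2}\Big\},$$ $$\eta\le\min\Big\{\tfrac\gamma L\min\big\{\sqrt{\tfrac{1-\beta}{\beta n}}\tfrac{\sqrt{\gamma\rho^3}}{45},\tfrac{\rho^2}{240\bar\omega}\big\},\ \sqrt{\tfrac{\bar\beta n}{8\mathbb C_{\bar g}}}\Big\}$$ (if $L=0$, the bounds on $\eta$ are void). **Claim.** (i) For admissible $(\eta,\gamma,\beta)$, the expectations that appear below are finite, and for every $t\ge1$ $$\Delta^t+\frac{2L^2\eta}{\bar\beta n}\sum_{i=1}^n\mathbb E\|\theta_i^t-\bar\theta^t\|^2\le(1-\tilde\beta)^t\Big(\Delta^0+\frac{2\eta}{\bar\beta n}{\tt V}^0\Big)+\frac{\eta\beta^2}{\bar\beta\tilde\beta}\frac{2\mathbb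 C_\sigma\sigma^2}{n},$$ where $${\tt V}^0\le\frac{2\sigma^2}{b_0}+\frac{192L^2n}{\rho^2\gamma^2(1-\gamma)}\overline G_0\eta^2 .$$ (ii) Fix $\gamma\in(0,1]$ with $\gamma\le\gamma_\infty$, and let $\eta=\eta_T$ and $\beta=\beta_T$ depend on the horizon $T$ so that, for some constants $c_\eta,c_\beta$ and all large $T$, $\frac{\log T}{\mu T}\le\eta_T\le c_\eta\frac{\log T}T$ and $\frac{2\log T}T\le\beta_T\le c_\beta\frac{\log T}T$. Then there are $C$ and $T_0$, not depending on $b_0\ge1$, such that for all $T\ge T_0$ the parameters $(\eta_T,\gamma,\beta_T)$ are admissible and the algorithm run with them satisfies $$\mathbb E[f(\bar\theta^T)]-f^\star\le C\,\frac{\log T}T,\qquad \frac1n\sum_{i=1}^n\mathbb E\|\theta_i^T-\bar\theta^T\|^2\le C\,\frac{\log T}T .$$ (iii) For every $\beta\in(0,1)$ there are $\eta,\gamma$ such that $(\eta,\gamma,\beta)$ is admissible. If $\sigma=0$, then for every (fixed) admissible $(\eta,\gamma,\beta)$ one has $\tilde\beta\in(0,1)$ and there is a constant $C$, not depending on $b_0$,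 with $\mathbb E[f(\bar\theta^T)]-f^\star\le C(1-\tilde\beta)^T$ for all $T\ge0$. -/

import Mathlib

open MeasureTheory ProbabilityTheory Filter

universe u v w

noncomputable section

/-- The parameter space `ℝ^d` with the Euclidean norm. -/
abbrev Vec (d : ℕ) : Type := EuclideanSpace ℝ (Fin d)

/-! ### Families of `n` vectors, i.e. `n × d` matrices given by their rows -/

/-- The average row `n⁻¹ 𝟏ᵀ X`. -/
def rowAvg {n d : ℕ} (X : Fin n → Vec d) : Vec d := (n : ℝ)⁻¹ • ∑ i, X i

/-- The squared Frobenius norm. -/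
def frobSq {m d : ℕ} (X : Fin m → Vec d) : ℝ := ∑ i, ‖X i‖ ^ 2

/-- The matrix product `A X`. -/
def leftMul {m n d : ℕ} (A : Matrix (Fin m) (Fin n) ℝ) (X : Fin n → Vec d) : Fin m → Vec d :=
  fun k => ∑ i, A k i • X i

/-- The spectral norm of a square matrix. -/
def specNorm {n : ℕ} (A : Matrix (Fin n) (Fin n) ℝ) : ℝ :=
  ‖Matrix.toEuclideanCLM (n := Fin n) (𝕜 := ℝ) A‖

/-! ### The stochastic optimization problem -/

section Problem

variable {n d : ℕ} {Z : Type u} [MeasurableSpace Z]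

/-- The stochastic gradient `∇ f_i(θ; z)` (gradient in `θ`). -/
def stochGrad (F : Fin n → Vec d → Z → ℝ) (i : Fin n) (θ : Vec d) (z : Z) : Vec d :=
  gradient (fun x => F i x z) θ

/-- The local objective `f_i(θ) = E_{ζ ∼ D_i} f_i(θ; ζ)`. -/
def localObj (F : Fin n → Vec d → Z → ℝ) (D : Fin n → Measure Z) (i : Fin n) (θ : Vec d) : ℝ :=
  ∫ z, F i θ z ∂(D i)

/-- The objective `f = n⁻¹ ∑ f_i`. -/
def avgObj (F : Fin n → Vec d → Z → ℝ) (D : Fin n → Measure Z) (θ : Vec d) : ℝ :=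
  (n : ℝ)⁻¹ * ∑ i, localObj F D i θ

/-- The optimal value `f⋆`. -/
def optVal (F : Fin n → Vec d → Z → ℝ) (D : Fin n → Measure Z) : ℝ := ⨅ θ, avgObj F D θ

/-- Standing regularity: the sample losses are integrable, the stochastic gradients are jointly
measurable, the local objectives are continuously differentiable and `f` is bounded below. -/
structure IsStochasticProblem (F : Fin n → Vec d → Z → ℝ) (D : Fin n → Measure Z) : Prop where
  integrable : ∀ i θ, Integrable (F i θ) (D i)
  measurable_grad : ∀ i, Measurable fun p : Vec d × Z => stochGrad F i p.1 p.2
  contDiff : ∀ i, ContDiff ℝ 1 (localObj F D i)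
  bddBelow : BddBelow (Set.range (avgObj F D))

/-- For almost every sample, `f_i(·; ζ)` is differentiable with `L`-Lipschitz gradient. -/
structure HasLipschitzSampleGradients (F : Fin n → Vec d → Z → ℝ) (D : Fin n → Measure Z)
    (L : ℝ) : Prop where
  nonneg : 0 ≤ L
  differentiable : ∀ i, ∀ᵐ z ∂(D i), Differentiable ℝ fun θ => F i θ z
  lipschitz : ∀ i, ∀ᵐ z ∂(D i), ∀ θ θ' : Vec d,
    ‖stochGrad F i θ z - stochGrad F i θ' z‖ ≤ L * ‖θ - θ'‖

/-- The stochastic gradients are unbiased with variance at most `σ²`. -/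
structure HasUnbiasedGradients (F : Fin n → Vec d → Z → ℝ) (D : Fin n → Measure Z)
    (σ : ℝ) : Prop where
  nonneg : 0 ≤ σ
  unbiased : ∀ i θ, ∫ z, stochGrad F i θ z ∂(D i) = gradient (localObj F D i) θ
  variance : ∀ i θ, ∫⁻ z, ‖stochGrad F i θ z - gradient (localObj F D i) θ‖ₑ ^ 2 ∂(D i)
    ≤ ENNReal.ofReal (σ ^ 2)

/-- The Polyak–Łojasiewicz condition with constant `μ > 0`. -/
structure IsPL (F : Fin n → Vec d → Z → ℝ) (D : Fin n → Measure Z) (μ : ℝ) : Prop where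
  pos : 0 < μ
  pl : ∀ θ, 2 * μ * (avgObj F D θ - optVal F D) ≤ ‖gradient (avgObj F D) θ‖ ^ 2

end Problem

/-- `W` is a mixing matrix for the undirected graph `G` (self-loops are always allowed), with
`U` an orthonormal basis (as columns) of the complement of `𝟏`, and constants `ρ`, `ωb`. -/
structure IsMixing {n : ℕ} (G : SimpleGraph (Fin n)) (W : Matrix (Fin n) (Fin n) ℝ)
    (U : Matrix (Fin n) (Fin (n - 1)) ℝ) (ρ ωb : ℝ) : Prop where
  nonneg : ∀ i j, 0 ≤ W i j
  graph : ∀ i j, i ≠ j → ¬ G.Adj i j → W i j = 0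
  row_sum : ∀ i, ∑ j, W i j = 1
  col_sum : ∀ j, ∑ i, W i j = 1
  U_orthonormal : U.transpose * U = 1
  U_proj : U * U.transpose = 1 - Matrix.of fun _ _ => (n : ℝ)⁻¹
  rho_pos : 0 < ρ
  rho_le : ρ ≤ 1
  mixing : specNorm (U.transpose * W * U) ≤ 1 - ρ
  omega_pos : 0 < ωb
  omega_le : ωb ≤ 2
  eigen : specNorm (W - 1) ≤ ωb

/-- The random compressor `x ↦ Q x ξ`, `ξ ∼ κ x`, is a contraction in mean square. -/
structure IsCompressor {d : ℕ} {Ξ : Type v} [MeasurableSpace Ξ] (κ : Kernel (Vec d) Ξ)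
    (Q : Vec d → Ξ → Vec d) (δ : ℝ) : Prop where
  measurable : Measurable fun p : Vec d × Ξ => Q p.1 p.2
  delta_pos : 0 < δ
  delta_le : δ ≤ 1
  contraction : ∀ x, ∫⁻ ξ, ‖x - Q x ξ‖ₑ ^ 2 ∂(κ x) ≤ ENNReal.ofReal ((1 - δ) * ‖x‖ ^ 2)

/-! ### The algorithm -/

/-- The variables of all agents: `θ_i`, `θ̂_i`, `v_i`, `g_i`, `ĝ_i`. -/
structure AgentState (n d : ℕ) where
  θ : Fin n → Vec d
  θhat : Fin n → Vec d
  v : Fin n → Vec d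
  g : Fin n → Vec d
  ghat : Fin n → Vec d

/-- The random draws: `ζ0 i r` is the `r`-th sample of agent `i` in the initial batch, and in
iteration `t` (which produces the iterates with index `t + 1`) agent `i` uses the data sample
`ζ t i` and the compressor seeds `ξθ t i` and `ξg t i`. -/
structure Draws (Ω : Type w) (Z : Type u) (Ξ : Type v) (n b : ℕ) where
  ζ0 : Fin n → Fin b → Ω → Z
  ζ : ℕ → Fin n → Ω → Z
  ξθ : ℕ → Fin n → Ω → Ξ
  ξg : ℕ → Fin n → Ω → Ξ

section Algorithm

variable {n d b : ℕ} {Z : Type u} {Ξ : Type v}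

/-- Initialization from the common point `θ₀` and the initial batch. -/
def initState (F : Fin n → Vec d → Z → ℝ) (θ₀ : Vec d) (z : Fin n → Fin b → Z) :
    AgentState n d where
  θ := fun _ => θ₀
  θhat := fun _ => θ₀
  v := fun i => (b : ℝ)⁻¹ • ∑ r, stochGrad F i θ₀ (z i r)
  g := fun i => (b : ℝ)⁻¹ • ∑ r, stochGrad F i θ₀ (z i r)
  ghat := fun _ => 0

/-- The argument `θ_i - η g_i - θ̂_i` of the first compression. -/
def thetaResidual (η : ℝ) (s : AgentState n d) (i : Fin n) : Vec d :=
  s.θ i - η • s.g i - s.θhat i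

def thetaHatNext (Q : Vec d → Ξ → Vec d) (η : ℝ) (s : AgentState n d) (ξ : Fin n → Ξ)
    (i : Fin n) : Vec d :=
  s.θhat i + Q (thetaResidual η s i) (ξ i)

def thetaNext (W : Matrix (Fin n) (Fin n) ℝ) (Q : Vec d → Ξ → Vec d) (η γ : ℝ)
    (s : AgentState n d) (ξ : Fin n → Ξ) (i : Fin n) : Vec d :=
  s.θ i - η • s.g i + γ • ∑ j, W i j • (thetaHatNext Q η s ξ j - thetaHatNext Q η s ξ i)

/-- The momentum update, with new iterates `θ'` and samples `z`. -/
def vNext (F : Fin n → Vec d → Z → ℝ) (β : ℝ) (s : AgentState n d) (θ' : Fin n → Vec d)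
    (z : Fin n → Z) (i : Fin n) : Vec d :=
  β • stochGrad F i (θ' i) (z i) +
    (1 - β) • (s.v i + stochGrad F i (θ' i) (z i) - stochGrad F i (s.θ i) (z i))

/-- The argument `g_i + v_i' - v_i - ĝ_i` of the second compression. -/
def gResidual (s : AgentState n d) (v' : Fin n → Vec d) (i : Fin n) : Vec d :=
  s.g i + v' i - s.v i - s.ghat i

def gHatNext (Q : Vec d → Ξ → Vec d) (s : AgentState n d) (v' : Fin n → Vec d)
    (ξ : Fin n → Ξ) (i : Fin n) : Vec d :=
  s.ghat i + Q (gResidual s v' i) (ξ i)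

def gNext (W : Matrix (Fin n) (Fin n) ℝ) (Q : Vec d → Ξ → Vec d) (γ : ℝ)
    (s : AgentState n d) (v' : Fin n → Vec d) (ξ : Fin n → Ξ) (i : Fin n) : Vec d :=
  s.g i + v' i - s.v i + γ • ∑ j, W i j • (gHatNext Q s v' ξ j - gHatNext Q s v' ξ i)

/-- One iteration, with data samples `z` and compressor seeds `ξ₁`, `ξ₂`. -/
def stepState (F : Fin n → Vec d → Z → ℝ) (W : Matrix (Fin n) (Fin n) ℝ)
    (Q : Vec d → Ξ → Vec d) (η γ β : ℝ) (s : AgentState n d)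
    (ξ₁ : Fin n → Ξ) (z : Fin n → Z) (ξ₂ : Fin n → Ξ) : AgentState n d where
  θ := thetaNext W Q η γ s ξ₁
  θhat := thetaHatNext Q η s ξ₁
  v := vNext F β s (thetaNext W Q η γ s ξ₁) z
  g := gNext W Q γ s (vNext F β s (thetaNext W Q η γ s ξ₁) z) ξ₂
  ghat := gHatNext Q s (vNext F β s (thetaNext W Q η γ s ξ₁) z) ξ₂

variable {Ω : Type w}

/-- The state of DoCoM-SGT after `t` iterations. -/
def docom (F : Fin n → Vec d → Z → ℝ) (W : Matrix (Fin n) (Fin n) ℝ)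
    (Q : Vec d → Ξ → Vec d) (θ₀ : Vec d) (η γ β : ℝ) (R : Draws Ω Z Ξ n b) :
    ℕ → Ω → AgentState n d
  | 0, o => initState F θ₀ fun i r => R.ζ0 i r o
  | t + 1, o => stepState F W Q η γ β (docom F W Q θ₀ η γ β R t o)
      (fun i => R.ξθ t i o) (fun i => R.ζ t i o) (fun i => R.ξg t i o)

/-- The averaged iterate `θ̄^t`. -/
def thetaBar (F : Fin n → Vec d → Z → ℝ) (W : Matrix (Fin n) (Fin n) ℝ)
    (Q : Vec d → Ξ → Vec d) (θ₀ : Vec d) (η γ β : ℝ) (R : Draws Ω Z Ξ n b)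
    (t : ℕ) (o : Ω) : Vec d :=
  rowAvg (docom F W Q θ₀ η γ β R t o).θ

end Algorithm

/-! ### The law of the random draws -/

section Sampling

variable {n d b : ℕ} {Z : Type u} {Ξ : Type v} {Ω : Type w}
  [MeasurableSpace Z] [MeasurableSpace Ξ]

/-- The σ-algebra of everything drawn before iteration `t`. -/
abbrev Draws.past (R : Draws Ω Z Ξ n b) : ℕ → MeasurableSpace Ω
  | 0 => ⨆ i, ⨆ r, MeasurableSpace.comap (R.ζ0 i r) inferInstance
  | t + 1 => R.past t ⊔ (⨆ i, MeasurableSpace.comap (R.ξθ t i) inferInstance)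
      ⊔ (⨆ i, MeasurableSpace.comap (R.ζ t i) inferInstance)
      ⊔ (⨆ i, MeasurableSpace.comap (R.ξg t i) inferInstance)

/-- Everything drawn before the data samples of iteration `t`. -/
abbrev Draws.pastData (R : Draws Ω Z Ξ n b) (t : ℕ) : MeasurableSpace Ω :=
  R.past t ⊔ (⨆ i, MeasurableSpace.comap (R.ξθ t i) inferInstance)

/-- Everything drawn before the second compression of iteration `t`. -/
abbrev Draws.pastG (R : Draws Ω Z Ξ n b) (t : ℕ) : MeasurableSpace Ω :=
  R.pastData t ⊔ (⨆ i, MeasurableSpace.comap (R.ζ t i) inferInstance)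

/-- The conditional law of `X` given the σ-algebra `m` is the random measure `ν`. -/
def HasCondLaw {S : Type*} [MeasurableSpace S] {mΩ : MeasurableSpace Ω} (P : Measure Ω)
    (m : MeasurableSpace Ω) (X : Ω → S) (ν : Ω → Measure S) : Prop :=
  ∀ B : Set Ω, MeasurableSet[m] B → ∀ A : Set S, MeasurableSet A →
    P (B ∩ X ⁻¹' A) = ∫⁻ o in B, ν o A ∂P

/-- The draws follow the sampling scheme of the algorithm: the initial batches are independent
samples from the `D i`; each compressor call at a point `x` uses a seed with conditional law
`κ x` given everything drawn before (the seeds of different agents in the same compression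
round may be dependent); and the data samples of an iteration are
independent samples from the `D i`, independent of everything drawn before. -/
structure IsSampling [MeasurableSpace Ω] (P : Measure Ω) (F : Fin n → Vec d → Z → ℝ)
    (D : Fin n → Measure Z) (W : Matrix (Fin n) (Fin n) ℝ) (κ : Kernel (Vec d) Ξ)
    (Q : Vec d → Ξ → Vec d) (θ₀ : Vec d) (η γ β : ℝ) (R : Draws Ω Z Ξ n b) : Prop where
  measurable_ζ0 : ∀ i r, Measurable (R.ζ0 i r)
  measurable_ζ : ∀ t i, Measurable (R.ζ t i)
  measurable_ξθ : ∀ t i, Measurable (R.ξθ t i)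
  measurable_ξg : ∀ t i, Measurable (R.ξg t i)
  law_init : P.map (fun o i r => R.ζ0 i r o) =
    Measure.pi fun i : Fin n => Measure.pi fun _ : Fin b => D i
  law_ξθ : ∀ t i, HasCondLaw P (R.past t) (R.ξθ t i) fun o =>
    κ (thetaResidual η (docom F W Q θ₀ η γ β R t o) i)
  law_ζ : ∀ t, HasCondLaw P (R.pastData t) (fun o i => R.ζ t i o) fun _ => Measure.pi D
  law_ξg : ∀ t i, HasCondLaw P (R.pastG t) (R.ξg t i) fun o =>
    κ (gResidual (docom F W Q θ₀ η γ β R t o) (docom F W Q θ₀ η γ β R (t + 1) o).v i)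

end Sampling

/-! ### Constants and step sizes -/

/-- `β̄`. -/
def betaBar (ρ δ γ β : ℝ) : ℝ := min (ρ * γ / 8) (min (δ * γ / 8) β)

/-- `β̃`. -/
def betaTilde (ρ δ μ η γ β : ℝ) : ℝ := min (η * μ) (betaBar ρ δ γ β / 2)

/-- `ℂ_σ`. -/
def cSigma (n : ℕ) (L ρ ωb δ η γ : ℝ) : ℝ :=
  4 + η ^ 2 / γ ^ 3 * (672 * L ^ 2 * n / ρ ^ 3)
    + η ^ 2 / γ * (6 * L ^ 2 * n * ρ ^ 4 * δ / (25 * ωb ^ 2))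
    + η ^ 2 / γ ^ 2 * (4 * L ^ 2 * n / ωb ^ 2)

/-- `ℂ_ḡ`. -/
def cGbar (n : ℕ) (L ρ ωb γ β : ℝ) : ℝ :=
  8 * (1 - β) ^ 2 * L ^ 2 * (1 - ρ * γ) ^ 2
    + L ^ 2 * n / (ρ * γ) * (96 + 141 / 400 * (ρ ^ 2 / ωb ^ 2))

/-- `γ_∞`, which depends on `γ` itself through its last term. -/
def gammaInf (n : ℕ) (ρ ωb δ γ : ℝ) : ℝ :=
  min (1 / (4 * ρ)) (min (ρ * n / (64 * ωb ^ 2))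
    (min (δ / (10 * ωb)) (δ * ρ * √(1 - γ) / (259 * ωb ^ 2))))

/-- `η_∞`. -/
def etaInf (n : ℕ) (L ρ ωb γ β : ℝ) : ℝ :=
  γ / L * min (√((1 - β) / (β * n)) * (√(γ * ρ ^ 3) / 45)) (ρ ^ 2 / (240 * ωb))

/-- The step-size condition. If `L = 0`, both upper bounds on `η` are read as `+∞`. -/
structure StepSizes (n : ℕ) (L ρ ωb δ η γ β : ℝ) : Prop where
  eta_pos : 0 < η
  gamma_pos : 0 < γ
  gamma_le_one : γ ≤ 1
  beta_pos : 0 < β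
  beta_lt_one : β < 1
  gamma_le : γ ≤ gammaInf n ρ ωb δ γ
  eta_le : 0 < L → η ≤ min (etaInf n L ρ ωb γ β)
    (√(betaBar ρ δ γ β * n / (8 * cGbar n L ρ ωb γ β)))

/-! ### The Lyapunov function -/

/-- The weights `a`, `b`, `c`. -/
def lyapA (L ρ η γ : ℝ) : ℝ := 96 * L ^ 2 / (ρ ^ 2 * γ ^ 2) * η ^ 2

def lyapB (L ρ ωb δ η γ : ℝ) : ℝ :=
  η ^ 2 / (γ * (1 - γ)) * (3072 * ωb ^ 2 * L ^ 2 / (δ * ρ ^ 3))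

def lyapC (L ρ ωb δ γ : ℝ) : ℝ := γ / (1 - γ) * (48 * L ^ 2 * ωb ^ 2 / (δ * ρ))

/-- The quantity whose expectation is the Lyapunov function `V`. -/
def lyapState {n d : ℕ} {Z : Type u} [MeasurableSpace Z] (F : Fin n → Vec d → Z → ℝ)
    (D : Fin n → Measure Z) (U : Matrix (Fin n) (Fin (n - 1)) ℝ) (L ρ ωb δ η γ : ℝ)
    (s : AgentState n d) : ℝ :=
  L ^ 2 * frobSq (leftMul U.transpose s.θ)
    + n * ‖rowAvg s.v - rowAvg fun i => gradient (localObj F D i) (s.θ i)‖ ^ 2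
    + (n : ℝ)⁻¹ * frobSq (fun i => s.v i - gradient (localObj F D i) (s.θ i))
    + lyapA L ρ η γ * frobSq (leftMul U.transpose s.g)
    + lyapB L ρ ωb δ η γ * frobSq (fun i => s.g i - s.ghat i)
    + lyapC L ρ ωb δ γ * frobSq (fun i => s.θ i - η • s.g i - s.θhat i)

end

/-! ### Frobenius norms and mixing -/

/-! Gossip does not move averages: the columns of `W - 1` sum to zero, so θ̄ makes the exact step θ̄
- ηḡ, and v⁰ = g⁰ propagates to v̄ = ḡ (`thetaBar_succ`, `rowAvg_v_docom`). The averaged iterate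
thus performs inexact gradient descent, and smoothness together with the Polyak–Łojasiewicz
inequality (`avgObj_step_le`) yields, in expectation, Δ' ≤ (1 - ημ)Δ - (η/4)‖ḡ‖² + (η/n)(n‖v̄ - avg
∇F‖² + L²‖UᵀΘ‖²). The negative term is kept, since it pays later for the displacement of the
iterates.

The bracket is controlled through six mean square errors: the disagreement of Θ and of G, the error
of the gradient estimator averaged and per agent, and the two compression residuals. For a quantity
Y with compressed copy Ŷ, the step Y + γ(W-1)Ŷ is exact gossip on Y, which shrinks disagreement by 1
- ργ, minus γ(W-1)(Y - Ŷ); and the new residual is (1 - γ(W-1))(Y - Ŷ) plus a drift. Young's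
inequality, with parameters small against ργ or δ, turns this into pathwise bounds. The momentum
estimator obeys v' - ∇F(θ') = (1-β)(v - ∇F(θ)) + centred noise of variance at most 2β²σ² +
2(1-β)²L²‖θ' - θ‖² per agent; orthogonality makes its error contract, and independence of the agents
divides the variance of the average by n. Conditional laws (`HasCondLaw.integral_le`) convert all
this into the expectation inequalities `StepBounds`.

The weighted sum V of the six errors contracts by 1 - β̄, up to ℂ_σβ²σ² and η²ℂ_ḡ‖ḡ‖²
(`StepBounds.lyapunov_le`): the weights are scaled so that each cross term is a small fraction of
the decay of the error it feeds. This uses ρ ≤ ω̄, which holds only for n ≥ 2; a single agent needs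
just the two estimator errors, and `exists_lyapunov` hides the case distinction.

Finally Δ + wV with w = 2η/(β̄n) is a joint Lyapunov function: (η/n)V is half of the decay of wV,
and the second bound on η gives wη²ℂ_ḡ ≤ η/4, so ‖ḡ‖² cancels. Iteration proves (i), and (ii) and
(iii) follow by inserting the step sizes into bounds that are uniform in the batch size. -/

theorem norm_add_sq_le_young {E : Type*} [SeminormedAddCommGroup E] (x y : E) {α : ℝ}
    (hα : 0 < α) : ‖x + y‖ ^ 2 ≤ (1 + α) * ‖x‖ ^ 2 + (1 + α⁻¹) * ‖y‖ ^ 2 := by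
  have h1 := norm_add_le x y
  have h2 : ‖x + y‖ ^ 2 ≤ (‖x‖ + ‖y‖) ^ 2 := by gcongr
  have h3 : 0 ≤ α⁻¹ * (α * ‖x‖ - ‖y‖) ^ 2 := by positivity
  have h4 : α⁻¹ * (α * ‖x‖ - ‖y‖) ^ 2 = α * ‖x‖ ^ 2 - 2 * ‖x‖ * ‖y‖ + α⁻¹ * ‖y‖ ^ 2 := by
    field_simp
    ring
  nlinarith

theorem norm_add_sq_le_two {E : Type*} [SeminormedAddCommGroup E] (x y : E) :
    ‖x + y‖ ^ 2 ≤ 2 * ‖x‖ ^ 2 + 2 * ‖y‖ ^ 2 := by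
  have := norm_add_sq_le_young x y one_pos
  norm_num at this
  linarith

theorem norm_add_add_sq_le {E : Type*} [SeminormedAddCommGroup E] (x y z : E) :
    ‖x + y + z‖ ^ 2 ≤ 3 * ‖x‖ ^ 2 + 3 * ‖y‖ ^ 2 + 3 * ‖z‖ ^ 2 := by
  have h1 : ‖x + y + z‖ ≤ ‖x‖ + ‖y‖ + ‖z‖ := norm_add₃_le
  have h2 : ‖x + y + z‖ ^ 2 ≤ (‖x‖ + ‖y‖ + ‖z‖) ^ 2 := by gcongr
  nlinarith [sq_nonneg (‖x‖ - ‖y‖), sq_nonneg (‖y‖ - ‖z‖), sq_nonneg (‖x‖ - ‖z‖)]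

section Frobenius

variable {l m n d : ℕ}

theorem frobSq_nonneg (X : Fin m → Vec d) : 0 ≤ frobSq X :=
  Finset.sum_nonneg fun _ _ => by positivity

theorem frobSq_smul (c : ℝ) (X : Fin m → Vec d) : frobSq (c • X) = c ^ 2 * frobSq X := by
  simp [frobSq, norm_smul, mul_pow, Finset.mul_sum]

theorem frobSq_neg (X : Fin m → Vec d) : frobSq (-X) = frobSq X := by simp [frobSq]

theorem frobSq_add_le (X Y : Fin m → Vec d) {α : ℝ} (hα : 0 < α) :
    frobSq (X + Y) ≤ (1 + α) * frobSq X + (1 + α⁻¹) * frobSq Y := by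
  simp only [frobSq, Finset.mul_sum, ← Finset.sum_add_distrib]
  exact Finset.sum_le_sum fun i _ => norm_add_sq_le_young _ _ hα

theorem frobSq_add_le_two (X Y : Fin m → Vec d) :
    frobSq (X + Y) ≤ 2 * frobSq X + 2 * frobSq Y := by
  simp only [frobSq, Finset.mul_sum, ← Finset.sum_add_distrib]
  exact Finset.sum_le_sum fun i _ => norm_add_sq_le_two _ _

theorem frobSq_add_add_le (X Y Z : Fin m → Vec d) :
    frobSq (X + Y + Z) ≤ 3 * frobSq X + 3 * frobSq Y + 3 * frobSq Z := by
  simp only [frobSq, Finset.mul_sum, ← Finset.sum_add_distrib]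
  exact Finset.sum_le_sum fun i _ => norm_add_add_sq_le _ _ _

theorem leftMul_add (A : Matrix (Fin m) (Fin n) ℝ) (X Y : Fin n → Vec d) :
    leftMul A (X + Y) = leftMul A X + leftMul A Y := by
  funext k
  simp [leftMul, Finset.sum_add_distrib]

theorem leftMul_smul (A : Matrix (Fin m) (Fin n) ℝ) (c : ℝ) (X : Fin n → Vec d) :
    leftMul A (c • X) = c • leftMul A X := by
  funext k
  simp [leftMul, Finset.smul_sum, smul_comm c]

theorem leftMul_neg (A : Matrix (Fin m) (Fin n) ℝ) (X : Fin n → Vec d) :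
    leftMul A (-X) = -leftMul A X := by
  simpa using leftMul_smul A (-1) X

theorem leftMul_sub (A : Matrix (Fin m) (Fin n) ℝ) (X Y : Fin n → Vec d) :
    leftMul A (X - Y) = leftMul A X - leftMul A Y := by
  rw [sub_eq_add_neg, leftMul_add, leftMul_neg, sub_eq_add_neg]

theorem add_leftMul (A B : Matrix (Fin m) (Fin n) ℝ) (X : Fin n → Vec d) :
    leftMul (A + B) X = leftMul A X + leftMul B X := by
  funext k
  simp [leftMul, add_smul, Finset.sum_add_distrib]

theorem sub_leftMul (A B : Matrix (Fin m) (Fin n) ℝ) (X : Fin n → Vec d) :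
    leftMul (A - B) X = leftMul A X - leftMul B X := by
  funext k
  simp [leftMul, sub_smul, Finset.sum_sub_distrib]

theorem smul_leftMul (c : ℝ) (A : Matrix (Fin m) (Fin n) ℝ) (X : Fin n → Vec d) :
    leftMul (c • A) X = c • leftMul A X := by
  funext k
  simp [leftMul, Finset.smul_sum, mul_smul]

theorem one_leftMul (X : Fin n → Vec d) : leftMul (1 : Matrix (Fin n) (Fin n) ℝ) X = X := by
  funext k
  simp [leftMul, Matrix.one_apply, ite_smul]

theorem mul_leftMul (A : Matrix (Fin l) (Fin m) ℝ) (B : Matrix (Fin m) (Fin n) ℝ)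
    (X : Fin n → Vec d) : leftMul (A * B) X = leftMul A (leftMul B X) := by
  funext k
  simp only [leftMul, Matrix.mul_apply, Finset.sum_smul, Finset.smul_sum, smul_smul]
  exact Finset.sum_comm

/-- The `k`-th column of the matrix with rows `X i`. -/
def colVec (X : Fin n → Vec d) (k : Fin d) : EuclideanSpace ℝ (Fin n) :=
  WithLp.toLp 2 fun i => X i k

theorem frobSq_eq_sum_colVec (X : Fin n → Vec d) : frobSq X = ∑ k, ‖colVec X k‖ ^ 2 := by
  simp only [frobSq, EuclideanSpace.norm_sq_eq, colVec]
  exact Finset.sum_comm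

theorem colVec_leftMul (A : Matrix (Fin n) (Fin n) ℝ) (X : Fin n → Vec d) (k : Fin d) :
    colVec (leftMul A X) k = Matrix.toEuclideanCLM (n := Fin n) (𝕜 := ℝ) A (colVec X k) := by
  ext i
  simp [colVec, leftMul, Matrix.mulVec, dotProduct]

/-- Left multiplication acts on each column separately, and the Frobenius norm is the ℓ² sum of the
column norms, so the operator norm bound applies column by column. -/
theorem frobSq_leftMul_le (A : Matrix (Fin n) (Fin n) ℝ) (X : Fin n → Vec d) :
    frobSq (leftMul A X) ≤ specNorm A ^ 2 * frobSq X := by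
  rw [frobSq_eq_sum_colVec, frobSq_eq_sum_colVec, Finset.mul_sum]
  refine Finset.sum_le_sum fun k _ => ?_
  rw [colVec_leftMul, ← mul_pow]
  gcongr
  exact ContinuousLinearMap.le_opNorm _ _

theorem frobSq_leftMul_le_of_le {A : Matrix (Fin n) (Fin n) ℝ} {c : ℝ} (h : specNorm A ≤ c)
    (X : Fin n → Vec d) : frobSq (leftMul A X) ≤ c ^ 2 * frobSq X := by
  refine (frobSq_leftMul_le A X).trans ?_
  have := frobSq_nonneg X
  have : 0 ≤ specNorm A := norm_nonneg _
  gcongr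

theorem specNorm_add_le (A B : Matrix (Fin n) (Fin n) ℝ) :
    specNorm (A + B) ≤ specNorm A + specNorm B := by
  simp only [specNorm, map_add]
  exact norm_add_le _ _

theorem specNorm_smul (c : ℝ) (A : Matrix (Fin n) (Fin n) ℝ) :
    specNorm (c • A) = |c| * specNorm A := by
  simp only [specNorm, map_smul, norm_smul, Real.norm_eq_abs]

theorem specNorm_one_le : specNorm (1 : Matrix (Fin n) (Fin n) ℝ) ≤ 1 := by
  simp only [specNorm, map_one]
  exact ContinuousLinearMap.norm_id_le

/-- ⟨AX, AX⟩ = ⟨X, AᵀAX⟩. This treats the rectangular matrices `U` and `Uᵀ`, for which `specNorm` is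
not available. -/
theorem frobSq_leftMul_eq_sum_inner (A : Matrix (Fin m) (Fin n) ℝ) (X : Fin n → Vec d) :
    frobSq (leftMul A X) = ∑ i, inner ℝ (X i) (leftMul (A.transpose * A) X i) := by
  simp only [frobSq, leftMul, ← real_inner_self_eq_norm_sq, sum_inner, inner_sum,
    Matrix.mul_apply, Matrix.transpose_apply, Finset.sum_smul, inner_smul_left, inner_smul_right,
    RCLike.conj_to_real]
  rw [Finset.sum_comm]
  refine Finset.sum_congr rfl fun i _ => ?_
  rw [Finset.sum_comm]
  refine Finset.sum_congr rfl fun j _ => ?_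
  rw [Finset.mul_sum]
  refine Finset.sum_congr rfl fun k _ => ?_
  rw [real_inner_comm]
  ring

theorem rowAvg_add (X Y : Fin n → Vec d) : rowAvg (X + Y) = rowAvg X + rowAvg Y := by
  simp [rowAvg, Finset.sum_add_distrib]

theorem rowAvg_smul (c : ℝ) (X : Fin n → Vec d) : rowAvg (c • X) = c • rowAvg X := by
  simp [rowAvg, ← Finset.smul_sum, smul_comm c]

theorem rowAvg_sub (X Y : Fin n → Vec d) : rowAvg (X - Y) = rowAvg X - rowAvg Y := by
  simp [rowAvg, Finset.sum_sub_distrib, smul_sub]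

theorem sum_norm_sub_rowAvg_sq (X : Fin n → Vec d) :
    ∑ i, ‖X i - rowAvg X‖ ^ 2 = frobSq X - n * ‖rowAvg X‖ ^ 2 := by
  rcases Nat.eq_zero_or_pos n with rfl | hn
  · simp [frobSq]
  have hn' : (n : ℝ) ≠ 0 := by positivity
  have hsum : ∑ i, X i = (n : ℝ) • rowAvg X := by simp [rowAvg, smul_smul, hn']
  simp only [norm_sub_sq_real, Finset.sum_add_distrib, Finset.sum_sub_distrib, frobSq,
    ← Finset.mul_sum, ← sum_inner, hsum, inner_smul_left, real_inner_self_eq_norm_sq]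
  simp
  ring

theorem card_mul_norm_rowAvg_sq_le (X : Fin n → Vec d) : n * ‖rowAvg X‖ ^ 2 ≤ frobSq X := by
  have h := sum_norm_sub_rowAvg_sq X
  have : 0 ≤ ∑ i, ‖X i - rowAvg X‖ ^ 2 := Finset.sum_nonneg fun _ _ => by positivity
  linarith

end Frobenius

/-! ### Disagreement and averaging under a mixing matrix -/

namespace IsMixing

variable {n d : ℕ} {G : SimpleGraph (Fin n)} {W : Matrix (Fin n) (Fin n) ℝ}
  {U : Matrix (Fin n) (Fin (n - 1)) ℝ} {ρ ωb : ℝ}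

theorem frobSq_transpose (h : IsMixing G W U ρ ωb) (X : Fin n → Vec d) :
    frobSq (leftMul U.transpose X) = frobSq X - n * ‖rowAvg X‖ ^ 2 := by
  rw [frobSq_leftMul_eq_sum_inner, Matrix.transpose_transpose, h.U_proj, sub_leftMul, one_leftMul]
  have h1 : ∀ i : Fin n, leftMul (Matrix.of fun (_ _ : Fin n) => (n : ℝ)⁻¹) X i = rowAvg X := by
    intro i
    simp [leftMul, rowAvg, Finset.smul_sum]
  simp only [Pi.sub_apply, h1, inner_sub_right, Finset.sum_sub_distrib, frobSq, ← sum_inner,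
    real_inner_self_eq_norm_sq]
  rcases Nat.eq_zero_or_pos n with rfl | hn
  · simp
  have hn' : (n : ℝ) ≠ 0 := by positivity
  have hsum : ∑ i, X i = (n : ℝ) • rowAvg X := by simp [rowAvg, smul_smul, hn']
  rw [hsum, inner_smul_left, real_inner_self_eq_norm_sq]
  simp

theorem frobSq_transpose_eq_sum (h : IsMixing G W U ρ ωb) (X : Fin n → Vec d) :
    frobSq (leftMul U.transpose X) = ∑ i, ‖X i - rowAvg X‖ ^ 2 := by
  rw [h.frobSq_transpose, sum_norm_sub_rowAvg_sq]

theorem frobSq_eq (h : IsMixing G W U ρ ωb) (X : Fin n → Vec d) :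
    frobSq X = n * ‖rowAvg X‖ ^ 2 + frobSq (leftMul U.transpose X) := by
  rw [h.frobSq_transpose]; ring

theorem frobSq_transpose_le (h : IsMixing G W U ρ ωb) (X : Fin n → Vec d) :
    frobSq (leftMul U.transpose X) ≤ frobSq X := by
  rw [h.frobSq_transpose]
  have : 0 ≤ n * ‖rowAvg X‖ ^ 2 := by positivity
  linarith

theorem frobSq_left (h : IsMixing G W U ρ ωb) (Y : Fin (n - 1) → Vec d) :
    frobSq (leftMul U Y) = frobSq Y := by
  rw [frobSq_leftMul_eq_sum_inner, h.U_orthonormal, one_leftMul]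
  simp [frobSq]

theorem mul_const (h : IsMixing G W U ρ ωb) :
    W * (Matrix.of fun _ _ => (n : ℝ)⁻¹) = Matrix.of fun _ _ => (n : ℝ)⁻¹ := by
  ext i j
  simp [Matrix.mul_apply, ← Finset.sum_mul, h.row_sum]

/-- Orthonormality gives Uᵀ(UUᵀ) = Uᵀ; expanding UUᵀ = 1 - J, with J the averaging matrix, leaves
UᵀJ = 0. -/
theorem transpose_mul_const (h : IsMixing G W U ρ ωb) :
    U.transpose * (Matrix.of fun (_ _ : Fin n) => (n : ℝ)⁻¹) = 0 := by
  have h1 : U.transpose * (U * U.transpose) = U.transpose := by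
    rw [← Matrix.mul_assoc, h.U_orthonormal, Matrix.one_mul]
  rw [h.U_proj, Matrix.mul_sub, Matrix.mul_one] at h1
  simpa using h1

/-- As WJ = J and UᵀJ = 0, gossip descends to the disagreement coordinates, where it acts by the
matrix whose spectral norm is at most 1 - ρ. -/
theorem transpose_mul (h : IsMixing G W U ρ ωb) :
    U.transpose * W = (U.transpose * W * U) * U.transpose := by
  rw [Matrix.mul_assoc (U.transpose * W), h.U_proj, Matrix.mul_sub, Matrix.mul_one,
    Matrix.mul_assoc, h.mul_const, h.transpose_mul_const, sub_zero]

theorem sub_one_eq (h : IsMixing G W U ρ ωb) : W - 1 = (W - 1) * U * U.transpose := by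
  rw [Matrix.mul_assoc, h.U_proj, Matrix.mul_sub, Matrix.mul_one, Matrix.sub_mul, h.mul_const]
  simp

/-- `W - 1` kills constant rows, so it factors through UUᵀ; since `U` is isometric, only the
disagreement of `X` is charged. -/
theorem frobSq_sub_one_le (h : IsMixing G W U ρ ωb) (X : Fin n → Vec d) :
    frobSq (leftMul (W - 1) X) ≤ ωb ^ 2 * frobSq (leftMul U.transpose X) := by
  rw [h.sub_one_eq, Matrix.mul_assoc, mul_leftMul, mul_leftMul, ← h.frobSq_left (leftMul _ X)]
  exact frobSq_leftMul_le_of_le h.eigen _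

theorem frobSq_mix_le (h : IsMixing G W U ρ ωb) {γ : ℝ} (h0 : 0 ≤ γ) (h1 : γ ≤ 1)
    (X : Fin n → Vec d) :
    frobSq (leftMul U.transpose (X + γ • leftMul (W - 1) X))
      ≤ (1 - ρ * γ) ^ 2 * frobSq (leftMul U.transpose X) := by
  have key : leftMul U.transpose (X + γ • leftMul (W - 1) X)
      = leftMul ((1 - γ) • 1 + γ • (U.transpose * W * U)) (leftMul U.transpose X) := by
    rw [leftMul_add, leftMul_smul, sub_leftMul, leftMul_sub, one_leftMul, add_leftMul,
      smul_leftMul, smul_leftMul, one_leftMul, ← mul_leftMul, ← mul_leftMul, ← h.transpose_mul,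
      sub_smul, smul_sub, one_smul]
    abel
  rw [key]
  refine frobSq_leftMul_le_of_le ?_ _
  refine (specNorm_add_le _ _).trans ?_
  rw [specNorm_smul, specNorm_smul, abs_of_nonneg h0, abs_of_nonneg (by linarith)]
  nlinarith [specNorm_one_le (n := n - 1), h.mixing]

theorem frobSq_antimix_le (h : IsMixing G W U ρ ωb) {γ : ℝ} (h0 : 0 ≤ γ)
    (X : Fin n → Vec d) :
    frobSq (X - γ • leftMul (W - 1) X) ≤ (1 + γ * ωb) ^ 2 * frobSq X := by
  have key : X - γ • leftMul (W - 1) X = leftMul (1 + (-γ) • (W - 1)) X := by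
    rw [add_leftMul, one_leftMul, smul_leftMul, neg_smul, sub_eq_add_neg]
  rw [key]
  refine frobSq_leftMul_le_of_le ?_ _
  refine (specNorm_add_le _ _).trans ?_
  rw [specNorm_smul, abs_neg, abs_of_nonneg h0]
  nlinarith [specNorm_one_le (n := n), h.eigen]

/-- On a nonzero disagreement vector Y, W shrinks to at most (1-ρ)‖Y‖ while W - 1 has size at most
ω̄‖Y‖, so ‖Y‖ ≤ (1 - ρ + ω̄)‖Y‖. For n = 1 there is no such Y and the inequality may fail. The
triangle inequality is run on squared norms through Young. -/
theorem rho_le_omega (h : IsMixing G W U ρ ωb) (hn : 2 ≤ n) : ρ ≤ ωb := by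
  obtain ⟨Y, hY⟩ : ∃ Y : Fin (n - 1) → Vec 1, 0 < frobSq Y := by
    refine ⟨fun _ => EuclideanSpace.single 0 1, ?_⟩
    simp [frobSq]
    omega
  have e1 : leftMul U.transpose (leftMul U Y) = Y := by
    rw [← mul_leftMul, h.U_orthonormal, one_leftMul]
  have hA := h.frobSq_sub_one_le (leftMul U Y)
  rw [e1] at hA
  have hB := h.frobSq_transpose_le (leftMul (W - 1) (leftMul U Y))
  have e2 : leftMul U.transpose (leftMul (W - 1) (leftMul U Y))
      = leftMul (U.transpose * W * U) Y - Y := by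
    rw [sub_leftMul, leftMul_sub, one_leftMul, e1, ← mul_leftMul, ← mul_leftMul,
      Matrix.mul_assoc]
  rw [e2] at hB
  have hC := frobSq_leftMul_le_of_le h.mixing Y
  by_contra! hlt
  have hρ := h.rho_pos
  have hω := h.omega_pos
  have hρ1 := h.rho_le
  have hs : specNorm (U.transpose * W * U) ≤ 1 - ρ := h.mixing
  -- choose the Young parameter so that the two contributions balance
  have hY1 := frobSq_add_le (leftMul (U.transpose * W * U) Y) (-(leftMul (U.transpose * W * U) Y - Y))
    (α := (ωb + ρ) / (2 - (ωb + ρ))) (by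
      apply div_pos <;> linarith)
  rw [frobSq_neg] at hY1
  have e3 : leftMul (U.transpose * W * U) Y + -(leftMul (U.transpose * W * U) Y - Y) = Y := by abel
  rw [e3] at hY1
  set q := ωb + ρ with hq
  have hq2 : 0 < 2 - q := by linarith
  have hq0 : 0 < q := by linarith
  have a1 : 1 + q / (2 - q) = 2 / (2 - q) := by field_simp; ring
  have a2 : 1 + (q / (2 - q))⁻¹ = 2 / q := by field_simp; ring
  rw [a1, a2] at hY1
  have hD : frobSq (leftMul (U.transpose * W * U) Y - Y) ≤ ωb ^ 2 * frobSq Y := hB.trans hA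
  have b1 : 2 / (2 - q) * frobSq (leftMul (U.transpose * W * U) Y)
      ≤ 2 / (2 - q) * ((1 - ρ) ^ 2 * frobSq Y) := by gcongr
  have b2 : 2 / q * frobSq (leftMul (U.transpose * W * U) Y - Y)
      ≤ 2 / q * (ωb ^ 2 * frobSq Y) := by gcongr
  -- This amounts to ω̄ + ρ ≤ 2ρ, and `c2` to 2ω̄ < ω̄ + ρ, both from the contrary assumption ω̄ <
  -- ρ. The two constants then add up to less than 1 - ρ + ω̄ < 1.
  have c1 : 2 / (2 - q) * (1 - ρ) ^ 2 ≤ 1 - ρ := by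
    rw [div_mul_eq_mul_div, div_le_iff₀ hq2]
    nlinarith
  have c2 : 2 / q * ωb ^ 2 < ωb := by
    rw [div_mul_eq_mul_div, div_lt_iff₀ hq0]
    nlinarith
  nlinarith [mul_le_mul_of_nonneg_right c1 hY.le, mul_lt_mul_of_pos_right c2 hY]

end IsMixing

/-! ### One compressed gossip step -/

namespace IsMixing

variable {n d : ℕ} {G : SimpleGraph (Fin n)} {W : Matrix (Fin n) (Fin n) ℝ}
  {U : Matrix (Fin n) (Fin (n - 1)) ℝ} {ρ ωb : ℝ}

theorem rowAvg_sub_one (h : IsMixing G W U ρ ωb) (X : Fin n → Vec d) :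
    rowAvg (leftMul (W - 1) X) = 0 := by
  rw [sub_leftMul, one_leftMul, rowAvg_sub]
  have : rowAvg (leftMul W X) = rowAvg X := by
    simp only [rowAvg, leftMul]
    rw [Finset.sum_comm]
    simp only [← Finset.sum_smul, h.col_sum, one_smul]
  rw [this, sub_self]

theorem sum_smul_sub (h : IsMixing G W U ρ ωb) (X : Fin n → Vec d) (i : Fin n) :
    ∑ j, W i j • (X j - X i) = leftMul (W - 1) X i := by
  rw [sub_leftMul, one_leftMul]
  simp [leftMul, smul_sub, Finset.sum_sub_distrib, ← Finset.sum_smul, h.row_sum]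

/-- Gossip with the copy `Yh` is exact gossip on `Y` minus γ(W-1) applied to the compression error
`Y - Yh`. -/
theorem consensus_le (h : IsMixing G W U ρ ωb) {γ : ℝ} (h0 : 0 < γ) (h1 : γ ≤ 1)
    (hp : ρ * γ < 1) (Y Yh : Fin n → Vec d) :
    frobSq (leftMul U.transpose (Y + γ • leftMul (W - 1) Yh))
      ≤ (1 - ρ * γ) * frobSq (leftMul U.transpose Y) + γ * ωb ^ 2 / ρ * frobSq (Y - Yh) := by
  have hρ := h.rho_pos
  have e : Y + γ • leftMul (W - 1) Yh
      = (Y + γ • leftMul (W - 1) Y) + (-γ) • leftMul (W - 1) (Y - Yh) := by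
    rw [leftMul_sub, smul_sub, neg_smul, neg_smul]; abel
  have hp0 : 0 < ρ * γ := by positivity
  have hq : 0 < 1 - ρ * γ := by linarith
  rw [e, leftMul_add]
  -- With this parameter 1 + α = 1/(1 - ργ), which cancels one of the two contraction factors, and 1
  -- + α⁻¹ = 1/(ργ).
  refine (frobSq_add_le _ _ (α := ρ * γ / (1 - ρ * γ)) (by positivity)).trans ?_
  have a1 : 1 + ρ * γ / (1 - ρ * γ) = 1 / (1 - ρ * γ) := by field_simp; ring
  have a2 : 1 + (ρ * γ / (1 - ρ * γ))⁻¹ = 1 / (ρ * γ) := by field_simp; ring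
  rw [a1, a2]
  have b1 := h.frobSq_mix_le h0.le h1 Y
  have b2 : frobSq (leftMul U.transpose ((-γ) • leftMul (W - 1) (Y - Yh)))
      ≤ γ ^ 2 * (ωb ^ 2 * frobSq (Y - Yh)) := by
    rw [leftMul_smul, frobSq_smul, neg_sq]
    have := ((h.frobSq_transpose_le _).trans (h.frobSq_sub_one_le (Y - Yh))).trans
      (mul_le_mul_of_nonneg_left (h.frobSq_transpose_le _) (sq_nonneg ωb))
    gcongr
  calc _ ≤ 1 / (1 - ρ * γ) * ((1 - ρ * γ) ^ 2 * frobSq (leftMul U.transpose Y))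
        + 1 / (ρ * γ) * (γ ^ 2 * (ωb ^ 2 * frobSq (Y - Yh))) := by gcongr
    _ = _ := by field_simp

/-- The old error `Y - Yh` is transported by 1 - γ(W-1), of norm at most 1 + γω̄, and the rest is
drift. `Z` leaves room for the shift -ηg' in the next argument of the θ-compressor. -/
theorem residual_le (h : IsMixing G W U ρ ωb) {γ α : ℝ} (h0 : 0 < γ) (hα : 0 < α)
    (Y Yh Z : Fin n → Vec d) :
    frobSq (Y + γ • leftMul (W - 1) Yh - Yh + Z)
      ≤ (1 + α) * (1 + γ * ωb) ^ 2 * frobSq (Y - Yh)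
        + (1 + α⁻¹) * frobSq (γ • leftMul (W - 1) Y + Z) := by
  have e : Y + γ • leftMul (W - 1) Yh - Yh + Z
      = ((Y - Yh) - γ • leftMul (W - 1) (Y - Yh)) + (γ • leftMul (W - 1) Y + Z) := by
    rw [leftMul_sub, smul_sub]; abel
  rw [e]
  refine (frobSq_add_le _ _ hα).trans ?_
  have := h.frobSq_antimix_le h0.le (Y - Yh)
  rw [mul_assoc]
  gcongr

/-- The average moves by exactly -ηH̄, and Pythagoras separates it from the disagreement part, so
only the latter pays the factor 3 for its three terms: gossip on X, the mixed direction, and the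
compression error. -/
theorem displacement_le (h : IsMixing G W U ρ ωb) {γ η : ℝ} (h0 : 0 < γ) (h1 : γ ≤ 1)
    (X H Yh : Fin n → Vec d) :
    frobSq (X - η • H + γ • leftMul (W - 1) Yh - X)
      ≤ n * η ^ 2 * ‖rowAvg H‖ ^ 2 + 3 * γ ^ 2 * ωb ^ 2 * frobSq (leftMul U.transpose X)
        + 3 * η ^ 2 * frobSq (leftMul U.transpose H)
        + 3 * γ ^ 2 * ωb ^ 2 * frobSq (X - η • H - Yh) := by
  rw [h.frobSq_eq]
  have e1 : rowAvg (X - η • H + γ • leftMul (W - 1) Yh - X) = -(η • rowAvg H) := by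
    rw [rowAvg_sub, rowAvg_add, rowAvg_sub, rowAvg_smul, rowAvg_smul, h.rowAvg_sub_one]
    simp
  have e2 : X - η • H + γ • leftMul (W - 1) Yh - X
      = γ • leftMul (W - 1) X + (-η) • (H + γ • leftMul (W - 1) H)
        + (-γ) • leftMul (W - 1) (X - η • H - Yh) := by
    simp only [leftMul_sub, leftMul_smul, smul_sub, smul_add, neg_smul, smul_comm η γ]
    abel
  rw [e1, e2, norm_neg, norm_smul, mul_pow, Real.norm_eq_abs, sq_abs, leftMul_add, leftMul_add,
    leftMul_smul, leftMul_smul, leftMul_smul U.transpose (-γ)]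
  have b0 := frobSq_add_add_le (γ • leftMul U.transpose (leftMul (W - 1) X))
    ((-η) • leftMul U.transpose (H + γ • leftMul (W - 1) H))
    ((-γ) • leftMul U.transpose (leftMul (W - 1) (X - η • H - Yh)))
  rw [frobSq_smul, frobSq_smul, frobSq_smul, neg_sq, neg_sq] at b0
  have b1 := (h.frobSq_transpose_le _).trans (h.frobSq_sub_one_le X)
  have b2 := (h.frobSq_transpose_le _).trans ((h.frobSq_sub_one_le (X - η • H - Yh)).trans
      (mul_le_mul_of_nonneg_left (h.frobSq_transpose_le _) (sq_nonneg ωb)))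
  have b3 : frobSq (leftMul U.transpose (H + γ • leftMul (W - 1) H))
      ≤ frobSq (leftMul U.transpose H) := by
    refine (h.frobSq_mix_le h0.le h1 H).trans ?_
    have := frobSq_nonneg (leftMul U.transpose H)
    have hρ := h.rho_pos
    have hρ1 := h.rho_le
    have : (1 - ρ * γ) ^ 2 ≤ 1 := by
      have : ρ * γ ≤ 1 := by nlinarith
      have : 0 < ρ * γ := by positivity
      nlinarith
    nlinarith
  have c1 := mul_le_mul_of_nonneg_left b1 (sq_nonneg γ)
  have c2 := mul_le_mul_of_nonneg_left b2 (sq_nonneg γ)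
  have c3 := mul_le_mul_of_nonneg_left b3 (sq_nonneg η)
  linarith

end IsMixing

/-! ### Pathwise inequalities for one iteration -/

section Step

variable {n d : ℕ} {Ξ : Type v} {G : SimpleGraph (Fin n)} {W : Matrix (Fin n) (Fin n) ℝ}
  {U : Matrix (Fin n) (Fin (n - 1)) ℝ} {ρ ωb : ℝ}

/-- The error `R - 𝒬(R)` made by compressing the rows of `R` with seeds `ξ`. -/
def compErr (Q : Vec d → Ξ → Vec d) (R : Fin n → Vec d) (ξ : Fin n → Ξ) : Fin n → Vec d :=
  fun i => R i - Q (R i) (ξ i)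

theorem thetaNext_eq (h : IsMixing G W U ρ ωb) (Q : Vec d → Ξ → Vec d) (η γ : ℝ)
    (s : AgentState n d) (ξ : Fin n → Ξ) :
    thetaNext W Q η γ s ξ
      = s.θ - η • s.g + γ • leftMul (W - 1) (thetaHatNext Q η s ξ) := by
  funext i
  simp [thetaNext, h.sum_smul_sub]

theorem gNext_eq (h : IsMixing G W U ρ ωb) (Q : Vec d → Ξ → Vec d) (γ : ℝ)
    (s : AgentState n d) (v' : Fin n → Vec d) (ξ : Fin n → Ξ) :
    gNext W Q γ s v' ξ
      = s.g + (v' - s.v) + γ • leftMul (W - 1) (gHatNext Q s v' ξ) := by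
  funext i
  simp [gNext, h.sum_smul_sub]
  abel

theorem sub_thetaHatNext (Q : Vec d → Ξ → Vec d) (η : ℝ) (s : AgentState n d)
    (ξ : Fin n → Ξ) :
    s.θ - η • s.g - thetaHatNext Q η s ξ = compErr Q (thetaResidual η s) ξ := by
  funext i
  simp [thetaHatNext, compErr, thetaResidual]
  abel

theorem sub_gHatNext (Q : Vec d → Ξ → Vec d) (s : AgentState n d) (v' : Fin n → Vec d)
    (ξ : Fin n → Ξ) :
    s.g + (v' - s.v) - gHatNext Q s v' ξ = compErr Q (gResidual s v') ξ := by
  funext i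
  simp [gHatNext, compErr, gResidual]
  abel

theorem rowAvg_thetaNext (h : IsMixing G W U ρ ωb) (Q : Vec d → Ξ → Vec d) (η γ : ℝ)
    (s : AgentState n d) (ξ : Fin n → Ξ) :
    rowAvg (thetaNext W Q η γ s ξ) = rowAvg s.θ - η • rowAvg s.g := by
  rw [thetaNext_eq h, rowAvg_add, rowAvg_sub, rowAvg_smul, rowAvg_smul, h.rowAvg_sub_one]
  simp

theorem rowAvg_gNext (h : IsMixing G W U ρ ωb) (Q : Vec d → Ξ → Vec d) (γ : ℝ)
    (s : AgentState n d) (v' : Fin n → Vec d) (ξ : Fin n → Ξ) :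
    rowAvg (gNext W Q γ s v' ξ) = rowAvg s.g + rowAvg (v' - s.v) := by
  rw [gNext_eq h, rowAvg_add, rowAvg_add, rowAvg_smul, h.rowAvg_sub_one]
  simp

variable {γ η δ : ℝ}

/-- Young with parameter p/2: half of the contraction is given up to separate the input `Y`. -/
theorem contraction_young_le {p : ℝ} (hp : 0 < p) (hp1 : p < 1) (X Y : Fin n → Vec d) :
    (1 - p) * frobSq (X + Y) ≤ (1 - p / 2) * frobSq X + 2 / p * frobSq Y := by
  have hq : 0 < 1 - p := by linarith
  have hX := frobSq_nonneg X
  have hY := frobSq_nonneg Y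
  have h := mul_le_mul_of_nonneg_left (frobSq_add_le X Y (α := p / 2) (by positivity)) hq.le
  have e : (p / 2)⁻¹ = 2 / p := by field_simp
  rw [e] at h
  have e2 : (1 - p) * (1 + 2 / p) = 2 / p - 1 - p := by field_simp; ring
  have e3 : (1 - p) * ((1 + p / 2) * frobSq X + (1 + 2 / p) * frobSq Y)
      = (1 - p) * (1 + p / 2) * frobSq X + (1 - p) * (1 + 2 / p) * frobSq Y := by ring
  rw [e3, e2] at h
  nlinarith [mul_nonneg hp.le hX, mul_nonneg (sq_nonneg p) hX, mul_nonneg hp.le hY]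

theorem frobSq_transpose_thetaNext_le (h : IsMixing G W U ρ ωb) (h0 : 0 < γ) (h1 : γ ≤ 1)
    (hp : ρ * γ < 1) (Q : Vec d → Ξ → Vec d) (s : AgentState n d) (ξ : Fin n → Ξ) :
    frobSq (leftMul U.transpose (thetaNext W Q η γ s ξ))
      ≤ (1 - ρ * γ / 2) * frobSq (leftMul U.transpose s.θ)
        + 2 / (ρ * γ) * (η ^ 2 * frobSq (leftMul U.transpose s.g))
        + γ * ωb ^ 2 / ρ * frobSq (compErr Q (thetaResidual η s) ξ) := by
  have hp0 : 0 < ρ * γ := mul_pos h.rho_pos h0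
  rw [thetaNext_eq h, ← sub_thetaHatNext]
  refine (h.consensus_le h0 h1 hp _ _).trans ?_
  have := contraction_young_le hp0 hp (leftMul U.transpose s.θ) (leftMul U.transpose (-(η • s.g)))
  rw [leftMul_neg, frobSq_neg, leftMul_smul, frobSq_smul, ← leftMul_smul, ← leftMul_neg,
    ← leftMul_add, ← sub_eq_add_neg] at this
  linarith

theorem frobSq_thetaNext_sub_le (h : IsMixing G W U ρ ωb) (h0 : 0 < γ) (h1 : γ ≤ 1)
    (Q : Vec d → Ξ → Vec d) (s : AgentState n d) (ξ : Fin n → Ξ) :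
    frobSq (thetaNext W Q η γ s ξ - s.θ)
      ≤ n * η ^ 2 * ‖rowAvg s.g‖ ^ 2 + 3 * γ ^ 2 * ωb ^ 2 * frobSq (leftMul U.transpose s.θ)
        + 3 * η ^ 2 * frobSq (leftMul U.transpose s.g)
        + 3 * γ ^ 2 * ωb ^ 2 * frobSq (compErr Q (thetaResidual η s) ξ) := by
  rw [thetaNext_eq h, ← sub_thetaHatNext]
  exact h.displacement_le h0 h1 _ _ _

theorem frobSq_transpose_gNext_le (h : IsMixing G W U ρ ωb) (h0 : 0 < γ) (h1 : γ ≤ 1)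
    (hp : ρ * γ < 1) (Q : Vec d → Ξ → Vec d) (s : AgentState n d) (v' : Fin n → Vec d)
    (ξ : Fin n → Ξ) :
    frobSq (leftMul U.transpose (gNext W Q γ s v' ξ))
      ≤ (1 - ρ * γ / 2) * frobSq (leftMul U.transpose s.g)
        + 2 / (ρ * γ) * frobSq (v' - s.v)
        + γ * ωb ^ 2 / ρ * frobSq (compErr Q (gResidual s v') ξ) := by
  have hp0 : 0 < ρ * γ := mul_pos h.rho_pos h0
  rw [gNext_eq h, ← sub_gHatNext]
  refine (h.consensus_le h0 h1 hp _ _).trans ?_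
  have h2 := contraction_young_le hp0 hp (leftMul U.transpose s.g)
    (leftMul U.transpose (v' - s.v))
  rw [← leftMul_add] at h2
  have h3 : 2 / (ρ * γ) * frobSq (leftMul U.transpose (v' - s.v))
      ≤ 2 / (ρ * γ) * frobSq (v' - s.v) := by
    have := h.frobSq_transpose_le (v' - s.v)
    gcongr
  linarith

theorem young_compression_factor_le (hδ : 0 < δ) (hδ1 : δ ≤ 1) : 1 + (δ / 10)⁻¹ ≤ 11 / δ := by
  rw [inv_div, le_div_iff₀ hδ, add_mul, div_mul_cancel₀ _ hδ.ne']
  linarith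

theorem frobSq_smul_sub_one_le (h : IsMixing G W U ρ ωb) (X : Fin n → Vec d) :
    frobSq (γ • leftMul (W - 1) X) ≤ γ ^ 2 * ωb ^ 2 * frobSq (leftMul U.transpose X) := by
  rw [frobSq_smul, mul_assoc]
  have := h.frobSq_sub_one_le X
  gcongr

/-- The Young parameter δ/10 and γω̄ ≤ δ/10 each cost factors 1 + δ/10, three in all.
`frobSq_gResidual_le` costs a fourth, and the compressor's 1 - δ absorbs them in
`contraction_factor_le`. -/
theorem frobSq_gNext_sub_gHatNext_le (h : IsMixing G W U ρ ωb) (h0 : 0 < γ)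
    (hδ : 0 < δ) (hδ1 : δ ≤ 1) (hγ : γ * ωb ≤ δ / 10)
    (Q : Vec d → Ξ → Vec d) (s : AgentState n d) (v' : Fin n → Vec d) (ξ : Fin n → Ξ) :
    frobSq (gNext W Q γ s v' ξ - gHatNext Q s v' ξ)
      ≤ (1 + δ / 10) ^ 3 * frobSq (compErr Q (gResidual s v') ξ)
        + 11 / δ * (γ ^ 2 * ωb ^ 2
          * (2 * frobSq (leftMul U.transpose s.g) + 2 * frobSq (v' - s.v))) := by
  have h2 := h.residual_le h0 (α := δ / 10) (by positivity) (s.g + (v' - s.v))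
    (gHatNext Q s v' ξ) 0
  rw [← gNext_eq h, sub_gHatNext, add_zero, add_zero] at h2
  refine h2.trans ?_
  have hω := h.omega_pos
  have hE := frobSq_nonneg (compErr Q (gResidual s v') ξ)
  have h3 := frobSq_smul_sub_one_le (γ := γ) h (s.g + (v' - s.v))
  have h4 : frobSq (leftMul U.transpose (s.g + (v' - s.v)))
      ≤ 2 * frobSq (leftMul U.transpose s.g) + 2 * frobSq (v' - s.v) := by
    rw [leftMul_add]
    have := h.frobSq_transpose_le (v' - s.v)
    linarith [frobSq_add_le_two (leftMul U.transpose s.g) (leftMul U.transpose (v' - s.v))]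
  have h5 := young_compression_factor_le hδ hδ1
  have h6 : (1 + γ * ωb) ^ 2 ≤ (1 + δ / 10) ^ 2 := by gcongr
  have h7 : (1 + δ / 10) * (1 + γ * ωb) ^ 2 ≤ (1 + δ / 10) ^ 3 := by
    calc _ ≤ (1 + δ / 10) * (1 + δ / 10) ^ 2 := by gcongr
      _ = _ := by ring
  have h8 : frobSq (γ • leftMul (W - 1) (s.g + (v' - s.v))) ≤ γ ^ 2 * ωb ^ 2
      * (2 * frobSq (leftMul U.transpose s.g) + 2 * frobSq (v' - s.v)) := by
    refine h3.trans ?_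
    gcongr
  have h9 := frobSq_nonneg (γ • leftMul (W - 1) (s.g + (v' - s.v)))
  gcongr

theorem frobSq_gResidual_le (hδ : 0 < δ) (hδ1 : δ ≤ 1) (s : AgentState n d)
    (v' : Fin n → Vec d) :
    frobSq (gResidual s v') ≤ (1 + δ / 10) * frobSq (s.g - s.ghat)
      + 11 / δ * frobSq (v' - s.v) := by
  have e : gResidual s v' = (s.g - s.ghat) + (v' - s.v) := by
    funext i
    simp [gResidual]
    abel
  rw [e]
  refine (frobSq_add_le _ _ (α := δ / 10) (by positivity)).trans ?_
  have := young_compression_factor_le hδ hδ1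
  have := frobSq_nonneg (v' - s.v)
  gcongr

theorem frobSq_gResidual_le_two (s : AgentState n d) (v' : Fin n → Vec d) :
    frobSq (gResidual s v') ≤ 2 * frobSq (s.g - s.ghat) + 2 * frobSq (v' - s.v) := by
  have e : gResidual s v' = (s.g - s.ghat) + (v' - s.v) := by
    funext i
    simp [gResidual]
    abel
  rw [e]
  exact frobSq_add_le_two _ _

/-- The next argument of the θ-compressor already contains the new direction g'. Its average is ḡ
plus the average of v' - v, while its disagreement is left on the right-hand side, to be eliminated
later by the tracking bound. -/
theorem frobSq_thetaResidual_next_le (h : IsMixing G W U ρ ωb) (h0 : 0 < γ)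
    (hδ : 0 < δ) (hδ1 : δ ≤ 1) (hγ : γ * ωb ≤ δ / 10)
    (Q : Vec d → Ξ → Vec d) (s : AgentState n d) (ξ : Fin n → Ξ)
    (v' : Fin n → Vec d) (ξ' : Fin n → Ξ) :
    frobSq (thetaNext W Q η γ s ξ - η • gNext W Q γ s v' ξ' - thetaHatNext Q η s ξ)
      ≤ (1 + δ / 10) ^ 3 * frobSq (compErr Q (thetaResidual η s) ξ)
        + 11 / δ * (2 * (γ ^ 2 * ωb ^ 2 * (2 * frobSq (leftMul U.transpose s.θ)
            + 2 * (η ^ 2 * frobSq (leftMul U.transpose s.g))))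
          + 2 * (η ^ 2 * (2 * n * ‖rowAvg s.g‖ ^ 2 + 2 * frobSq (v' - s.v)
            + frobSq (leftMul U.transpose (gNext W Q γ s v' ξ'))))) := by
  set g' := gNext W Q γ s v' ξ' with hg'
  have h2 := h.residual_le h0 (α := δ / 10) (by positivity) (s.θ - η • s.g)
    (thetaHatNext Q η s ξ) (-(η • g'))
  rw [← thetaNext_eq h, sub_thetaHatNext] at h2
  have e : thetaNext W Q η γ s ξ - η • g' - thetaHatNext Q η s ξ
      = thetaNext W Q η γ s ξ - thetaHatNext Q η s ξ + -(η • g') := by abel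
  rw [e]
  refine h2.trans ?_
  have hω := h.omega_pos
  have hE := frobSq_nonneg (compErr Q (thetaResidual η s) ξ)
  have h3 := frobSq_smul_sub_one_le (γ := γ) h (s.θ - η • s.g)
  have h4 : frobSq (leftMul U.transpose (s.θ - η • s.g))
      ≤ 2 * frobSq (leftMul U.transpose s.θ)
        + 2 * (η ^ 2 * frobSq (leftMul U.transpose s.g)) := by
    rw [sub_eq_add_neg, leftMul_add]
    have h5 := frobSq_add_le_two (leftMul U.transpose s.θ) (leftMul U.transpose (-(η • s.g)))
    rw [leftMul_neg, frobSq_neg, leftMul_smul, frobSq_smul] at h5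
    rwa [leftMul_neg, leftMul_smul]
  have h5 := young_compression_factor_le hδ hδ1
  have h6 : (1 + γ * ωb) ^ 2 ≤ (1 + δ / 10) ^ 2 := by gcongr
  have h7 : (1 + δ / 10) * (1 + γ * ωb) ^ 2 ≤ (1 + δ / 10) ^ 3 := by
    calc _ ≤ (1 + δ / 10) * (1 + δ / 10) ^ 2 := by gcongr
      _ = _ := by ring
  have h8 : frobSq g' ≤ 2 * n * ‖rowAvg s.g‖ ^ 2 + 2 * frobSq (v' - s.v)
      + frobSq (leftMul U.transpose g') := by
    rw [h.frobSq_eq, hg', rowAvg_gNext h]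
    have a1 := norm_add_sq_le_two (rowAvg s.g) (rowAvg (v' - s.v))
    have a2 := card_mul_norm_rowAvg_sq_le (v' - s.v)
    have a3 := mul_le_mul_of_nonneg_left a1 (Nat.cast_nonneg (α := ℝ) n)
    linarith
  have h9 := frobSq_nonneg (γ • leftMul (W - 1) (s.θ - η • s.g) + -(η • g'))
  have h10 : frobSq (γ • leftMul (W - 1) (s.θ - η • s.g) + -(η • g'))
      ≤ 2 * (γ ^ 2 * ωb ^ 2 * (2 * frobSq (leftMul U.transpose s.θ)
            + 2 * (η ^ 2 * frobSq (leftMul U.transpose s.g))))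
          + 2 * (η ^ 2 * (2 * n * ‖rowAvg s.g‖ ^ 2 + 2 * frobSq (v' - s.v)
            + frobSq (leftMul U.transpose g'))) := by
    refine (frobSq_add_le_two _ _).trans ?_
    rw [frobSq_neg, frobSq_smul η]
    have := h3.trans (mul_le_mul_of_nonneg_left h4 (by positivity))
    gcongr
  gcongr

end Step

/-! ### Second moments -/

section SecondMoments

variable {d : ℕ}

theorem integral_norm_add_sq_of_integral_eq_zero {S : Type*} [MeasurableSpace S] {ν : Measure S}
    [IsProbabilityMeasure ν] (a : Vec d) {w : S → Vec d} (hw : MemLp w 2 ν)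
    (h0 : ∫ z, w z ∂ν = 0) :
    ∫ z, ‖a + w z‖ ^ 2 ∂ν = ‖a‖ ^ 2 + ∫ z, ‖w z‖ ^ 2 ∂ν := by
  have hi : Integrable w ν := hw.integrable (by norm_num)
  have hsq := hw.integrable_norm_pow (p := 2) (by norm_num)
  have hin : ∫ z, inner ℝ a (w z) ∂ν = 0 := by rw [integral_inner hi, h0, inner_zero_right]
  have hini : Integrable (fun z => inner ℝ a (w z)) ν := hi.const_inner a
  simp_rw [norm_add_sq_real]
  rw [integral_add (by fun_prop) (by simpa using hsq), integral_add (by fun_prop) (by fun_prop),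
    integral_const_mul, hin]
  simp

/-- The variance is at most the second moment. Applied to gradient differences, it spares a separate
estimate for the difference of the means. -/
theorem integral_norm_sub_integral_sq_le {S : Type*} [MeasurableSpace S] {ν : Measure S}
    [IsProbabilityMeasure ν] {w : S → Vec d} (hw : MemLp w 2 ν) :
    ∫ z, ‖w z - ∫ z', w z' ∂ν‖ ^ 2 ∂ν ≤ ∫ z, ‖w z‖ ^ 2 ∂ν := by
  set c := ∫ z', w z' ∂ν with hc
  have hi : Integrable w ν := hw.integrable (by norm_num)
  have h := integral_norm_add_sq_of_integral_eq_zero c (w := fun z => w z - c)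
    (hw.sub (memLp_const c)) (by rw [integral_sub hi (by fun_prop)]; simp [hc])
  simp only [add_sub_cancel] at h
  nlinarith [sq_nonneg ‖c‖]

variable {ι : Type*} [Fintype ι] {S : ι → Type*} [∀ i, MeasurableSpace (S i)]
  {ν : ∀ i, Measure (S i)} [∀ i, IsProbabilityMeasure (ν i)] {w : ∀ i, S i → Vec d}

theorem memLp_comp_eval_pi (hw : ∀ i, MemLp (w i) 2 (ν i)) (i : ι) :
    MemLp (fun z : ∀ i, S i => w i (z i)) 2 (Measure.pi ν) :=
  (hw i).comp_measurePreserving (measurePreserving_eval ν i)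

theorem integral_norm_add_comp_eval_sq (a : Vec d) {i : ι} (hw : MemLp (w i) 2 (ν i))
    (h0 : ∫ z, w i z ∂(ν i) = 0) :
    ∫ z, ‖a + w i (z i)‖ ^ 2 ∂(Measure.pi ν) = ‖a‖ ^ 2 + ∫ z, ‖w i z‖ ^ 2 ∂(ν i) := by
  rw [← integral_norm_add_sq_of_integral_eq_zero a hw h0]
  exact integral_comp_eval (f := fun x => ‖a + w i x‖ ^ 2)
    ((aestronglyMeasurable_const.add hw.aestronglyMeasurable).norm.pow 2)

/-- Independent centred vectors are orthogonal in L². The proof goes coordinate by coordinate, where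
it is additivity of the variance under a product measure. -/
theorem integral_norm_sum_pi_sq (hw : ∀ i, MemLp (w i) 2 (ν i))
    (h0 : ∀ i, ∫ z, w i z ∂(ν i) = 0) :
    ∫ z, ‖∑ i, w i (z i)‖ ^ 2 ∂(Measure.pi ν) = ∑ i, ∫ z, ‖w i z‖ ^ 2 ∂(ν i) := by
  have hc : ∀ i k, MemLp (fun z => w i z k) 2 (ν i) := fun i k => (hw i).eval_piLp k
  have h0c : ∀ i k, ∫ z, w i z k ∂(ν i) = 0 := by
    intro i k
    have hi : Integrable (w i) (ν i) := (hw i).integrable (by norm_num)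
    have := (EuclideanSpace.proj (𝕜 := ℝ) k : Vec d →L[ℝ] ℝ).integral_comp_comm hi
    rw [h0 i] at this
    simpa using this
  have hpi : ∀ i k, MemLp (fun z : ∀ i, S i => w i (z i) k) 2 (Measure.pi ν) :=
    fun i k => (hc i k).comp_measurePreserving (measurePreserving_eval ν i)
  have key : ∀ k, ∫ z, (∑ i, w i (z i) k) ^ 2 ∂(Measure.pi ν)
      = ∑ i, ∫ z, (w i z k) ^ 2 ∂(ν i) := by
    intro k
    have h1 := variance_sum_pi (μ := ν) (X := fun i z => w i z k) (fun i => hc i k)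
    have hm : MemLp (∑ i, fun z : ∀ i, S i => w i (z i) k) 2 (Measure.pi ν) :=
      memLp_finsetSum' _ fun i _ => hpi i k
    rw [variance_of_integral_eq_zero hm.aestronglyMeasurable.aemeasurable] at h1
    · simp only [Finset.sum_apply] at h1
      rw [h1]
      refine Finset.sum_congr rfl fun i _ => ?_
      rw [variance_of_integral_eq_zero (hc i k).aestronglyMeasurable.aemeasurable (h0c i k)]
    · simp only [Finset.sum_apply]
      rw [integral_finsetSum _ fun i _ => (hpi i k).integrable (by norm_num)]
      refine Finset.sum_eq_zero fun i _ => ?_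
      rw [integral_comp_eval (f := fun z => w i z k) (hc i k).aestronglyMeasurable, h0c]
  simp_rw [EuclideanSpace.real_norm_sq_eq]
  rw [integral_finsetSum]
  · have e : ∀ i, ∫ z, ∑ k, (w i z k) ^ 2 ∂(ν i) = ∑ k, ∫ z, (w i z k) ^ 2 ∂(ν i) :=
      fun i => integral_finsetSum _ fun k _ => (hc i k).integrable_sq
    simp_rw [e]
    rw [Finset.sum_comm]
    refine Finset.sum_congr rfl fun k _ => ?_
    rw [← key k]
    simp
  · intro k _
    have hm : MemLp (fun z : ∀ i, S i => ∑ i, w i (z i) k) 2 (Measure.pi ν) :=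
      memLp_finsetSum _ fun i _ => hpi i k
    simpa using hm.integrable_sq

theorem integral_norm_add_sum_pi_sq (a : Vec d) (hw : ∀ i, MemLp (w i) 2 (ν i))
    (h0 : ∀ i, ∫ z, w i z ∂(ν i) = 0) :
    ∫ z, ‖a + ∑ i, w i (z i)‖ ^ 2 ∂(Measure.pi ν)
      = ‖a‖ ^ 2 + ∑ i, ∫ z, ‖w i z‖ ^ 2 ∂(ν i) := by
  have hpi := memLp_comp_eval_pi hw
  rw [integral_norm_add_sq_of_integral_eq_zero a (w := fun z : ∀ i, S i => ∑ i, w i (z i))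
    (memLp_finsetSum _ fun i _ => hpi i), integral_norm_sum_pi_sq hw h0]
  rw [integral_finsetSum _ fun i _ => (hpi i).integrable (by norm_num)]
  refine Finset.sum_eq_zero fun i _ => ?_
  rw [integral_comp_eval (hw i).aestronglyMeasurable, h0]

end SecondMoments

/-! ### Smoothness -/

/-- Along t ↦ x + th, the function minus its quadratic upper model has derivative ⟨∇f(x+th) - ∇f(x),
h⟩ - Lt‖h‖² ≤ 0 for t ≥ 0, hence it does not increase from t = 0 to t = 1. -/
theorem le_add_inner_gradient_add_sq {E : Type*} [NormedAddCommGroup E] [InnerProductSpace ℝ E]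
    [CompleteSpace E] {f : E → ℝ} {L : ℝ} (hf : Differentiable ℝ f)
    (hL : ∀ x y, ‖gradient f x - gradient f y‖ ≤ L * ‖x - y‖) (x h : E) :
    f (x + h) ≤ f x + inner ℝ (gradient f x) h + L / 2 * ‖h‖ ^ 2 := by
  have hd : ∀ t : ℝ, HasDerivAt
      (fun t : ℝ => f (x + t • h) - t * inner ℝ (gradient f x) h - L / 2 * t ^ 2 * ‖h‖ ^ 2)
      (inner ℝ (gradient f (x + t • h)) h - inner ℝ (gradient f x) h - L * t * ‖h‖ ^ 2) t := by
    intro t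
    have h1 : HasDerivAt (fun t : ℝ => x + t • h) h t := by
      simpa using ((hasDerivAt_id t).smul_const h).const_add x
    have h2 := (hf (x + t • h)).hasFDerivAt.comp_hasDerivAt t h1
    rw [← inner_gradient_left] at h2
    have h3 := (hasDerivAt_id t).mul_const (inner ℝ (gradient f x) h)
    have h4 := (((hasDerivAt_id t).pow 2).const_mul (L / 2)).mul_const (‖h‖ ^ 2)
    refine ((h2.sub h3).sub h4).congr_deriv ?_
    simp only [id, one_mul, mul_one, pow_one, Nat.cast_ofNat, Nat.add_one_sub_one]
    ring
  have hanti := antitoneOn_of_deriv_nonpos (convex_Ici (0 : ℝ))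
    (fun t _ => (hd t).continuousAt.continuousWithinAt)
    (fun t _ => (hd t).differentiableAt.differentiableWithinAt) (by
      intro t ht
      rw [interior_Ici, Set.mem_Ioi] at ht
      rw [(hd t).deriv, ← inner_sub_left]
      have h1 := real_inner_le_norm (gradient f (x + t • h) - gradient f x) h
      have h2 := hL (x + t • h) x
      rw [add_sub_cancel_left, norm_smul, Real.norm_eq_abs, abs_of_pos ht] at h2
      have h3 := mul_le_mul_of_nonneg_right h2 (norm_nonneg h)
      nlinarith)
  have := hanti (Set.mem_Ici.2 le_rfl) (Set.mem_Ici.2 zero_le_one) zero_le_one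
  simp only [one_smul, zero_smul, add_zero, one_mul, zero_mul, one_pow, mul_one, sub_zero, ne_eq,
    OfNat.ofNat_ne_zero, not_false_eq_true, zero_pow, mul_zero] at this
  linarith

/-! ### The stochastic problem -/

section Problem

variable {n d : ℕ} {Z : Type u} [MeasurableSpace Z] {F : Fin n → Vec d → Z → ℝ}
  {D : Fin n → Measure Z} {L σ μ : ℝ}

/-- The matrix with rows `∇ f_i(θ_i)`. -/
noncomputable def fullGrad (F : Fin n → Vec d → Z → ℝ) (D : Fin n → Measure Z) (θ : Fin n → Vec d) :
    Fin n → Vec d :=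
  fun i => gradient (localObj F D i) (θ i)

theorem memLp_two_of_lintegral_sq_lt_top {S E : Type*} [MeasurableSpace S] {ν : Measure S}
    [NormedAddCommGroup E] {f : S → E} (hf : AEStronglyMeasurable f ν)
    (h : ∫⁻ z, ‖f z‖ₑ ^ 2 ∂ν < ⊤) : MemLp f 2 ν := by
  refine ⟨hf, ?_⟩
  rw [eLpNorm_lt_top_iff_lintegral_rpow_enorm_lt_top (by norm_num) (by norm_num)]
  simpa using h

theorem lintegral_enorm_sq_eq_ofReal {S E : Type*} [MeasurableSpace S] {ν : Measure S}
    [NormedAddCommGroup E] {f : S → E} (hf : MemLp f 2 ν) :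
    ∫⁻ z, ‖f z‖ₑ ^ 2 ∂ν = ENNReal.ofReal (∫ z, ‖f z‖ ^ 2 ∂ν) := by
  rw [ofReal_integral_eq_lintegral_ofReal
    (by simpa using hf.integrable_norm_pow (p := 2) (by norm_num))
    (Eventually.of_forall fun _ => by positivity)]
  refine lintegral_congr fun z => ?_
  rw [ENNReal.ofReal_pow (norm_nonneg _), ofReal_norm]

/-- Variance and contraction are assumed for the Lebesgue integral, so that integrability is a
conclusion; a Bochner integral bound alone would be vacuous for a nonintegrable function. -/
theorem memLp_two_and_integral_le {S E : Type*} [MeasurableSpace S] {ν : Measure S}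
    [NormedAddCommGroup E] {f : S → E} (hf : AEStronglyMeasurable f ν) {c : ℝ} (hc : 0 ≤ c)
    (h : ∫⁻ z, ‖f z‖ₑ ^ 2 ∂ν ≤ ENNReal.ofReal c) :
    MemLp f 2 ν ∧ ∫ z, ‖f z‖ ^ 2 ∂ν ≤ c := by
  have hm := memLp_two_of_lintegral_sq_lt_top hf (h.trans_lt ENNReal.ofReal_lt_top)
  refine ⟨hm, ?_⟩
  rw [lintegral_enorm_sq_eq_ofReal hm] at h
  exact (ENNReal.ofReal_le_ofReal_iff hc).1 h

theorem IsStochasticProblem.measurable_stochGrad (hprob : IsStochasticProblem F D) (i : Fin n)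
    (θ : Vec d) : Measurable (stochGrad F i θ) :=
  (hprob.measurable_grad i).comp measurable_prodMk_left

theorem IsStochasticProblem.continuous_gradient (hprob : IsStochasticProblem F D) (i : Fin n) :
    Continuous (gradient (localObj F D i)) := by
  have h := (hprob.contDiff i).continuous_fderiv (by norm_num)
  exact (InnerProductSpace.toDual ℝ (Vec d)).symm.continuous.comp h

theorem IsStochasticProblem.differentiable (hprob : IsStochasticProblem F D) (i : Fin n) :
    Differentiable ℝ (localObj F D i) := (hprob.contDiff i).differentiable (by norm_num)

theorem IsStochasticProblem.differentiable_avgObj (hprob : IsStochasticProblem F D) :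
    Differentiable ℝ (avgObj F D) := by
  have := hprob.differentiable
  unfold avgObj
  fun_prop

theorem IsStochasticProblem.gradient_avgObj (hprob : IsStochasticProblem F D) (θ : Vec d) :
    gradient (avgObj F D) θ = rowAvg fun i => gradient (localObj F D i) θ := by
  refine HasGradientAt.gradient ?_
  rw [hasGradientAt_iff_hasFDerivAt]
  have h : HasFDerivAt (fun x => (n : ℝ)⁻¹ * ∑ i, localObj F D i x)
      ((n : ℝ)⁻¹ • ∑ i, fderiv ℝ (localObj F D i) θ) θ :=
    (HasFDerivAt.fun_sum fun i _ => (hprob.differentiable i θ).hasFDerivAt).const_mul _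
  refine h.congr_fderiv ?_
  rw [rowAvg, map_smul, map_sum]
  simp only [toDual_gradient]

theorem HasUnbiasedGradients.memLp_sub (hprob : IsStochasticProblem F D)
    (hgrad : HasUnbiasedGradients F D σ) (i : Fin n) (θ : Vec d) :
    MemLp (fun z => stochGrad F i θ z - gradient (localObj F D i) θ) 2 (D i) ∧
      ∫ z, ‖stochGrad F i θ z - gradient (localObj F D i) θ‖ ^ 2 ∂(D i) ≤ σ ^ 2 :=
  memLp_two_and_integral_le
    (((hprob.measurable_stochGrad i θ).sub_const _).aestronglyMeasurable) (sq_nonneg σ)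
    (hgrad.variance i θ)

theorem optVal_le (hprob : IsStochasticProblem F D) (θ : Vec d) : optVal F D ≤ avgObj F D θ :=
  ciInf_le hprob.bddBelow θ

/-! ### The momentum estimator at fixed iterates -/

/-- The centred noise of the momentum update of agent `i`. -/
noncomputable def momentumNoise (F : Fin n → Vec d → Z → ℝ) (D : Fin n → Measure Z) (β : ℝ)
    (θ θ' : Fin n → Vec d) (i : Fin n) (z : Z) : Vec d :=
  β • (stochGrad F i (θ' i) z - gradient (localObj F D i) (θ' i))
    + (1 - β) • ((stochGrad F i (θ' i) z - stochGrad F i (θ i) z)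
      - (gradient (localObj F D i) (θ' i) - gradient (localObj F D i) (θ i)))

/-- The correction by the old-point gradient at the same sample makes the estimator error an
autoregression: the old error scaled by 1 - β plus noise that is centred once θ and θ' are fixed. -/
theorem vNext_sub_fullGrad (β : ℝ) (s : AgentState n d) (θ' : Fin n → Vec d) (z : Fin n → Z)
    (i : Fin n) :
    vNext F β s θ' z i - fullGrad F D θ' i
      = (1 - β) • (s.v i - fullGrad F D s.θ i) + momentumNoise F D β s.θ θ' i (z i) := by
  simp only [vNext, fullGrad, momentumNoise]
  module

variable [∀ i, IsProbabilityMeasure (D i)]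

theorem HasUnbiasedGradients.memLp (hprob : IsStochasticProblem F D)
    (hgrad : HasUnbiasedGradients F D σ) (i : Fin n) (θ : Vec d) :
    MemLp (stochGrad F i θ) 2 (D i) := by
  have h := (hgrad.memLp_sub hprob i θ).1.add (memLp_const (gradient (localObj F D i) θ))
  convert h using 1
  funext z
  simp

theorem HasUnbiasedGradients.integrable (hprob : IsStochasticProblem F D)
    (hgrad : HasUnbiasedGradients F D σ) (i : Fin n) (θ : Vec d) :
    Integrable (stochGrad F i θ) (D i) :=
  (hgrad.memLp hprob i θ).integrable (by norm_num)

/-- The Lipschitz bound holds for almost every sample and passes to the mean by unbiasedness. -/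
theorem norm_gradient_localObj_sub_le (hprob : IsStochasticProblem F D)
    (hlip : HasLipschitzSampleGradients F D L) (hgrad : HasUnbiasedGradients F D σ) (i : Fin n)
    (θ θ' : Vec d) :
    ‖gradient (localObj F D i) θ - gradient (localObj F D i) θ'‖ ≤ L * ‖θ - θ'‖ := by
  rw [← hgrad.unbiased, ← hgrad.unbiased,
    ← integral_sub (hgrad.integrable hprob i θ) (hgrad.integrable hprob i θ')]
  have h := norm_integral_le_of_norm_le_const (μ := D i) (C := L * ‖θ - θ'‖)
    (f := fun z => stochGrad F i θ z - stochGrad F i θ' z) (by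
      filter_upwards [hlip.lipschitz i] with z hz using hz θ θ')
  simpa using h

theorem norm_rowAvg_sq_le (hn : 0 < n) (X : Fin n → Vec d) :
    ‖rowAvg X‖ ^ 2 ≤ (n : ℝ)⁻¹ * frobSq X := by
  have h := card_mul_norm_rowAvg_sq_le X
  have hn' : (0 : ℝ) < n := by positivity
  rw [inv_mul_eq_div, le_div_iff₀ hn']
  linarith

theorem norm_gradient_avgObj_sub_le (hn : 0 < n) (hprob : IsStochasticProblem F D)
    (hlip : HasLipschitzSampleGradients F D L) (hgrad : HasUnbiasedGradients F D σ)
    (θ θ' : Vec d) :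
    ‖gradient (avgObj F D) θ - gradient (avgObj F D) θ'‖ ≤ L * ‖θ - θ'‖ := by
  have hn' : (0 : ℝ) < n := by positivity
  rw [hprob.gradient_avgObj, hprob.gradient_avgObj, rowAvg, rowAvg, ← smul_sub,
    ← Finset.sum_sub_distrib, norm_smul, norm_inv, Real.norm_natCast]
  calc (n : ℝ)⁻¹ * ‖∑ i, (gradient (localObj F D i) θ - gradient (localObj F D i) θ')‖
      ≤ (n : ℝ)⁻¹ * ∑ _i : Fin n, L * ‖θ - θ'‖ := by
        gcongr
        refine (norm_sum_le _ _).trans (Finset.sum_le_sum fun i _ => ?_)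
        exact norm_gradient_localObj_sub_le hprob hlip hgrad i θ θ'
    _ = L * ‖θ - θ'‖ := by
        rw [Finset.sum_const, Finset.card_univ, Fintype.card_fin, nsmul_eq_mul]
        field_simp

/-- The descent of the objective along an inexact gradient step. -/
theorem avgObj_step_le (hn : 0 < n) (hprob : IsStochasticProblem F D)
    (hlip : HasLipschitzSampleGradients F D L) (hgrad : HasUnbiasedGradients F D σ)
    (hpl : IsPL F D μ) {η : ℝ} (hη : 0 < η) (hηL : η * L ≤ 1 / 2) (θ v : Fin n → Vec d) :
    avgObj F D (rowAvg θ - η • rowAvg v) - optVal F D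
      ≤ (1 - η * μ) * (avgObj F D (rowAvg θ) - optVal F D) - η / 4 * ‖rowAvg v‖ ^ 2
        + η / n * (n * ‖rowAvg v - rowAvg (fullGrad F D θ)‖ ^ 2
          + L ^ 2 * ∑ i, ‖θ i - rowAvg θ‖ ^ 2) := by
  have hn' : (0 : ℝ) < n := by positivity
  set x := rowAvg θ with hx
  set g := rowAvg v with hg
  set q := gradient (avgObj F D) x with hq
  have h1 := le_add_inner_gradient_add_sq hprob.differentiable_avgObj
    (norm_gradient_avgObj_sub_le hn hprob hlip hgrad) x (-(η • g))
  rw [← sub_eq_add_neg, inner_neg_right, inner_smul_right, norm_neg, norm_smul, mul_pow,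
    Real.norm_eq_abs, sq_abs] at h1
  -- Polarization turns -η⟨q, g⟩ into -(η/2)(‖q‖² + ‖g‖² - ‖q - g‖²). The ‖q‖² part feeds the PL
  -- inequality, and half of the ‖g‖² part survives the curvature term because ηL ≤ 1/2.
  have h2 : ‖q - g‖ ^ 2 = ‖q‖ ^ 2 - 2 * inner ℝ q g + ‖g‖ ^ 2 := norm_sub_sq_real q g
  have h3 := hpl.pl x
  have h4 : ‖q - g‖ ^ 2 ≤ 2 * ‖g - rowAvg (fullGrad F D θ)‖ ^ 2
      + 2 * ((n : ℝ)⁻¹ * (L ^ 2 * ∑ i, ‖θ i - x‖ ^ 2)) := by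
    have e : q - g = -(g - rowAvg (fullGrad F D θ))
        + rowAvg ((fun i => gradient (localObj F D i) x) - fullGrad F D θ) := by
      rw [rowAvg_sub, hq, hprob.gradient_avgObj]; abel
    rw [e]
    refine (norm_add_sq_le_two _ _).trans ?_
    rw [norm_neg]
    have h5 := norm_rowAvg_sq_le hn ((fun i => gradient (localObj F D i) x) - fullGrad F D θ)
    have h6 : frobSq ((fun i => gradient (localObj F D i) x) - fullGrad F D θ)
        ≤ L ^ 2 * ∑ i, ‖θ i - x‖ ^ 2 := by
      rw [frobSq, Finset.mul_sum]
      refine Finset.sum_le_sum fun i _ => ?_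
      rw [← mul_pow, norm_sub_rev (θ i)]
      have := norm_gradient_localObj_sub_le hprob hlip hgrad i x (θ i)
      simp only [Pi.sub_apply, fullGrad]
      gcongr
    have h7 := h5.trans (mul_le_mul_of_nonneg_left h6 (by positivity))
    linarith
  have h8 : η / n * (n * ‖g - rowAvg (fullGrad F D θ)‖ ^ 2 + L ^ 2 * ∑ i, ‖θ i - x‖ ^ 2)
      = η * (‖g - rowAvg (fullGrad F D θ)‖ ^ 2
        + (n : ℝ)⁻¹ * (L ^ 2 * ∑ i, ‖θ i - x‖ ^ 2)) := by
    field_simp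
  rw [h8]
  have h9 : L / 2 * (η ^ 2 * ‖g‖ ^ 2) ≤ η / 4 * ‖g‖ ^ 2 := by
    have : L / 2 * (η ^ 2 * ‖g‖ ^ 2) = η / 2 * (η * L) * ‖g‖ ^ 2 := by ring
    rw [this]
    have : η / 2 * (η * L) ≤ η / 4 := by nlinarith
    gcongr
  have h10 := mul_le_mul_of_nonneg_left h4 hη.le
  have h11 := mul_le_mul_of_nonneg_left h3 hη.le
  nlinarith

theorem memLp_momentumNoise (hprob : IsStochasticProblem F D)
    (hgrad : HasUnbiasedGradients F D σ) (β : ℝ) (θ θ' : Fin n → Vec d) (i : Fin n) :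
    MemLp (momentumNoise F D β θ θ' i) 2 (D i) :=
  ((hgrad.memLp_sub hprob i (θ' i)).1.const_smul β).add
    ((((hgrad.memLp hprob i (θ' i)).sub (hgrad.memLp hprob i (θ i))).sub
      (memLp_const _)).const_smul (1 - β))

theorem integral_momentumNoise (hprob : IsStochasticProblem F D)
    (hgrad : HasUnbiasedGradients F D σ) (β : ℝ) (θ θ' : Fin n → Vec d) (i : Fin n) :
    ∫ z, momentumNoise F D β θ θ' i z ∂(D i) = 0 := by
  have h1 := hgrad.integrable hprob i (θ' i)
  have h2 := hgrad.integrable hprob i (θ i)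
  unfold momentumNoise
  rw [integral_add (by fun_prop) (by fun_prop), integral_smul, integral_smul,
    integral_sub h1 (by fun_prop), integral_sub (by fun_prop) (by fun_prop),
    integral_sub h1 h2, hgrad.unbiased, hgrad.unbiased]
  simp

/-- The fresh noise enters only with weight β; the remainder is a centred gradient difference at one
common sample, hence of the order of the displacement. -/
theorem integral_momentumNoise_sq_le (hprob : IsStochasticProblem F D)
    (hlip : HasLipschitzSampleGradients F D L) (hgrad : HasUnbiasedGradients F D σ) (β : ℝ)
    (θ θ' : Fin n → Vec d) (i : Fin n) :
    ∫ z, ‖momentumNoise F D β θ θ' i z‖ ^ 2 ∂(D i)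
      ≤ 2 * β ^ 2 * σ ^ 2 + 2 * (1 - β) ^ 2 * L ^ 2 * ‖θ' i - θ i‖ ^ 2 := by
  have h1 := hgrad.integrable hprob i (θ' i)
  have h2 := hgrad.integrable hprob i (θ i)
  obtain ⟨m1, b1⟩ := hgrad.memLp_sub hprob i (θ' i)
  have m2 := (hgrad.memLp hprob i (θ' i)).sub (hgrad.memLp hprob i (θ i))
  have m3 := m2.sub (memLp_const (gradient (localObj F D i) (θ' i)
    - gradient (localObj F D i) (θ i)))
  have i1 := m1.integrable_norm_pow (p := 2) (by norm_num)
  have i3 := m3.integrable_norm_pow (p := 2) (by norm_num)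
  have i0 := (memLp_momentumNoise hprob hgrad β θ θ' i).integrable_norm_pow (p := 2) (by norm_num)
  have b3 : ∫ z, ‖(stochGrad F i (θ' i) z - stochGrad F i (θ i) z)
      - (gradient (localObj F D i) (θ' i) - gradient (localObj F D i) (θ i))‖ ^ 2 ∂(D i)
      ≤ L ^ 2 * ‖θ' i - θ i‖ ^ 2 := by
    have h3 := integral_norm_sub_integral_sq_le m2
    simp only [Pi.sub_apply] at h3
    rw [integral_sub h1 h2, hgrad.unbiased, hgrad.unbiased] at h3
    refine h3.trans ?_
    have h4 := integral_mono_ae (m2.integrable_norm_pow (p := 2) (by norm_num))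
      (integrable_const (L ^ 2 * ‖θ' i - θ i‖ ^ 2)) (by
        filter_upwards [hlip.lipschitz i] with z hz
        simp only [Pi.sub_apply]
        rw [← mul_pow]
        have := hz (θ' i) (θ i)
        gcongr)
    simpa using h4
  have hmono := integral_mono i0 ((i1.const_mul (2 * β ^ 2)).add (i3.const_mul (2 * (1 - β) ^ 2)))
    (fun z => by
      have := norm_add_sq_le_two
        (β • (stochGrad F i (θ' i) z - gradient (localObj F D i) (θ' i)))
        ((1 - β) • ((stochGrad F i (θ' i) z - stochGrad F i (θ i) z)
          - (gradient (localObj F D i) (θ' i) - gradient (localObj F D i) (θ i))))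
      rw [norm_smul, norm_smul, mul_pow, mul_pow, Real.norm_eq_abs, Real.norm_eq_abs, sq_abs,
        sq_abs] at this
      simp only [Pi.add_apply, Pi.sub_apply, momentumNoise]
      linarith)
  simp only [Pi.add_apply] at hmono
  rw [integral_add (i1.const_mul _) (i3.const_mul _), integral_const_mul,
    integral_const_mul] at hmono
  simp only [Pi.sub_apply] at hmono
  refine hmono.trans ?_
  have c1 := mul_le_mul_of_nonneg_left b1 (by positivity : 0 ≤ 2 * β ^ 2)
  have c3 := mul_le_mul_of_nonneg_left b3 (by positivity : 0 ≤ 2 * (1 - β) ^ 2)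
  linarith

theorem memLp_vNext (hprob : IsStochasticProblem F D) (hgrad : HasUnbiasedGradients F D σ)
    (β : ℝ) (s : AgentState n d) (θ' : Fin n → Vec d) (i : Fin n) :
    MemLp (fun z => vNext F β s θ' z i) 2 (Measure.pi D) := by
  have h := memLp_comp_eval_pi (fun i => memLp_momentumNoise hprob hgrad β s.θ θ' i) i
  have h2 := (h.add (memLp_const ((1 - β) • (s.v i - fullGrad F D s.θ i)))).add
    (memLp_const (fullGrad F D θ' i))
  convert h2 using 2 with z
  have := vNext_sub_fullGrad (F := F) (D := D) β s θ' z i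
  simp only [Pi.add_apply]
  rw [add_comm (momentumNoise _ _ _ _ _ _ _), ← this]
  simp

theorem integral_frobSq_vNext_sub_fullGrad_le (hprob : IsStochasticProblem F D)
    (hlip : HasLipschitzSampleGradients F D L) (hgrad : HasUnbiasedGradients F D σ) (β : ℝ)
    (s : AgentState n d) (θ' : Fin n → Vec d) :
    Integrable (fun z => frobSq (vNext F β s θ' z - fullGrad F D θ')) (Measure.pi D) ∧
    ∫ z, frobSq (vNext F β s θ' z - fullGrad F D θ') ∂(Measure.pi D)
      ≤ (1 - β) ^ 2 * frobSq (s.v - fullGrad F D s.θ) + 2 * β ^ 2 * n * σ ^ 2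
        + 2 * (1 - β) ^ 2 * L ^ 2 * frobSq (θ' - s.θ) := by
  have hm : ∀ i, MemLp (fun z => vNext F β s θ' z i - fullGrad F D θ' i) 2 (Measure.pi D) :=
    fun i => (memLp_vNext hprob hgrad β s θ' i).sub (memLp_const _)
  have hint : ∀ i, Integrable (fun z => ‖vNext F β s θ' z i - fullGrad F D θ' i‖ ^ 2)
      (Measure.pi D) := fun i => by simpa using (hm i).integrable_norm_pow (p := 2) (by norm_num)
  simp only [frobSq, Pi.sub_apply]
  refine ⟨integrable_finsetSum _ fun i _ => hint i, ?_⟩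
  rw [integral_finsetSum _ fun i _ => hint i]
  have key : ∀ i, ∫ z, ‖vNext F β s θ' z i - fullGrad F D θ' i‖ ^ 2 ∂(Measure.pi D)
      ≤ (1 - β) ^ 2 * ‖s.v i - fullGrad F D s.θ i‖ ^ 2
        + (2 * β ^ 2 * σ ^ 2 + 2 * (1 - β) ^ 2 * L ^ 2 * ‖θ' i - s.θ i‖ ^ 2) := by
    intro i
    have hN := memLp_momentumNoise hprob hgrad β s.θ θ' i
    simp_rw [vNext_sub_fullGrad]
    rw [integral_norm_add_comp_eval_sq (ν := D) (w := momentumNoise F D β s.θ θ') _ hN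
      (integral_momentumNoise hprob hgrad β _ _ i), norm_smul, mul_pow, Real.norm_eq_abs, sq_abs]
    have := integral_momentumNoise_sq_le hprob hlip hgrad β s.θ θ' i
    linarith
  refine (Finset.sum_le_sum fun i _ => key i).trans (le_of_eq ?_)
  simp only [Finset.sum_add_distrib, ← Finset.mul_sum, Finset.sum_const, Finset.card_univ,
    Fintype.card_fin, nsmul_eq_mul]
  ring

/-- Here independence across agents matters: the noises of the agents are orthogonal, so averaging
puts 1/n in front of the variance. This is the source of the speedup in n. -/
theorem integral_norm_rowAvg_vNext_sub_fullGrad_le (hn : 0 < n) (hprob : IsStochasticProblem F D)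
    (hlip : HasLipschitzSampleGradients F D L) (hgrad : HasUnbiasedGradients F D σ) (β : ℝ)
    (s : AgentState n d) (θ' : Fin n → Vec d) :
    Integrable (fun z => ‖rowAvg (vNext F β s θ' z) - rowAvg (fullGrad F D θ')‖ ^ 2)
      (Measure.pi D) ∧
    ∫ z, ‖rowAvg (vNext F β s θ' z) - rowAvg (fullGrad F D θ')‖ ^ 2 ∂(Measure.pi D)
      ≤ (1 - β) ^ 2 * ‖rowAvg s.v - rowAvg (fullGrad F D s.θ)‖ ^ 2
        + ((n : ℝ)⁻¹ * (2 * β ^ 2 * σ ^ 2)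
          + (n : ℝ)⁻¹ ^ 2 * (2 * (1 - β) ^ 2 * L ^ 2 * frobSq (θ' - s.θ))) := by
  have hn' : (0 : ℝ) < n := by positivity
  have hN := fun i => memLp_momentumNoise hprob hgrad β s.θ θ' i
  have hN' : ∀ i, MemLp (fun z => (n : ℝ)⁻¹ • momentumNoise F D β s.θ θ' i z) 2 (D i) :=
    fun i => (hN i).const_smul (n : ℝ)⁻¹
  have e : ∀ z : Fin n → Z, rowAvg (vNext F β s θ' z) - rowAvg (fullGrad F D θ')
      = (1 - β) • (rowAvg s.v - rowAvg (fullGrad F D s.θ))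
        + ∑ i, (n : ℝ)⁻¹ • momentumNoise F D β s.θ θ' i (z i) := by
    intro z
    rw [← rowAvg_sub, ← rowAvg_sub, ← rowAvg_smul, ← Finset.smul_sum]
    rw [show (n : ℝ)⁻¹ • ∑ i, momentumNoise F D β s.θ θ' i (z i)
      = rowAvg (fun i => momentumNoise F D β s.θ θ' i (z i)) from rfl, ← rowAvg_add]
    congr 1
    funext i
    simp [vNext_sub_fullGrad]
  simp_rw [e]
  constructor
  · have := ((memLp_const (μ := Measure.pi D)
      ((1 - β) • (rowAvg s.v - rowAvg (fullGrad F D s.θ)))).add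
      (memLp_finsetSum Finset.univ fun i _ => memLp_comp_eval_pi hN' i)).integrable_norm_pow
      (p := 2) (by norm_num)
    simpa using this
  rw [integral_norm_add_sum_pi_sq _ hN' (fun i => by
    rw [integral_smul, integral_momentumNoise hprob hgrad, smul_zero]), norm_smul, mul_pow,
    Real.norm_eq_abs, sq_abs]
  gcongr
  have key : ∀ i, ∫ z, ‖(n : ℝ)⁻¹ • momentumNoise F D β s.θ θ' i z‖ ^ 2 ∂(D i)
      ≤ (n : ℝ)⁻¹ ^ 2 * (2 * β ^ 2 * σ ^ 2 + 2 * (1 - β) ^ 2 * L ^ 2 * ‖θ' i - s.θ i‖ ^ 2) := by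
    intro i
    simp_rw [norm_smul, mul_pow, Real.norm_eq_abs, sq_abs]
    rw [integral_const_mul]
    have := integral_momentumNoise_sq_le hprob hlip hgrad β s.θ θ' i
    gcongr
  refine (Finset.sum_le_sum fun i _ => key i).trans (le_of_eq ?_)
  simp only [← Finset.mul_sum, Finset.sum_add_distrib, frobSq, Finset.sum_const, Finset.card_univ,
    Fintype.card_fin, nsmul_eq_mul, Pi.sub_apply]
  field_simp

/-- v' - v splits into -β times the old error, β times the noise at the old point, and a gradient
difference at a common sample. No orthogonality is used, hence the factors 3. -/
theorem integral_frobSq_vNext_sub_le (hprob : IsStochasticProblem F D)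
    (hlip : HasLipschitzSampleGradients F D L) (hgrad : HasUnbiasedGradients F D σ) (β : ℝ)
    (s : AgentState n d) (θ' : Fin n → Vec d) :
    Integrable (fun z => frobSq (vNext F β s θ' z - s.v)) (Measure.pi D) ∧
    ∫ z, frobSq (vNext F β s θ' z - s.v) ∂(Measure.pi D)
      ≤ 3 * β ^ 2 * frobSq (s.v - fullGrad F D s.θ) + 3 * β ^ 2 * n * σ ^ 2
        + 3 * L ^ 2 * frobSq (θ' - s.θ) := by
  have hm : ∀ i, MemLp (fun z => vNext F β s θ' z i - s.v i) 2 (Measure.pi D) :=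
    fun i => (memLp_vNext hprob hgrad β s θ' i).sub (memLp_const _)
  have hint : ∀ i, Integrable (fun z => ‖vNext F β s θ' z i - s.v i‖ ^ 2)
      (Measure.pi D) := fun i => by simpa using (hm i).integrable_norm_pow (p := 2) (by norm_num)
  simp only [frobSq, Pi.sub_apply]
  refine ⟨integrable_finsetSum _ fun i _ => hint i, ?_⟩
  rw [integral_finsetSum _ fun i _ => hint i]
  have key : ∀ i, ∫ z, ‖vNext F β s θ' z i - s.v i‖ ^ 2 ∂(Measure.pi D)
      ≤ 3 * β ^ 2 * ‖s.v i - fullGrad F D s.θ i‖ ^ 2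
        + (3 * β ^ 2 * σ ^ 2 + 3 * L ^ 2 * ‖θ' i - s.θ i‖ ^ 2) := by
    intro i
    obtain ⟨m1, b1⟩ := hgrad.memLp_sub hprob i (s.θ i)
    have i1 := m1.integrable_norm_pow (p := 2) (by norm_num)
    have i1' := integrable_comp_eval (μ := D) i1
    have hl : ∀ᵐ z ∂(Measure.pi D), ∀ θ θ' : Vec d,
        ‖stochGrad F i θ (z i) - stochGrad F i θ' (z i)‖ ≤ L * ‖θ - θ'‖ :=
      (measurePreserving_eval D i).quasiMeasurePreserving.ae (hlip.lipschitz i)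
    have hmono := integral_mono_ae (hint i)
      (((i1'.const_mul (3 * β ^ 2))).add (integrable_const
        (3 * β ^ 2 * ‖s.v i - fullGrad F D s.θ i‖ ^ 2 + 3 * L ^ 2 * ‖θ' i - s.θ i‖ ^ 2))) (by
        filter_upwards [hl] with z hz
        have e : vNext F β s θ' z i - s.v i
            = (-β) • (s.v i - fullGrad F D s.θ i)
              + β • (stochGrad F i (s.θ i) (z i) - gradient (localObj F D i) (s.θ i))
              + (stochGrad F i (θ' i) (z i) - stochGrad F i (s.θ i) (z i)) := by
          simp only [vNext, fullGrad]
          module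
        rw [e]
        refine (norm_add_add_sq_le _ _ _).trans ?_
        simp only [Pi.add_apply, norm_smul, mul_pow, Real.norm_eq_abs, sq_abs, neg_sq]
        have h1 : ‖stochGrad F i (θ' i) (z i) - stochGrad F i (s.θ i) (z i)‖ ^ 2
            ≤ (L * ‖θ' i - s.θ i‖) ^ 2 := by
          have := hz (θ' i) (s.θ i)
          gcongr
        rw [mul_pow] at h1
        linarith)
    refine hmono.trans ?_
    simp only [Pi.add_apply]
    rw [integral_add (i1'.const_mul _) (integrable_const _), integral_const_mul,
      integral_comp_eval (μ := D) (f := fun z =>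
        ‖stochGrad F i (s.θ i) z - gradient (localObj F D i) (s.θ i)‖ ^ 2)
        i1.aestronglyMeasurable]
    simp only [integral_const, probReal_univ, smul_eq_mul, one_mul]
    have := mul_le_mul_of_nonneg_left b1 (by positivity : 0 ≤ 3 * β ^ 2)
    linarith
  refine (Finset.sum_le_sum fun i _ => key i).trans (le_of_eq ?_)
  simp only [Finset.sum_add_distrib, ← Finset.mul_sum, Finset.sum_const, Finset.card_univ,
    Fintype.card_fin, nsmul_eq_mul]
  ring

end Problem

/-! ### Conditional laws -/

section CondLaw

variable {Ω : Type w} {m mΩ : MeasurableSpace Ω} {P : Measure Ω} [IsProbabilityMeasure P]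
  {S T : Type*} [MeasurableSpace S] [MeasurableSpace T]
  {κ : Kernel S T} [IsMarkovKernel κ] {X : Ω → T} {Y : Ω → S}

/-- If the conditional law of `X` depends on the past only through `Y`, the pair is distributed as
`Y` followed by the kernel. Testing on rectangles suffices, with the event {Y ∈ A} as `B` in the
definition of `HasCondLaw`. -/
theorem HasCondLaw.map_prodMk (h : HasCondLaw P m X fun o => κ (Y o)) (hm : m ≤ mΩ)
    (hY : Measurable[m] Y) (hX : Measurable X) :
    P.map (fun o => (Y o, X o)) = P.map Y ⊗ₘ κ := by
  have hY' : Measurable Y := hY.mono hm le_rfl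
  have : IsProbabilityMeasure (P.map Y) := Measure.isProbabilityMeasure_map hY'.aemeasurable
  have : IsProbabilityMeasure (P.map fun o => (Y o, X o)) :=
    Measure.isProbabilityMeasure_map (hY'.prodMk hX).aemeasurable
  refine Measure.ext_prod fun {A B} hA hB => ?_
  rw [Measure.map_apply (hY'.prodMk hX) (hA.prod hB), Measure.compProd_apply_prod hA hB,
    setLIntegral_map hA (κ.measurable_coe hB) hY', ← h _ (hY hA) _ hB]
  rfl

/-- The freezing principle: a bound for every fixed value of `Y` integrates to a bound for the
random one. The computation is done with Lebesgue integrals, so integrability of the left side comes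
out of it. -/
theorem HasCondLaw.integral_le (h : HasCondLaw P m X fun o => κ (Y o)) (hm : m ≤ mΩ)
    (hY : Measurable[m] Y) (hX : Measurable X) {f : S × T → ℝ} (hf : Measurable f)
    (hf0 : ∀ p, 0 ≤ f p) {c : S → ℝ}
    (hc : ∀ y, Integrable (fun x => f (y, x)) (κ y) ∧ ∫ x, f (y, x) ∂(κ y) ≤ c y)
    (hci : Integrable (fun o => c (Y o)) P) :
    Integrable (fun o => f (Y o, X o)) P ∧ ∫ o, f (Y o, X o) ∂P ≤ ∫ o, c (Y o) ∂P := by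
  have hY' : Measurable Y := hY.mono hm le_rfl
  have hc0 : ∀ y, 0 ≤ c y := fun y =>
    (integral_nonneg fun x => hf0 (y, x)).trans (hc y).2
  have hmeas : Measurable fun p : S × T => ENNReal.ofReal (f p) := hf.ennreal_ofReal
  have key : ∫⁻ o, ENNReal.ofReal (f (Y o, X o)) ∂P ≤ ENNReal.ofReal (∫ o, c (Y o) ∂P) := by
    have e := lintegral_map (μ := P) hmeas (hY'.prodMk hX)
    have : IsProbabilityMeasure (P.map Y) := Measure.isProbabilityMeasure_map hY'.aemeasurable
    rw [h.map_prodMk hm hY hX, Measure.lintegral_compProd hmeas,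
      lintegral_map hmeas.lintegral_kernel_prod_right' hY'] at e
    rw [← e, ofReal_integral_eq_lintegral_ofReal hci (Eventually.of_forall fun o => hc0 _)]
    refine lintegral_mono fun o => ?_
    rw [← ofReal_integral_eq_lintegral_ofReal (hc (Y o)).1 (Eventually.of_forall fun x => hf0 _)]
    exact ENNReal.ofReal_le_ofReal (hc (Y o)).2
  have hfm : Measurable fun o => f (Y o, X o) := hf.comp (hY'.prodMk hX)
  have hint : Integrable (fun o => f (Y o, X o)) P := by
    refine ⟨hfm.aestronglyMeasurable, ?_⟩
    rw [hasFiniteIntegral_iff_ofReal (Eventually.of_forall fun o => hf0 _)]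
    exact key.trans_lt ENNReal.ofReal_lt_top
  refine ⟨hint, ?_⟩
  rw [← ofReal_integral_eq_lintegral_ofReal hint (Eventually.of_forall fun o => hf0 _)] at key
  exact (ENNReal.ofReal_le_ofReal_iff (integral_nonneg fun o => hc0 _)).1 key

end CondLaw

/-! ### Measurability of the iterates -/

section Measurability

variable {n d b : ℕ} {Z : Type u} [MeasurableSpace Z] {Ξ : Type v} [MeasurableSpace Ξ]
  {F : Fin n → Vec d → Z → ℝ} {D : Fin n → Measure Z} {W : Matrix (Fin n) (Fin n) ℝ}
  {κ : Kernel (Vec d) Ξ} {Q : Vec d → Ξ → Vec d} {δ η γ β : ℝ} {θ₀ : Vec d}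

/-- All variables of the random state `s` are measurable. -/
structure StateMeasurable {A : Type*} (mA : MeasurableSpace A) (s : A → AgentState n d) : Prop where
  θ : ∀ i, Measurable fun o => (s o).θ i
  θhat : ∀ i, Measurable fun o => (s o).θhat i
  v : ∀ i, Measurable fun o => (s o).v i
  g : ∀ i, Measurable fun o => (s o).g i
  ghat : ∀ i, Measurable fun o => (s o).ghat i

theorem StateMeasurable.mono {A : Type*} {m m' : MeasurableSpace A} (h : m ≤ m')
    {s : A → AgentState n d} (hs : StateMeasurable m s) : StateMeasurable m' s where
  θ i := (hs.θ i).mono h le_rfl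
  θhat i := (hs.θhat i).mono h le_rfl
  v i := (hs.v i).mono h le_rfl
  g i := (hs.g i).mono h le_rfl
  ghat i := (hs.ghat i).mono h le_rfl

section

variable {A : Type*} {mA : MeasurableSpace A} {s : A → AgentState n d}

theorem StateMeasurable.thetaResidual (hs : StateMeasurable mA s) (i : Fin n) :
    Measurable fun o => thetaResidual η (s o) i :=
  ((hs.θ i).sub ((hs.g i).const_smul η)).sub (hs.θhat i)

theorem StateMeasurable.thetaHatNext (hs : StateMeasurable mA s) (hcomp : IsCompressor κ Q δ)
    {ξ : Fin n → A → Ξ} (hξ : ∀ i, Measurable (ξ i)) (i : Fin n) :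
    Measurable fun o => thetaHatNext Q η (s o) (fun j => ξ j o) i :=
  (hs.θhat i).add (hcomp.measurable.comp ((hs.thetaResidual i).prodMk (hξ i)))

theorem StateMeasurable.thetaNext (hs : StateMeasurable mA s) (hcomp : IsCompressor κ Q δ)
    {ξ : Fin n → A → Ξ} (hξ : ∀ i, Measurable (ξ i)) (i : Fin n) :
    Measurable fun o => thetaNext W Q η γ (s o) (fun j => ξ j o) i :=
  ((hs.θ i).sub ((hs.g i).const_smul η)).add ((Finset.measurable_fun_sum _ fun j _ =>
    ((hs.thetaHatNext hcomp hξ j).sub (hs.thetaHatNext hcomp hξ i)).const_smul (W i j)).const_smul γ)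

theorem measurable_vNext (hprob : IsStochasticProblem F D)
    (hθ : ∀ i, Measurable fun o => (s o).θ i) (hv : ∀ i, Measurable fun o => (s o).v i)
    {θ' : A → Fin n → Vec d} (hθ' : ∀ i, Measurable fun o => θ' o i) {z : A → Fin n → Z}
    (hz : ∀ i, Measurable fun o => z o i) (i : Fin n) :
    Measurable fun o => vNext F β (s o) (θ' o) (z o) i := by
  have h1 : Measurable fun o => stochGrad F i (θ' o i) (z o i) :=
    (hprob.measurable_grad i).comp ((hθ' i).prodMk (hz i))
  have h2 : Measurable fun o => stochGrad F i ((s o).θ i) (z o i) :=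
    (hprob.measurable_grad i).comp ((hθ i).prodMk (hz i))
  exact (h1.const_smul β).add ((((hv i).add h1).sub h2).const_smul (1 - β))

theorem StateMeasurable.gResidual (hs : StateMeasurable mA s) {v' : A → Fin n → Vec d}
    (hv' : ∀ i, Measurable fun o => v' o i) (i : Fin n) :
    Measurable fun o => gResidual (s o) (v' o) i :=
  (((hs.g i).add (hv' i)).sub (hs.v i)).sub (hs.ghat i)

theorem StateMeasurable.gHatNext (hs : StateMeasurable mA s) (hcomp : IsCompressor κ Q δ)
    {v' : A → Fin n → Vec d} (hv' : ∀ i, Measurable fun o => v' o i)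
    {ξ : Fin n → A → Ξ} (hξ : ∀ i, Measurable (ξ i)) (i : Fin n) :
    Measurable fun o => gHatNext Q (s o) (v' o) (fun j => ξ j o) i :=
  (hs.ghat i).add (hcomp.measurable.comp ((hs.gResidual hv' i).prodMk (hξ i)))

theorem StateMeasurable.gNext (hs : StateMeasurable mA s) (hcomp : IsCompressor κ Q δ)
    {v' : A → Fin n → Vec d} (hv' : ∀ i, Measurable fun o => v' o i)
    {ξ : Fin n → A → Ξ} (hξ : ∀ i, Measurable (ξ i)) (i : Fin n) :
    Measurable fun o => gNext W Q γ (s o) (v' o) (fun j => ξ j o) i :=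
  (((hs.g i).add (hv' i)).sub (hs.v i)).add ((Finset.measurable_fun_sum _ fun j _ =>
    ((hs.gHatNext hcomp hv' hξ j).sub (hs.gHatNext hcomp hv' hξ i)).const_smul (W i j)).const_smul γ)

theorem StateMeasurable.stepState (hs : StateMeasurable mA s) (hprob : IsStochasticProblem F D)
    (hcomp : IsCompressor κ Q δ) {ξ ξ' : Fin n → A → Ξ} (hξ : ∀ i, Measurable (ξ i))
    (hξ' : ∀ i, Measurable (ξ' i)) {z : Fin n → A → Z} (hz : ∀ i, Measurable (z i)) :
    StateMeasurable mA fun o => stepState F W Q η γ β (s o) (fun i => ξ i o) (fun i => z i o)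
      (fun i => ξ' i o) := by
  have hv := measurable_vNext (β := β) hprob hs.θ hs.v
    (hs.thetaNext (W := W) (η := η) (γ := γ) hcomp hξ) hz
  exact
    { θ := hs.thetaNext hcomp hξ
      θhat := hs.thetaHatNext hcomp hξ
      v := hv
      g := hs.gNext hcomp hv hξ'
      ghat := hs.gHatNext hcomp hv hξ' }

end

variable {Ω : Type w} {R : Draws Ω Z Ξ n b}

theorem measurable_iSup_comap {A B ι : Type*} [MeasurableSpace B] (X : ι → A → B) (i : ι) :
    Measurable[⨆ i, MeasurableSpace.comap (X i) inferInstance] (X i) :=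
  (comap_measurable (X i)).mono (le_iSup (fun i => MeasurableSpace.comap (X i) inferInstance) i)
    le_rfl

namespace Draws

theorem measurable_ξθ_pastData (R : Draws Ω Z Ξ n b) (t : ℕ) (i : Fin n) :
    Measurable[R.pastData t] (R.ξθ t i) :=
  (measurable_iSup_comap (R.ξθ t) i).mono le_sup_right le_rfl

theorem measurable_ζ_pastG (R : Draws Ω Z Ξ n b) (t : ℕ) (i : Fin n) :
    Measurable[R.pastG t] (R.ζ t i) :=
  (measurable_iSup_comap (R.ζ t) i).mono le_sup_right le_rfl

theorem measurable_ξg_past (R : Draws Ω Z Ξ n b) (t : ℕ) (i : Fin n) :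
    Measurable[R.past (t + 1)] (R.ξg t i) :=
  (measurable_iSup_comap (R.ξg t) i).mono le_sup_right le_rfl

theorem past_le_pastData (R : Draws Ω Z Ξ n b) (t : ℕ) : R.past t ≤ R.pastData t := le_sup_left

theorem pastData_le_pastG (R : Draws Ω Z Ξ n b) (t : ℕ) : R.pastData t ≤ R.pastG t := le_sup_left

theorem pastG_le_past (R : Draws Ω Z Ξ n b) (t : ℕ) : R.pastG t ≤ R.past (t + 1) := le_sup_left

end Draws

namespace IsSampling

variable [mΩ : MeasurableSpace Ω] {P : Measure Ω}

theorem past_le (hS : IsSampling P F D W κ Q θ₀ η γ β R) (t : ℕ) : R.past t ≤ mΩ := by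
  induction t with
  | zero => exact iSup_le fun i => iSup_le fun r => (hS.measurable_ζ0 i r).comap_le
  | succ t ih =>
    exact sup_le (sup_le (sup_le ih (iSup_le fun i => (hS.measurable_ξθ t i).comap_le))
      (iSup_le fun i => (hS.measurable_ζ t i).comap_le))
      (iSup_le fun i => (hS.measurable_ξg t i).comap_le)

theorem pastData_le (hS : IsSampling P F D W κ Q θ₀ η γ β R) (t : ℕ) : R.pastData t ≤ mΩ :=
  (R.pastData_le_pastG t).trans ((R.pastG_le_past t).trans (hS.past_le (t + 1)))

theorem pastG_le (hS : IsSampling P F D W κ Q θ₀ η γ β R) (t : ℕ) : R.pastG t ≤ mΩ :=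
  (R.pastG_le_past t).trans (hS.past_le (t + 1))

end IsSampling

theorem stateMeasurable_docom_past (hprob : IsStochasticProblem F D)
    (hcomp : IsCompressor κ Q δ) (R : Draws Ω Z Ξ n b) (t : ℕ) :
    StateMeasurable (R.past t) (docom F W Q θ₀ η γ β R t) := by
  induction t with
  | zero =>
    have h : ∀ i, Measurable[R.past 0] fun o => (docom F W Q θ₀ η γ β R 0 o).v i := by
      intro i
      suffices hm : Measurable[R.past 0] fun o => ∑ r, stochGrad F i θ₀ (R.ζ0 i r o) from
        hm.const_smul (b : ℝ)⁻¹
      refine Finset.measurable_fun_sum _ fun r _ => ?_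
      refine (hprob.measurable_stochGrad i θ₀).comp ?_
      exact (comap_measurable (R.ζ0 i r)).mono
        (le_iSup₂ (f := fun i r => MeasurableSpace.comap (R.ζ0 i r) inferInstance) i r) le_rfl
    exact
      { θ := fun i => measurable_const
        θhat := fun i => measurable_const
        v := h
        g := h
        ghat := fun i => measurable_const }
  | succ t ih =>
    have h1 := R.past_le_pastData t
    have h2 := R.pastData_le_pastG t
    have h3 := R.pastG_le_past t
    exact StateMeasurable.stepState (ih.mono ((h1.trans h2).trans h3)) hprob hcomp
      (fun i => (R.measurable_ξθ_pastData t i).mono (h2.trans h3) le_rfl)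
      (fun i => R.measurable_ξg_past t i)
      (fun i => (R.measurable_ζ_pastG t i).mono h3 le_rfl)

theorem measurable_thetaNext_pastData (hprob : IsStochasticProblem F D)
    (hcomp : IsCompressor κ Q δ) (R : Draws Ω Z Ξ n b) (t : ℕ) (i : Fin n) :
    Measurable[R.pastData t] fun o => (docom F W Q θ₀ η γ β R (t + 1) o).θ i :=
  ((stateMeasurable_docom_past hprob hcomp R t).mono (R.past_le_pastData t)).thetaNext
    hcomp (fun i => R.measurable_ξθ_pastData t i) i

theorem measurable_vNext_pastG (hprob : IsStochasticProblem F D)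
    (hcomp : IsCompressor κ Q δ) (R : Draws Ω Z Ξ n b) (t : ℕ) (i : Fin n) :
    Measurable[R.pastG t] fun o => (docom F W Q θ₀ η γ β R (t + 1) o).v i := by
  have h1 := R.past_le_pastData t
  have h2 := R.pastData_le_pastG t
  have hs := (stateMeasurable_docom_past (F := F) (W := W) (θ₀ := θ₀) (η := η) (γ := γ) (β := β)
    hprob hcomp R t).mono (h1.trans h2)
  exact measurable_vNext hprob hs.θ hs.v
    (fun i => (measurable_thetaNext_pastData hprob hcomp R t i).mono h2 le_rfl)
    (fun i => R.measurable_ζ_pastG t i) i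

end Measurability

/-! ### Square integrability of the iterates -/

section MemLp

variable {Ω : Type w} [MeasurableSpace Ω] {P : Measure Ω} {m n d : ℕ}

theorem integrable_norm_sq {E : Type*} [NormedAddCommGroup E] {f : Ω → E} (h : MemLp f 2 P) :
    Integrable (fun o => ‖f o‖ ^ 2) P := by
  simpa using h.integrable_norm_pow (p := 2) (by norm_num)

theorem integrable_frobSq {X : Ω → Fin m → Vec d} (h : ∀ i, MemLp (fun o => X o i) 2 P) :
    Integrable (fun o => frobSq (X o)) P :=
  integrable_finsetSum _ fun i _ => integrable_norm_sq (h i)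

theorem memLp_leftMul (A : Matrix (Fin m) (Fin n) ℝ) {X : Ω → Fin n → Vec d}
    (h : ∀ i, MemLp (fun o => X o i) 2 P) (k : Fin m) :
    MemLp (fun o => leftMul A (X o) k) 2 P :=
  memLp_finsetSum _ fun i _ => (h i).const_smul (A k i)

theorem memLp_rowAvg {X : Ω → Fin n → Vec d} (h : ∀ i, MemLp (fun o => X o i) 2 P) :
    MemLp (fun o => rowAvg (X o)) 2 P := by
  have h1 : MemLp (fun o => ∑ i, X o i) 2 P := memLp_finsetSum _ fun i _ => h i
  exact h1.const_smul (n : ℝ)⁻¹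

theorem measurable_of_rows {A : Type*} {mA : MeasurableSpace A} {X : A → Fin n → Vec d}
    (h : ∀ i, Measurable fun o => X o i) : Measurable X := measurable_pi_lambda _ h

theorem measurable_frobSq {A : Type*} [MeasurableSpace A] {X : A → Fin n → Vec d}
    (h : ∀ i, Measurable fun o => X o i) : Measurable fun o => frobSq (X o) :=
  Finset.measurable_fun_sum _ fun i _ => (h i).norm.pow_const 2

theorem measurable_rowAvg {A : Type*} [MeasurableSpace A] {X : A → Fin n → Vec d}
    (h : ∀ i, Measurable fun o => X o i) : Measurable fun o => rowAvg (X o) := by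
  have h1 : Measurable fun o => ∑ i, X o i := Finset.measurable_fun_sum _ fun i _ => h i
  exact h1.const_smul (n : ℝ)⁻¹

/-- All variables of the random state `s` are square integrable. -/
structure StateMemLp (P : Measure Ω) (s : Ω → AgentState n d) : Prop where
  θ : ∀ i, MemLp (fun o => (s o).θ i) 2 P
  θhat : ∀ i, MemLp (fun o => (s o).θhat i) 2 P
  v : ∀ i, MemLp (fun o => (s o).v i) 2 P
  g : ∀ i, MemLp (fun o => (s o).g i) 2 P
  ghat : ∀ i, MemLp (fun o => (s o).ghat i) 2 P

end MemLp

/-! ### Compression errors under the conditional law of the seeds -/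

section Compression

variable {Ω : Type w} {m mΩ : MeasurableSpace Ω} {P : Measure Ω} [IsProbabilityMeasure P]
  {n d : ℕ} {Ξ : Type v} [MeasurableSpace Ξ] {κ : Kernel (Vec d) Ξ} [IsMarkovKernel κ]
  {Q : Vec d → Ξ → Vec d} {δ : ℝ}

theorem IsCompressor.memLp_and_integral_le (hcomp : IsCompressor κ Q δ) {X : Ω → Ξ}
    {Y : Ω → Vec d} (h : HasCondLaw P m X fun o => κ (Y o)) (hm : m ≤ mΩ)
    (hY : Measurable[m] Y) (hX : Measurable X) (hY2 : MemLp Y 2 P) :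
    MemLp (fun o => Y o - Q (Y o) (X o)) 2 P ∧
      ∫ o, ‖Y o - Q (Y o) (X o)‖ ^ 2 ∂P ≤ (1 - δ) * ∫ o, ‖Y o‖ ^ 2 ∂P := by
  have hmeas : Measurable fun p : Vec d × Ξ => p.1 - Q p.1 p.2 :=
    measurable_fst.sub hcomp.measurable
  have hδ : 0 ≤ 1 - δ := by linarith [hcomp.delta_le]
  have key := h.integral_le hm hY hX (f := fun p => ‖p.1 - Q p.1 p.2‖ ^ 2)
    (hmeas.norm.pow_const 2) (fun p => by positivity) (c := fun y => (1 - δ) * ‖y‖ ^ 2)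
    (fun y => by
      have h1 := memLp_two_and_integral_le (ν := κ y) (f := fun x => y - Q y x)
        (hmeas.comp measurable_prodMk_left).aestronglyMeasurable
        (c := (1 - δ) * ‖y‖ ^ 2) (by positivity) (hcomp.contraction y)
      exact ⟨integrable_norm_sq h1.1, h1.2⟩)
    ((integrable_norm_sq hY2).const_mul _)
  refine ⟨?_, by simpa only [integral_const_mul] using key.2⟩
  exact (memLp_two_iff_integrable_sq_norm
    (hmeas.comp ((hY.mono hm le_rfl).prodMk hX)).aestronglyMeasurable).2 key.1

/-- The squared Frobenius norm is a sum over agents, so only the law of each single seed enters; the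
seeds of one round may be dependent. -/
theorem IsCompressor.integral_frobSq_compErr_le (hcomp : IsCompressor κ Q δ)
    {X : Fin n → Ω → Ξ} {Y : Ω → Fin n → Vec d}
    (h : ∀ i, HasCondLaw P m (X i) fun o => κ (Y o i)) (hm : m ≤ mΩ)
    (hY : ∀ i, Measurable[m] fun o => Y o i) (hX : ∀ i, Measurable (X i))
    (hY2 : ∀ i, MemLp (fun o => Y o i) 2 P) :
    (∀ i, MemLp (fun o => compErr Q (Y o) (fun j => X j o) i) 2 P) ∧
      ∫ o, frobSq (compErr Q (Y o) fun j => X j o) ∂P ≤ (1 - δ) * ∫ o, frobSq (Y o) ∂P := by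
  have hi := fun i => hcomp.memLp_and_integral_le (h i) hm (hY i) (hX i) (hY2 i)
  refine ⟨fun i => (hi i).1, ?_⟩
  simp only [frobSq, compErr]
  rw [integral_finsetSum _ fun i _ => integrable_norm_sq (hi i).1,
    integral_finsetSum _ fun i _ => integrable_norm_sq (hY2 i), Finset.mul_sum]
  exact Finset.sum_le_sum fun i _ => (hi i).2

end Compression

/-! ### Moments of the iterates and of the estimator errors -/

section Iterates

variable {n d b : ℕ} {Z : Type u} [MeasurableSpace Z] {Ξ : Type v} [MeasurableSpace Ξ]
  {F : Fin n → Vec d → Z → ℝ} {D : Fin n → Measure Z}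
  {W : Matrix (Fin n) (Fin n) ℝ} {κ : Kernel (Vec d) Ξ}
  {Q : Vec d → Ξ → Vec d} {L σ δ η γ β : ℝ} {θ₀ : Vec d}
  {Ω : Type w} [mΩ : MeasurableSpace Ω] {P : Measure Ω}
  {R : Draws Ω Z Ξ n b}

local notation "𝐬" => docom F W Q θ₀ η γ β R

theorem IsSampling.measurePreserving_ζ0 (hS : IsSampling P F D W κ Q θ₀ η γ β R) :
    MeasurePreserving (fun o i r => R.ζ0 i r o) P
      (Measure.pi fun i : Fin n => Measure.pi fun _ : Fin b => D i) :=
  ⟨measurable_pi_lambda _ fun i => measurable_pi_lambda _ fun r => hS.measurable_ζ0 i r,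
    hS.law_init⟩

theorem measurable_fullGrad (hprob : IsStochasticProblem F D) {A : Type*} [MeasurableSpace A]
    {X : A → Fin n → Vec d} (h : ∀ i, Measurable fun o => X o i) (i : Fin n) :
    Measurable fun o => fullGrad F D (X o) i :=
  (hprob.continuous_gradient i).measurable.comp (h i)

theorem StateMemLp.thetaResidual {s : Ω → AgentState n d} (hs : StateMemLp P s) (i : Fin n) :
    MemLp (fun o => thetaResidual η (s o) i) 2 P :=
  ((hs.θ i).sub ((hs.g i).const_smul η)).sub (hs.θhat i)

variable [IsProbabilityMeasure P]

theorem stateMemLp_docom_zero [∀ i, IsProbabilityMeasure (D i)] (hprob : IsStochasticProblem F D)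
    (hgrad : HasUnbiasedGradients F D σ) (hS : IsSampling P F D W κ Q θ₀ η γ β R) :
    StateMemLp P (𝐬 0) := by
  have h : ∀ i, MemLp (fun o => (𝐬 0 o).v i) 2 P := by
    intro i
    have h1 : ∀ r, MemLp (fun o => stochGrad F i θ₀ (R.ζ0 i r o)) 2 P := fun r =>
      (((hgrad.memLp hprob i θ₀).comp_measurePreserving
        (measurePreserving_eval (fun _ : Fin b => D i) r)).comp_measurePreserving
        (measurePreserving_eval (fun i : Fin n => Measure.pi fun _ : Fin b => D i)
          i)).comp_measurePreserving hS.measurePreserving_ζ0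
    have h2 : MemLp (fun o => ∑ r, stochGrad F i θ₀ (R.ζ0 i r o)) 2 P :=
      memLp_finsetSum _ fun r _ => h1 r
    exact h2.const_smul (b : ℝ)⁻¹
  exact
    { θ := fun i => memLp_const _
      θhat := fun i => memLp_const _
      v := h
      g := h
      ghat := fun i => memLp_const _ }

/-- Transfer of a bound for fixed iterates to the data samples of iteration `t`. -/
theorem integral_data_le [∀ i, IsProbabilityMeasure (D i)] (hprob : IsStochasticProblem F D) (hcomp : IsCompressor κ Q δ)
    (hS : IsSampling P F D W κ Q θ₀ η γ β R) (t : ℕ)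
    {f : (Fin n → Vec d) → (Fin n → Vec d) → (Fin n → Vec d) → (Fin n → Vec d) → ℝ}
    (hf : Measurable fun p : (Fin n → Vec d) × (Fin n → Vec d) × (Fin n → Vec d) × (Fin n → Vec d)
      => f p.1 p.2.1 p.2.2.1 p.2.2.2)
    (hf0 : ∀ θ v θ' v', 0 ≤ f θ v θ' v')
    {c : (Fin n → Vec d) → (Fin n → Vec d) → (Fin n → Vec d) → ℝ}
    (hc : ∀ (s : AgentState n d) θ',
      Integrable (fun z => f s.θ s.v θ' (vNext F β s θ' z)) (Measure.pi D) ∧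
        ∫ z, f s.θ s.v θ' (vNext F β s θ' z) ∂(Measure.pi D) ≤ c s.θ s.v θ')
    (hci : Integrable (fun o => c (𝐬 t o).θ (𝐬 t o).v (𝐬 (t + 1) o).θ) P) :
    Integrable (fun o => f (𝐬 t o).θ (𝐬 t o).v (𝐬 (t + 1) o).θ (𝐬 (t + 1) o).v) P ∧
      ∫ o, f (𝐬 t o).θ (𝐬 t o).v (𝐬 (t + 1) o).θ (𝐬 (t + 1) o).v ∂P
        ≤ ∫ o, c (𝐬 t o).θ (𝐬 t o).v (𝐬 (t + 1) o).θ ∂P := by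
  have hsm := (stateMeasurable_docom_past (F := F) (W := W) (θ₀ := θ₀) (η := η) (γ := γ) (β := β)
    hprob hcomp R t).mono (R.past_le_pastData t)
  have hY : Measurable[R.pastData t] fun o => ((𝐬 t o).θ, (𝐬 t o).v, (𝐬 (t + 1) o).θ) :=
    (measurable_of_rows hsm.θ).prodMk ((measurable_of_rows hsm.v).prodMk
      (measurable_of_rows (measurable_thetaNext_pastData hprob hcomp R t)))
  have hX : Measurable fun o i => R.ζ t i o := measurable_pi_lambda _ (hS.measurable_ζ t)
  -- The momentum update reads only θ and v of the old state, so the other three fields are filled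
  -- with 0.
  have hv : Measurable fun p : ((Fin n → Vec d) × (Fin n → Vec d) × (Fin n → Vec d)) × (Fin n → Z) =>
      vNext F β ⟨p.1.1, 0, p.1.2.1, 0, 0⟩ p.1.2.2 p.2 := by
    refine measurable_pi_lambda _ fun i => measurable_vNext hprob (fun i => ?_) (fun i => ?_)
      (fun i => ?_) (fun i => ?_) i
    all_goals fun_prop
  have hlaw : HasCondLaw P (R.pastData t) (fun o i => R.ζ t i o) fun o =>
      Kernel.const ((Fin n → Vec d) × (Fin n → Vec d) × (Fin n → Vec d)) (Measure.pi D) ((𝐬 t o).θ, (𝐬 t o).v, (𝐬 (t + 1) o).θ) := by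
    simpa using hS.law_ζ t
  exact hlaw.integral_le (hS.pastData_le t) hY hX
    (f := fun p => f p.1.1 p.1.2.1 p.1.2.2 (vNext F β ⟨p.1.1, 0, p.1.2.1, 0, 0⟩ p.1.2.2 p.2))
    (hf.comp (measurable_fst.fst.prodMk (measurable_fst.snd.fst.prodMk
      (measurable_fst.snd.snd.prodMk hv))))
    (fun p => hf0 _ _ _ _) (c := fun y => c y.1 y.2.1 y.2.2)
    (fun y => hc ⟨y.1, 0, y.2.1, 0, 0⟩ y.2.2) hci

variable [IsMarkovKernel κ]

theorem integral_compErr_theta (hprob : IsStochasticProblem F D)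
    (hcomp : IsCompressor κ Q δ) (hS : IsSampling P F D W κ Q θ₀ η γ β R) {t : ℕ}
    (hs : StateMemLp P (𝐬 t)) :
    (∀ i, MemLp (fun o => compErr Q (thetaResidual η (𝐬 t o)) (fun j => R.ξθ t j o) i) 2 P) ∧
      ∫ o, frobSq (compErr Q (thetaResidual η (𝐬 t o)) fun j => R.ξθ t j o) ∂P
        ≤ (1 - δ) * ∫ o, frobSq (thetaResidual η (𝐬 t o)) ∂P :=
  hcomp.integral_frobSq_compErr_le (hS.law_ξθ t) (hS.past_le t)
    (fun i => (stateMeasurable_docom_past hprob hcomp R t).thetaResidual i)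
    (hS.measurable_ξθ t) hs.thetaResidual

theorem memLp_thetaHat_succ (hprob : IsStochasticProblem F D)
    (hcomp : IsCompressor κ Q δ) (hS : IsSampling P F D W κ Q θ₀ η γ β R) {t : ℕ}
    (hs : StateMemLp P (𝐬 t)) (i : Fin n) : MemLp (fun o => (𝐬 (t + 1) o).θhat i) 2 P := by
  have h := ((hs.θhat i).add (hs.thetaResidual (η := η) i)).sub
    ((integral_compErr_theta hprob hcomp hS hs).1 i)
  refine h.ae_eq (Eventually.of_forall fun o => ?_)
  simp [docom, stepState, thetaHatNext, compErr]
  abel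

theorem memLp_theta_succ (hprob : IsStochasticProblem F D)
    (hcomp : IsCompressor κ Q δ) (hS : IsSampling P F D W κ Q θ₀ η γ β R) {t : ℕ}
    (hs : StateMemLp P (𝐬 t)) (i : Fin n) : MemLp (fun o => (𝐬 (t + 1) o).θ i) 2 P := by
  have h := memLp_thetaHat_succ hprob hcomp hS hs
  have h1 : MemLp (fun o => ∑ j, W i j • ((𝐬 (t + 1) o).θhat j - (𝐬 (t + 1) o).θhat i)) 2 P :=
    memLp_finsetSum _ fun j _ => ((h j).sub (h i)).const_smul (W i j)
  exact ((hs.θ i).sub ((hs.g i).const_smul η)).add (h1.const_smul γ)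

variable [∀ i, IsProbabilityMeasure (D i)]

/-- A Lipschitz gradient grows at most linearly, hence preserves square integrability. -/
theorem memLp_fullGrad (hprob : IsStochasticProblem F D)
    (hlip : HasLipschitzSampleGradients F D L) (hgrad : HasUnbiasedGradients F D σ)
    {X : Ω → Fin n → Vec d} (hX : ∀ i, MemLp (fun o => X o i) 2 P) (i : Fin n) :
    MemLp (fun o => fullGrad F D (X o) i) 2 P := by
  have hm : AEStronglyMeasurable (fun o => fullGrad F D (X o) i) P :=
    (hprob.continuous_gradient i).comp_aestronglyMeasurable (hX i).1
  have h0 : MemLp (fun o => fullGrad F D (X o) i - gradient (localObj F D i) 0) 2 P := by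
    refine (hX i).of_le_mul (c := L) (hm.sub aestronglyMeasurable_const)
      (Eventually.of_forall fun o => ?_)
    have h := norm_gradient_localObj_sub_le hprob hlip hgrad i (X o i) 0
    rw [sub_zero] at h
    exact h
  have h1 := h0.add (memLp_const (gradient (localObj F D i) 0))
  refine h1.ae_eq (Eventually.of_forall fun o => ?_)
  simp

theorem integral_gradErr_succ_le (hprob : IsStochasticProblem F D)
    (hlip : HasLipschitzSampleGradients F D L) (hgrad : HasUnbiasedGradients F D σ)
    (hcomp : IsCompressor κ Q δ) (hS : IsSampling P F D W κ Q θ₀ η γ β R) {t : ℕ}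
    (hs : StateMemLp P (𝐬 t)) :
    Integrable (fun o => frobSq ((𝐬 (t + 1) o).v - fullGrad F D (𝐬 (t + 1) o).θ)) P ∧
    ∫ o, frobSq ((𝐬 (t + 1) o).v - fullGrad F D (𝐬 (t + 1) o).θ) ∂P
      ≤ (1 - β) ^ 2 * ∫ o, frobSq ((𝐬 t o).v - fullGrad F D (𝐬 t o).θ) ∂P
        + 2 * β ^ 2 * n * σ ^ 2
        + 2 * (1 - β) ^ 2 * L ^ 2 * ∫ o, frobSq ((𝐬 (t + 1) o).θ - (𝐬 t o).θ) ∂P := by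
  have i1 : Integrable (fun o => frobSq ((𝐬 t o).v - fullGrad F D (𝐬 t o).θ)) P :=
    integrable_frobSq fun i => (hs.v i).sub (memLp_fullGrad hprob hlip hgrad hs.θ i)
  have i2 : Integrable (fun o => frobSq ((𝐬 (t + 1) o).θ - (𝐬 t o).θ)) P :=
    integrable_frobSq fun i => (memLp_theta_succ hprob hcomp hS hs i).sub (hs.θ i)
  have h := integral_data_le hprob hcomp hS t
    (f := fun _ _ θ' v' => frobSq (v' - fullGrad F D θ'))
    (c := fun θ v θ' => (1 - β) ^ 2 * frobSq (v - fullGrad F D θ) + 2 * β ^ 2 * n * σ ^ 2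
        + 2 * (1 - β) ^ 2 * L ^ 2 * frobSq (θ' - θ))
    (measurable_frobSq fun i => Measurable.sub (by fun_prop)
      (measurable_fullGrad hprob (by fun_prop) i))
    (fun _ _ _ _ => frobSq_nonneg _)
    (fun s θ' => integral_frobSq_vNext_sub_fullGrad_le hprob hlip hgrad β s θ')
    (((i1.const_mul _).add (integrable_const _)).add (i2.const_mul _))
  refine ⟨h.1, h.2.trans (le_of_eq ?_)⟩
  rw [integral_add (by fun_prop) (by fun_prop), integral_add (by fun_prop) (by fun_prop)]
  simp [integral_const_mul]

theorem memLp_v_succ (hprob : IsStochasticProblem F D)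
    (hlip : HasLipschitzSampleGradients F D L) (hgrad : HasUnbiasedGradients F D σ)
    (hcomp : IsCompressor κ Q δ) (hS : IsSampling P F D W κ Q θ₀ η γ β R) {t : ℕ}
    (hs : StateMemLp P (𝐬 t)) (i : Fin n) : MemLp (fun o => (𝐬 (t + 1) o).v i) 2 P := by
  have hθ := memLp_theta_succ hprob hcomp hS hs
  have hg := memLp_fullGrad hprob hlip hgrad hθ i
  have hm : Measurable fun o => (𝐬 (t + 1) o).v i :=
    (measurable_vNext_pastG hprob hcomp R t i).mono (hS.pastG_le t) le_rfl
  have hi := (integral_gradErr_succ_le hprob hlip hgrad hcomp hS hs).1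
  have h1 : MemLp (fun o => (𝐬 (t + 1) o).v i - fullGrad F D (𝐬 (t + 1) o).θ i) 2 P := by
    refine (memLp_two_iff_integrable_sq_norm (hm.aestronglyMeasurable.sub hg.1)).2 ?_
    refine hi.mono' ((hm.aestronglyMeasurable.sub hg.1).norm.pow 2)
      (Eventually.of_forall fun o => ?_)
    rw [Real.norm_of_nonneg (by positivity)]
    -- One row of the error is dominated by the whole Frobenius norm, whose integrability is already
    -- known.
    exact Finset.single_le_sum (f := fun i =>
      ‖((𝐬 (t + 1) o).v - fullGrad F D (𝐬 (t + 1) o).θ) i‖ ^ 2) (fun _ _ => by positivity)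
      (Finset.mem_univ i)
  have h2 := h1.add hg
  refine h2.ae_eq (Eventually.of_forall fun o => ?_)
  simp

theorem memLp_gResidual (hprob : IsStochasticProblem F D)
    (hlip : HasLipschitzSampleGradients F D L) (hgrad : HasUnbiasedGradients F D σ)
    (hcomp : IsCompressor κ Q δ) (hS : IsSampling P F D W κ Q θ₀ η γ β R) {t : ℕ}
    (hs : StateMemLp P (𝐬 t)) (i : Fin n) :
    MemLp (fun o => gResidual (𝐬 t o) (𝐬 (t + 1) o).v i) 2 P :=
  (((hs.g i).add (memLp_v_succ hprob hlip hgrad hcomp hS hs i)).sub (hs.v i)).sub (hs.ghat i)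

theorem integral_compErr_g (hprob : IsStochasticProblem F D)
    (hlip : HasLipschitzSampleGradients F D L) (hgrad : HasUnbiasedGradients F D σ)
    (hcomp : IsCompressor κ Q δ) (hS : IsSampling P F D W κ Q θ₀ η γ β R) {t : ℕ}
    (hs : StateMemLp P (𝐬 t)) :
    (∀ i, MemLp (fun o => compErr Q (gResidual (𝐬 t o) (𝐬 (t + 1) o).v)
        (fun j => R.ξg t j o) i) 2 P) ∧
      ∫ o, frobSq (compErr Q (gResidual (𝐬 t o) (𝐬 (t + 1) o).v) fun j => R.ξg t j o) ∂P
        ≤ (1 - δ) * ∫ o, frobSq (gResidual (𝐬 t o) (𝐬 (t + 1) o).v) ∂P :=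
  hcomp.integral_frobSq_compErr_le (hS.law_ξg t) (hS.pastG_le t)
    (fun i => ((stateMeasurable_docom_past hprob hcomp R t).mono
      ((R.past_le_pastData t).trans (R.pastData_le_pastG t))).gResidual
      (measurable_vNext_pastG hprob hcomp R t) i)
    (hS.measurable_ξg t) (memLp_gResidual hprob hlip hgrad hcomp hS hs)

theorem stateMemLp_docom (hprob : IsStochasticProblem F D)
    (hlip : HasLipschitzSampleGradients F D L) (hgrad : HasUnbiasedGradients F D σ)
    (hcomp : IsCompressor κ Q δ) (hS : IsSampling P F D W κ Q θ₀ η γ β R) (t : ℕ) :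
    StateMemLp P (𝐬 t) := by
  induction t with
  | zero => exact stateMemLp_docom_zero hprob hgrad hS
  | succ t hs =>
    have hv := memLp_v_succ hprob hlip hgrad hcomp hS hs
    have hghat : ∀ i, MemLp (fun o => (𝐬 (t + 1) o).ghat i) 2 P := by
      intro i
      have h := ((hs.ghat i).add (memLp_gResidual hprob hlip hgrad hcomp hS hs i)).sub
        ((integral_compErr_g hprob hlip hgrad hcomp hS hs).1 i)
      refine h.ae_eq (Eventually.of_forall fun o => ?_)
      simp [docom, stepState, gHatNext, compErr]
      abel
    refine
      { θ := memLp_theta_succ hprob hcomp hS hs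
        θhat := memLp_thetaHat_succ hprob hcomp hS hs
        v := hv
        g := fun i => ?_
        ghat := hghat }
    have h1 : MemLp (fun o => ∑ j, W i j • ((𝐬 (t + 1) o).ghat j - (𝐬 (t + 1) o).ghat i)) 2 P :=
      memLp_finsetSum _ fun j _ => ((hghat j).sub (hghat i)).const_smul (W i j)
    exact (((hs.g i).add (hv i)).sub (hs.v i)).add (h1.const_smul γ)

theorem integral_avgErr_succ_le (hn : 0 < n) (hprob : IsStochasticProblem F D)
    (hlip : HasLipschitzSampleGradients F D L) (hgrad : HasUnbiasedGradients F D σ)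
    (hcomp : IsCompressor κ Q δ) (hS : IsSampling P F D W κ Q θ₀ η γ β R) (t : ℕ) :
    ∫ o, ‖rowAvg (𝐬 (t + 1) o).v - rowAvg (fullGrad F D (𝐬 (t + 1) o).θ)‖ ^ 2 ∂P
      ≤ (1 - β) ^ 2 * ∫ o, ‖rowAvg (𝐬 t o).v - rowAvg (fullGrad F D (𝐬 t o).θ)‖ ^ 2 ∂P
        + ((n : ℝ)⁻¹ * (2 * β ^ 2 * σ ^ 2)
          + (n : ℝ)⁻¹ ^ 2 * (2 * (1 - β) ^ 2 * L ^ 2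
            * ∫ o, frobSq ((𝐬 (t + 1) o).θ - (𝐬 t o).θ) ∂P)) := by
  have hs := stateMemLp_docom hprob hlip hgrad hcomp hS t
  have i1 : Integrable (fun o => ‖rowAvg (𝐬 t o).v - rowAvg (fullGrad F D (𝐬 t o).θ)‖ ^ 2) P :=
    integrable_norm_sq ((memLp_rowAvg hs.v).sub
      (memLp_rowAvg (memLp_fullGrad hprob hlip hgrad hs.θ)))
  have i2 : Integrable (fun o => frobSq ((𝐬 (t + 1) o).θ - (𝐬 t o).θ)) P :=
    integrable_frobSq fun i => (memLp_theta_succ hprob hcomp hS hs i).sub (hs.θ i)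
  have h := integral_data_le hprob hcomp hS t
    (f := fun _ _ θ' v' => ‖rowAvg v' - rowAvg (fullGrad F D θ')‖ ^ 2)
    (c := fun θ v θ' => (1 - β) ^ 2 * ‖rowAvg v - rowAvg (fullGrad F D θ)‖ ^ 2
        + ((n : ℝ)⁻¹ * (2 * β ^ 2 * σ ^ 2)
          + (n : ℝ)⁻¹ ^ 2 * (2 * (1 - β) ^ 2 * L ^ 2 * frobSq (θ' - θ))))
    (((measurable_rowAvg (by fun_prop)).sub (measurable_rowAvg
      (measurable_fullGrad hprob (by fun_prop)))).norm.pow_const 2)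
    (fun _ _ _ _ => by positivity)
    (fun s θ' => integral_norm_rowAvg_vNext_sub_fullGrad_le hn hprob hlip hgrad β s θ')
    ((i1.const_mul _).add ((integrable_const _).add ((i2.const_mul _).const_mul _)))
  refine h.2.trans (le_of_eq ?_)
  rw [integral_add (by fun_prop) (by fun_prop), integral_add (by fun_prop) (by fun_prop)]
  simp [integral_const_mul]

theorem integral_vDrift_le (hprob : IsStochasticProblem F D)
    (hlip : HasLipschitzSampleGradients F D L) (hgrad : HasUnbiasedGradients F D σ)
    (hcomp : IsCompressor κ Q δ) (hS : IsSampling P F D W κ Q θ₀ η γ β R) (t : ℕ) :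
    ∫ o, frobSq ((𝐬 (t + 1) o).v - (𝐬 t o).v) ∂P
      ≤ 3 * β ^ 2 * ∫ o, frobSq ((𝐬 t o).v - fullGrad F D (𝐬 t o).θ) ∂P
        + 3 * β ^ 2 * n * σ ^ 2
        + 3 * L ^ 2 * ∫ o, frobSq ((𝐬 (t + 1) o).θ - (𝐬 t o).θ) ∂P := by
  have hs := stateMemLp_docom hprob hlip hgrad hcomp hS t
  have i1 : Integrable (fun o => frobSq ((𝐬 t o).v - fullGrad F D (𝐬 t o).θ)) P :=
    integrable_frobSq fun i => (hs.v i).sub (memLp_fullGrad hprob hlip hgrad hs.θ i)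
  have i2 : Integrable (fun o => frobSq ((𝐬 (t + 1) o).θ - (𝐬 t o).θ)) P :=
    integrable_frobSq fun i => (memLp_theta_succ hprob hcomp hS hs i).sub (hs.θ i)
  have h := integral_data_le hprob hcomp hS t
    (f := fun _ v _ v' => frobSq (v' - v))
    (c := fun θ v θ' => 3 * β ^ 2 * frobSq (v - fullGrad F D θ) + 3 * β ^ 2 * n * σ ^ 2
        + 3 * L ^ 2 * frobSq (θ' - θ))
    (measurable_frobSq fun i => by simp only [Pi.sub_apply]; fun_prop)
    (fun _ _ _ _ => frobSq_nonneg _)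
    (fun s θ' => integral_frobSq_vNext_sub_le hprob hlip hgrad β s θ')
    (((i1.const_mul _).add (integrable_const _)).add (i2.const_mul _))
  refine h.2.trans (le_of_eq ?_)
  rw [integral_add (by fun_prop) (by fun_prop), integral_add (by fun_prop) (by fun_prop)]
  simp [integral_const_mul]

end Iterates

/-! ### The one-step bounds in expectation -/

/-- The bounds on the mean square errors after one iteration (primed) in terms of those before:
`x`, `g` consensus errors of `θ`, `g`; `m`, `e` errors of the gradient estimators; `s`, `r`
compression residuals; `h` the mean square of the averaged direction; `D`, `E` the displacements of
`θ` and `v`. -/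
structure StepBounds (n : ℕ) (L ρ ωb σ δ η γ β x m e g s r x' m' e' g' s' r' h D E : ℝ) :
    Prop where
  consensus : x' ≤ (1 - ρ * γ / 2) * x + 2 / (ρ * γ) * (η ^ 2 * g) + γ * ωb ^ 2 / ρ * r
  displacement : D ≤ n * η ^ 2 * h + 3 * γ ^ 2 * ωb ^ 2 * x + 3 * η ^ 2 * g
    + 3 * γ ^ 2 * ωb ^ 2 * r
  gradErr : e' ≤ (1 - β) ^ 2 * e + 2 * β ^ 2 * n * σ ^ 2 + 2 * (1 - β) ^ 2 * L ^ 2 * D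
  avgErr : m' ≤ (1 - β) ^ 2 * m + ((n : ℝ)⁻¹ * (2 * β ^ 2 * σ ^ 2)
    + (n : ℝ)⁻¹ ^ 2 * (2 * (1 - β) ^ 2 * L ^ 2 * D))
  vDrift : E ≤ 3 * β ^ 2 * e + 3 * β ^ 2 * n * σ ^ 2 + 3 * L ^ 2 * D
  tracking : g' ≤ (1 - ρ * γ / 2) * g + 2 / (ρ * γ) * E + γ * ωb ^ 2 / ρ * (2 * s + 2 * E)
  gRes : s' ≤ (1 - δ / 2) * s + 11 / δ * E + 11 / δ * (γ ^ 2 * ωb ^ 2 * (2 * g + 2 * E))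
  thetaRes : r' ≤ (1 - δ / 2) * r + 11 / δ * (2 * (γ ^ 2 * ωb ^ 2 * (2 * x + 2 * (η ^ 2 * g)))
    + 2 * (η ^ 2 * (2 * n * h + 2 * E + g')))

theorem integral_le_linear_comb {Ω : Type*} [MeasurableSpace Ω] {P : Measure Ω} {k : ℕ}
    {f : Ω → ℝ} {f' : Fin k → Ω → ℝ} {c : Fin k → ℝ} (hf : Integrable f P)
    (hf' : ∀ i, Integrable (f' i) P) (h : ∀ o, f o ≤ ∑ i, c i * f' i o) :
    ∫ o, f o ∂P ≤ ∑ i, c i * ∫ o, f' i o ∂P := by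
  have h1 := integral_mono hf (integrable_finsetSum _ fun i _ => (hf' i).const_mul (c i)) h
  rw [integral_finsetSum _ fun i _ => (hf' i).const_mul (c i)] at h1
  simpa only [integral_const_mul] using h1

theorem integral_le_linear_comb₄ {Ω : Type*} [MeasurableSpace Ω] {P : Measure Ω}
    {f f₁ f₂ f₃ f₄ : Ω → ℝ} {c₁ c₂ c₃ c₄ : ℝ} (hf : Integrable f P) (h₁ : Integrable f₁ P)
    (h₂ : Integrable f₂ P) (h₃ : Integrable f₃ P) (h₄ : Integrable f₄ P)
    (h : ∀ o, f o ≤ c₁ * f₁ o + c₂ * f₂ o + c₃ * f₃ o + c₄ * f₄ o) :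
    ∫ o, f o ∂P ≤ c₁ * ∫ o, f₁ o ∂P + c₂ * ∫ o, f₂ o ∂P + c₃ * ∫ o, f₃ o ∂P
      + c₄ * ∫ o, f₄ o ∂P := by
  have h0 := integral_le_linear_comb (f' := ![f₁, f₂, f₃, f₄]) (c := ![c₁, c₂, c₃, c₄]) hf
    (by intro i; fin_cases i <;> assumption) (by simpa [Fin.sum_univ_succ, add_assoc] using h)
  simpa [Fin.sum_univ_succ, add_assoc] using h0

theorem integral_le_linear_comb₆ {Ω : Type*} [MeasurableSpace Ω] {P : Measure Ω}
    {f f₁ f₂ f₃ f₄ f₅ f₆ : Ω → ℝ} {c₁ c₂ c₃ c₄ c₅ c₆ : ℝ} (hf : Integrable f P)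
    (h₁ : Integrable f₁ P) (h₂ : Integrable f₂ P) (h₃ : Integrable f₃ P) (h₄ : Integrable f₄ P)
    (h₅ : Integrable f₅ P) (h₆ : Integrable f₆ P)
    (h : ∀ o, f o ≤ c₁ * f₁ o + c₂ * f₂ o + c₃ * f₃ o + c₄ * f₄ o + c₅ * f₅ o + c₆ * f₆ o) :
    ∫ o, f o ∂P ≤ c₁ * ∫ o, f₁ o ∂P + c₂ * ∫ o, f₂ o ∂P + c₃ * ∫ o, f₃ o ∂P
      + c₄ * ∫ o, f₄ o ∂P + c₅ * ∫ o, f₅ o ∂P + c₆ * ∫ o, f₆ o ∂P := by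
  have h0 := integral_le_linear_comb (f' := ![f₁, f₂, f₃, f₄, f₅, f₆])
    (c := ![c₁, c₂, c₃, c₄, c₅, c₆]) hf
    (by intro i; fin_cases i <;> assumption) (by simpa [Fin.sum_univ_succ, add_assoc] using h)
  simpa [Fin.sum_univ_succ, add_assoc] using h0

section Expectation

variable {n d b : ℕ} {Z : Type u} [MeasurableSpace Z] {Ξ : Type v} [MeasurableSpace Ξ]
  {G : SimpleGraph (Fin n)} {U : Matrix (Fin n) (Fin (n - 1)) ℝ} {ρ ωb : ℝ}
  {F : Fin n → Vec d → Z → ℝ} {D : Fin n → Measure Z} [∀ i, IsProbabilityMeasure (D i)]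
  {W : Matrix (Fin n) (Fin n) ℝ} {κ : Kernel (Vec d) Ξ} [IsMarkovKernel κ]
  {Q : Vec d → Ξ → Vec d} {L σ δ η γ β : ℝ} {θ₀ : Vec d}
  {Ω : Type w} [mΩ : MeasurableSpace Ω] {P : Measure Ω} [IsProbabilityMeasure P]
  {R : Draws Ω Z Ξ n b}

local notation "𝐬" => docom F W Q θ₀ η γ β R

/-- (1 + δ/10)⁴ ≤ 1 + δ/2, and (1 + δ/2)(1 - δ) ≤ 1 - δ/2. This dictates the choice δ/10 of the
Young parameters. -/
theorem contraction_factor_le {δ : ℝ} (hδ : 0 < δ) (hδ1 : δ ≤ 1) :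
    (1 + δ / 10) ^ 3 * (1 - δ) * (1 + δ / 10) ≤ 1 - δ / 2 := by
  have h2 : δ ^ 2 ≤ δ := by nlinarith
  have h3 : δ ^ 3 ≤ δ := by nlinarith [sq_nonneg δ]
  have h4 : δ ^ 4 ≤ δ := by nlinarith [sq_nonneg δ, sq_nonneg (δ ^ 2)]
  have e : (1 + δ / 10) ^ 3 * (1 + δ / 10)
      = 1 + 4 / 10 * δ + 6 / 100 * δ ^ 2 + 4 / 1000 * δ ^ 3 + 1 / 10000 * δ ^ 4 := by ring
  have h5 : (1 + δ / 10) ^ 3 * (1 + δ / 10) ≤ 1 + δ / 2 := by rw [e]; linarith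
  calc _ = (1 + δ / 10) ^ 3 * (1 + δ / 10) * (1 - δ) := by ring
    _ ≤ (1 + δ / 2) * (1 - δ) := by
      have : 0 ≤ 1 - δ := by linarith
      gcongr
    _ ≤ _ := by nlinarith

theorem stepBounds_docom (hn : 0 < n) (hprob : IsStochasticProblem F D)
    (hlip : HasLipschitzSampleGradients F D L) (hmix : IsMixing G W U ρ ωb)
    (hgrad : HasUnbiasedGradients F D σ) (hcomp : IsCompressor κ Q δ)
    (h0 : 0 < γ) (h1 : γ ≤ 1) (hp : ρ * γ < 1) (hγ : γ * ωb ≤ δ / 10)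
    (hS : IsSampling P F D W κ Q θ₀ η γ β R) (t : ℕ) :
    StepBounds n L ρ ωb σ δ η γ β
      (∫ o, frobSq (leftMul U.transpose (𝐬 t o).θ) ∂P)
      (∫ o, ‖rowAvg (𝐬 t o).v - rowAvg (fullGrad F D (𝐬 t o).θ)‖ ^ 2 ∂P)
      (∫ o, frobSq ((𝐬 t o).v - fullGrad F D (𝐬 t o).θ) ∂P)
      (∫ o, frobSq (leftMul U.transpose (𝐬 t o).g) ∂P)
      (∫ o, frobSq ((𝐬 t o).g - (𝐬 t o).ghat) ∂P)
      (∫ o, frobSq (thetaResidual η (𝐬 t o)) ∂P)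
      (∫ o, frobSq (leftMul U.transpose (𝐬 (t + 1) o).θ) ∂P)
      (∫ o, ‖rowAvg (𝐬 (t + 1) o).v - rowAvg (fullGrad F D (𝐬 (t + 1) o).θ)‖ ^ 2 ∂P)
      (∫ o, frobSq ((𝐬 (t + 1) o).v - fullGrad F D (𝐬 (t + 1) o).θ) ∂P)
      (∫ o, frobSq (leftMul U.transpose (𝐬 (t + 1) o).g) ∂P)
      (∫ o, frobSq ((𝐬 (t + 1) o).g - (𝐬 (t + 1) o).ghat) ∂P)
      (∫ o, frobSq (thetaResidual η (𝐬 (t + 1) o)) ∂P)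
      (∫ o, ‖rowAvg (𝐬 t o).g‖ ^ 2 ∂P)
      (∫ o, frobSq ((𝐬 (t + 1) o).θ - (𝐬 t o).θ) ∂P)
      (∫ o, frobSq ((𝐬 (t + 1) o).v - (𝐬 t o).v) ∂P) := by
  have hδ := hcomp.delta_pos
  have hδ1 := hcomp.delta_le
  have hρ := hmix.rho_pos
  have hω := hmix.omega_pos
  have hs := stateMemLp_docom hprob hlip hgrad hcomp hS t
  have hs' := stateMemLp_docom hprob hlip hgrad hcomp hS (t + 1)
  obtain ⟨mθ, bθ⟩ := integral_compErr_theta hprob hcomp hS hs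
  obtain ⟨mg, bg⟩ := integral_compErr_g hprob hlip hgrad hcomp hS hs
  have ix := integrable_frobSq (memLp_leftMul U.transpose hs.θ)
  have ix' := integrable_frobSq (memLp_leftMul U.transpose hs'.θ)
  have ig := integrable_frobSq (memLp_leftMul U.transpose hs.g)
  have ig' := integrable_frobSq (memLp_leftMul U.transpose hs'.g)
  have iEθ := integrable_frobSq mθ
  have iEg := integrable_frobSq mg
  have ir : Integrable (fun o => frobSq (thetaResidual η (𝐬 t o))) P :=
    integrable_frobSq hs.thetaResidual
  have ir' : Integrable (fun o => frobSq (thetaResidual η (𝐬 (t + 1) o))) P :=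
    integrable_frobSq hs'.thetaResidual
  have is : Integrable (fun o => frobSq ((𝐬 t o).g - (𝐬 t o).ghat)) P :=
    integrable_frobSq fun i => (hs.g i).sub (hs.ghat i)
  have is' : Integrable (fun o => frobSq ((𝐬 (t + 1) o).g - (𝐬 (t + 1) o).ghat)) P :=
    integrable_frobSq fun i => (hs'.g i).sub (hs'.ghat i)
  have ih : Integrable (fun o => ‖rowAvg (𝐬 t o).g‖ ^ 2) P :=
    integrable_norm_sq (memLp_rowAvg hs.g)
  have iD : Integrable (fun o => frobSq ((𝐬 (t + 1) o).θ - (𝐬 t o).θ)) P :=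
    integrable_frobSq fun i => (hs'.θ i).sub (hs.θ i)
  have iE : Integrable (fun o => frobSq ((𝐬 (t + 1) o).v - (𝐬 t o).v)) P :=
    integrable_frobSq fun i => (hs'.v i).sub (hs.v i)
  have iq : Integrable (fun o => frobSq (gResidual (𝐬 t o) (𝐬 (t + 1) o).v)) P :=
    integrable_frobSq (memLp_gResidual hprob hlip hgrad hcomp hS hs)
  have iz : Integrable (fun _ : Ω => (0 : ℝ)) P := integrable_zero _ _ _
  have hr0 : 0 ≤ ∫ o, frobSq (thetaResidual η (𝐬 t o)) ∂P :=
    integral_nonneg fun _ => frobSq_nonneg _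
  have hs0 : 0 ≤ ∫ o, frobSq ((𝐬 t o).g - (𝐬 t o).ghat) ∂P :=
    integral_nonneg fun _ => frobSq_nonneg _
  have hE0 : 0 ≤ ∫ o, frobSq ((𝐬 (t + 1) o).v - (𝐬 t o).v) ∂P :=
    integral_nonneg fun _ => frobSq_nonneg _
  have hq0 : 0 ≤ ∫ o, frobSq (gResidual (𝐬 t o) (𝐬 (t + 1) o).v) ∂P :=
    integral_nonneg fun _ => frobSq_nonneg _
  -- Where the compression error only perturbs consensus or displacement, the factor 1 - δ is
  -- dropped; it is retained for the residual recursions.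
  have bθ' : ∫ o, frobSq (compErr Q (thetaResidual η (𝐬 t o)) fun j => R.ξθ t j o) ∂P
      ≤ ∫ o, frobSq (thetaResidual η (𝐬 t o)) ∂P := by nlinarith
  have bg' : ∫ o, frobSq (compErr Q (gResidual (𝐬 t o) (𝐬 (t + 1) o).v) fun j => R.ξg t j o) ∂P
      ≤ ∫ o, frobSq (gResidual (𝐬 t o) (𝐬 (t + 1) o).v) ∂P := by nlinarith
  -- Two bounds on the same residual: this one keeps the coefficient near 1, as the recursion for
  -- the residual needs, while `q2` avoids the large 11/δ in the tracking bound.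
  have q1 := integral_le_linear_comb₄ (c₁ := 1 + δ / 10) (c₂ := 11 / δ) (c₃ := 0) (c₄ := 0)
    iq is iE iz iz (fun o => by
      have := frobSq_gResidual_le hδ hδ1 (𝐬 t o) (𝐬 (t + 1) o).v
      linarith)
  have q2 := integral_le_linear_comb₄ (c₁ := 2) (c₂ := 2) (c₃ := 0) (c₄ := 0)
    iq is iE iz iz (fun o => by
      have := frobSq_gResidual_le_two (𝐬 t o) (𝐬 (t + 1) o).v
      linarith)
  have hω2 : 0 ≤ γ * ωb ^ 2 / ρ := by positivity
  have hfac := contraction_factor_le hδ hδ1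
  have hfac3 : (1 + δ / 10) ^ 3 * (1 - δ) ≤ 1 - δ / 2 := by
    have : 0 ≤ (1 + δ / 10) ^ 3 * (1 - δ) := mul_nonneg (by positivity) (by linarith)
    nlinarith
  refine ⟨?_, ?_, ?_, ?_, ?_, ?_, ?_, ?_⟩
  · have := integral_le_linear_comb₄ (c₁ := 1 - ρ * γ / 2) (c₂ := 2 / (ρ * γ) * η ^ 2)
      (c₃ := γ * ωb ^ 2 / ρ) (c₄ := 0) ix' ix ig iEθ iz (fun o => by
        have := frobSq_transpose_thetaNext_le (η := η) hmix h0 h1 hp Q (𝐬 t o)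
          (fun i => R.ξθ t i o)
        simp only [docom, stepState]
        linarith)
    have h2 := mul_le_mul_of_nonneg_left bθ' hω2
    linarith
  · have := integral_le_linear_comb₄ (c₁ := n * η ^ 2) (c₂ := 3 * γ ^ 2 * ωb ^ 2)
      (c₃ := 3 * η ^ 2) (c₄ := 3 * γ ^ 2 * ωb ^ 2) iD ih ix ig iEθ (fun o =>
        frobSq_thetaNext_sub_le (η := η) hmix h0 h1 Q (𝐬 t o) (fun i => R.ξθ t i o))
    have h2 := mul_le_mul_of_nonneg_left bθ' (by positivity : 0 ≤ 3 * γ ^ 2 * ωb ^ 2)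
    linarith
  · exact (integral_gradErr_succ_le hprob hlip hgrad hcomp hS hs).2
  · exact integral_avgErr_succ_le hn hprob hlip hgrad hcomp hS t
  · exact integral_vDrift_le hprob hlip hgrad hcomp hS t
  · have := integral_le_linear_comb₄ (c₁ := 1 - ρ * γ / 2) (c₂ := 2 / (ρ * γ))
      (c₃ := γ * ωb ^ 2 / ρ) (c₄ := 0) ig' ig iE iEg iz (fun o => by
        have := frobSq_transpose_gNext_le hmix h0 h1 hp Q (𝐬 t o) (𝐬 (t + 1) o).v
          (fun i => R.ξg t i o)
        rw [zero_mul, add_zero]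
        exact this)
    have h2 := mul_le_mul_of_nonneg_left (bg'.trans q2) hω2
    linarith
  · have := integral_le_linear_comb₄ (c₁ := (1 + δ / 10) ^ 3)
      (c₂ := 11 / δ * (γ ^ 2 * ωb ^ 2) * 2) (c₃ := 11 / δ * (γ ^ 2 * ωb ^ 2) * 2) (c₄ := 0)
      is' iEg ig iE iz (fun o => by
        have := frobSq_gNext_sub_gHatNext_le hmix h0 hδ hδ1 hγ Q (𝐬 t o) (𝐬 (t + 1) o).v
          (fun i => R.ξg t i o)
        refine (this.trans (le_of_eq ?_))
        ring)
    have h2 := mul_le_mul_of_nonneg_left bg (by positivity : 0 ≤ (1 + δ / 10) ^ 3)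
    have h3 := mul_le_mul_of_nonneg_left q1
      (mul_nonneg (by positivity : 0 ≤ (1 + δ / 10) ^ 3) (by linarith : 0 ≤ 1 - δ))
    have h4 := mul_le_mul_of_nonneg_right hfac hs0
    have h5 : (1 + δ / 10) ^ 3 * (1 - δ) * (11 / δ * ∫ o, frobSq ((𝐬 (t + 1) o).v - (𝐬 t o).v) ∂P)
        ≤ 1 * (11 / δ * ∫ o, frobSq ((𝐬 (t + 1) o).v - (𝐬 t o).v) ∂P) :=
      mul_le_mul_of_nonneg_right (by linarith) (by positivity)
    linarith
  · have := integral_le_linear_comb₆ (c₁ := (1 + δ / 10) ^ 3)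
      (c₂ := 11 / δ * (2 * (γ ^ 2 * ωb ^ 2 * 2)))
      (c₃ := 11 / δ * (2 * (γ ^ 2 * ωb ^ 2 * (2 * η ^ 2))))
      (c₄ := 11 / δ * (2 * (η ^ 2 * (2 * n)))) (c₅ := 11 / δ * (2 * (η ^ 2 * 2)))
      (c₆ := 11 / δ * (2 * η ^ 2)) ir' iEθ ix ig ih iE ig' (fun o => by
        have := frobSq_thetaResidual_next_le (η := η) hmix h0 hδ hδ1 hγ Q (𝐬 t o)
          (fun i => R.ξθ t i o) (𝐬 (t + 1) o).v (fun i => R.ξg t i o)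
        refine (this.trans (le_of_eq ?_))
        simp only [docom, stepState]
        ring)
    have h2 := mul_le_mul_of_nonneg_left bθ (by positivity : 0 ≤ (1 + δ / 10) ^ 3)
    have h4 := mul_le_mul_of_nonneg_right hfac3 hr0
    linarith

end Expectation

/-! ### Contraction of the Lyapunov function: scalar part -/

namespace StepBounds

variable {n : ℕ} {L ρ ωb σ δ η γ β x m e g s r x' m' e' g' s' r' h D E : ℝ}

/-- The weighted combination of the one-step bounds. -/
theorem combine (hb : StepBounds n L ρ ωb σ δ η γ β x m e g s r x' m' e' g' s' r' h D E)
    (hn : 0 < n) (hρ : 0 < ρ) (hγ : 0 < γ) (hδ : 0 < δ) {a b c A Tv TD : ℝ}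
    (ha : 0 ≤ a) (hb0 : 0 ≤ b) (hc : 0 ≤ c) (hA : A = a + 2 * (c * (11 / δ) * η ^ 2))
    (hTv : Tv = A * (2 / (ρ * γ) + 2 * (γ * ωb ^ 2 / ρ))
      + b * (11 / δ) * (1 + 2 * (γ ^ 2 * ωb ^ 2)) + 4 * (c * (11 / δ) * η ^ 2))
    (hTD : TD = 4 * (1 - β) ^ 2 * L ^ 2 * (n : ℝ)⁻¹ + 3 * L ^ 2 * Tv) :
    L ^ 2 * x' + n * m' + (n : ℝ)⁻¹ * e' + a * g' + b * s' + c * r'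
      ≤ (L ^ 2 * (1 - ρ * γ / 2) + 4 * (c * (11 / δ) * (γ ^ 2 * ωb ^ 2))
            + 3 * γ ^ 2 * ωb ^ 2 * TD) * x
        + n * (1 - β) ^ 2 * m
        + ((1 - β) ^ 2 * (n : ℝ)⁻¹ + 3 * β ^ 2 * Tv) * e
        + (L ^ 2 * (2 / (ρ * γ)) * η ^ 2 + A * (1 - ρ * γ / 2)
            + 2 * (b * (11 / δ) * (γ ^ 2 * ωb ^ 2))
            + 4 * (c * (11 / δ) * (γ ^ 2 * ωb ^ 2)) * η ^ 2 + 3 * η ^ 2 * TD) * g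
        + (2 * A * (γ * ωb ^ 2 / ρ) + b * (1 - δ / 2)) * s
        + (L ^ 2 * (γ * ωb ^ 2 / ρ) + c * (1 - δ / 2) + 3 * γ ^ 2 * ωb ^ 2 * TD) * r
        + (4 + 3 * n * Tv) * (β ^ 2 * σ ^ 2)
        + (4 * (c * (11 / δ) * η ^ 2) * n + n * η ^ 2 * TD) * h := by
  have hn' : (0 : ℝ) < n := by positivity
  -- `A`, `Tv`, `TD` are the total weights with which g', E and D appear once the bounds are added:
  -- the residual bound for θ produces g', which the tracking bound trades for E, which the drift
  -- bound trades for D. The term 4(1-β)²L²/n in `TD` comes equally from the two estimator errors.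
  have hA0 : 0 ≤ A := by rw [hA]; positivity
  have hTv0 : 0 ≤ Tv := by rw [hTv]; positivity
  have hTD0 : 0 ≤ TD := by rw [hTD]; positivity
  have i1 := mul_le_mul_of_nonneg_left hb.consensus (sq_nonneg L)
  have i2 := mul_le_mul_of_nonneg_left hb.avgErr hn'.le
  have i3 := mul_le_mul_of_nonneg_left hb.gradErr (inv_nonneg.2 hn'.le)
  have i4 := mul_le_mul_of_nonneg_left hb.tracking hA0
  have i5 := mul_le_mul_of_nonneg_left hb.gRes hb0
  have i6 := mul_le_mul_of_nonneg_left hb.thetaRes hc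
  have i7 := mul_le_mul_of_nonneg_left hb.vDrift hTv0
  have i8 := mul_le_mul_of_nonneg_left hb.displacement hTD0
  have e2 : (n : ℝ) * ((1 - β) ^ 2 * m + ((n : ℝ)⁻¹ * (2 * β ^ 2 * σ ^ 2)
      + (n : ℝ)⁻¹ ^ 2 * (2 * (1 - β) ^ 2 * L ^ 2 * D)))
      = n * (1 - β) ^ 2 * m + 2 * β ^ 2 * σ ^ 2 + (n : ℝ)⁻¹ * (2 * (1 - β) ^ 2 * L ^ 2 * D) := by
    field_simp
    ring
  have e3 : (n : ℝ)⁻¹ * ((1 - β) ^ 2 * e + 2 * β ^ 2 * n * σ ^ 2 + 2 * (1 - β) ^ 2 * L ^ 2 * D)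
      = (1 - β) ^ 2 * (n : ℝ)⁻¹ * e + 2 * β ^ 2 * σ ^ 2
        + (n : ℝ)⁻¹ * (2 * (1 - β) ^ 2 * L ^ 2 * D) := by
    field_simp
  rw [e2] at i2
  rw [e3] at i3
  have j4 : A * g' = a * g' + 2 * (c * (11 / δ) * η ^ 2) * g' := by rw [hA]; ring
  have j7 : Tv * E = (A * (2 / (ρ * γ) + 2 * (γ * ωb ^ 2 / ρ))
      + b * (11 / δ) * (1 + 2 * (γ ^ 2 * ωb ^ 2)) + 4 * (c * (11 / δ) * η ^ 2)) * E := by rw [hTv]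
  have j8 : TD * D = (4 * (1 - β) ^ 2 * L ^ 2 * (n : ℝ)⁻¹ + 3 * L ^ 2 * Tv) * D := by rw [hTD]
  -- With the quotients made opaque, the claim is the sum of the collected inequalities.
  generalize (n : ℝ)⁻¹ = q at *
  generalize 2 / (ρ * γ) = w at *
  generalize γ * ωb ^ 2 / ρ = y at *
  generalize 11 / δ = k at *
  clear hA hTv hTD hb
  nlinarith only [i1, i2, i3, i4, i5, i6, i7, i8, j4, j7, j8]

end StepBounds

/-! ### Polynomial consequences of the step-size condition -/

namespace StepSizes

variable {n : ℕ} {L ρ ωb δ η γ β : ℝ}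

/-- At γ = 1 the factor √(1 - γ) would force γ_∞ ≤ 0. This makes the divisions by 1 - γ in the
weights legitimate. -/
theorem gamma_lt_one (h : StepSizes n L ρ ωb δ η γ β) : γ < 1 := by
  refine lt_of_le_of_ne h.gamma_le_one fun h1 => ?_
  have h2 := h.gamma_le.trans ((min_le_right _ _).trans ((min_le_right _ _).trans
    (min_le_right _ _)))
  rw [h1] at h2
  simp at h2
  linarith

theorem rho_gamma_le (h : StepSizes n L ρ ωb δ η γ β) (hρ : 0 < ρ) : ρ * γ ≤ 1 / 4 := by
  have h2 := h.gamma_le.trans (min_le_left _ _)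
  rw [le_div_iff₀ (by positivity)] at h2
  linarith

theorem gamma_omega_sq_le (h : StepSizes n L ρ ωb δ η γ β) (hω : 0 < ωb) :
    64 * (γ * ωb ^ 2) ≤ ρ * n := by
  have h2 := h.gamma_le.trans ((min_le_right _ _).trans (min_le_left _ _))
  rw [le_div_iff₀ (by positivity)] at h2
  linarith

theorem gamma_omega_le (h : StepSizes n L ρ ωb δ η γ β) (hω : 0 < ωb) :
    γ * ωb ≤ δ / 10 := by
  have h2 := h.gamma_le.trans ((min_le_right _ _).trans ((min_le_right _ _).trans
    (min_le_left _ _)))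
  rw [le_div_iff₀ (by positivity)] at h2
  linarith

theorem gamma_omega_sq_le_sqrt (h : StepSizes n L ρ ωb δ η γ β) (hω : 0 < ωb) :
    259 * (γ * ωb ^ 2) ≤ δ * ρ * √(1 - γ) := by
  have h2 := h.gamma_le.trans ((min_le_right _ _).trans ((min_le_right _ _).trans
    (min_le_right _ _)))
  rw [le_div_iff₀ (by positivity)] at h2
  linarith

theorem gamma_omega_sq_sq_le (h : StepSizes n L ρ ωb δ η γ β) (hω : 0 < ωb) :
    67081 * (γ ^ 2 * ωb ^ 4) ≤ δ ^ 2 * ρ ^ 2 * (1 - γ) := by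
  have h1 := h.gamma_omega_sq_le_sqrt hω
  have h0 := h.gamma_pos
  have h2 : (259 * (γ * ωb ^ 2)) ^ 2 ≤ (δ * ρ * √(1 - γ)) ^ 2 := by gcongr
  rw [mul_pow (δ * ρ), Real.sq_sqrt (by linarith [h.gamma_lt_one])] at h2
  linarith

theorem gamma_omega_sq_le_rho (h : StepSizes n L ρ ωb δ η γ β) (hω : 0 < ωb) (hρ : 0 < ρ)
    (hδ : 0 < δ) : 259 * (γ * ωb ^ 2) ≤ δ * ρ := by
  have h1 := h.gamma_omega_sq_le_sqrt hω
  have h0 := h.gamma_pos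
  have h2 : √(1 - γ) ≤ 1 := Real.sqrt_le_one.2 (by linarith)
  have h3 : δ * ρ * √(1 - γ) ≤ δ * ρ * 1 := by gcongr
  linarith

theorem eta_le_beta (h : StepSizes n L ρ ωb δ η γ β) (hL : 0 ≤ L) (hn : 0 < n) (hρ : 0 < ρ) :
    2025 * (L ^ 2 * η ^ 2) * (β * n) ≤ γ ^ 3 * ρ ^ 3 * (1 - β) := by
  have h0 := h.gamma_pos
  have h1 := h.beta_pos
  have h2 := h.beta_lt_one
  have hη := h.eta_pos
  rcases hL.eq_or_lt with rfl | hL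
  · have : 0 ≤ γ ^ 3 * ρ ^ 3 * (1 - β) := mul_nonneg (by positivity) (by linarith)
    simpa using this
  have hn' : (0 : ℝ) < n := by positivity
  have h3 := ((h.eta_le hL).trans (min_le_left _ _)).trans
    (mul_le_mul_of_nonneg_left (min_le_left _ _) (by positivity : 0 ≤ γ / L))
  have h4 : L * η ≤ γ * (√((1 - β) / (β * n)) * (√(γ * ρ ^ 3) / 45)) := by
    have := mul_le_mul_of_nonneg_left h3 hL.le
    refine this.trans (le_of_eq ?_)
    field_simp
  have h5 : (L * η) ^ 2 ≤ (γ * (√((1 - β) / (β * n)) * (√(γ * ρ ^ 3) / 45))) ^ 2 := by gcongr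
  rw [mul_pow, mul_pow, mul_pow, div_pow, Real.sq_sqrt (div_nonneg (by linarith) (by positivity)),
    Real.sq_sqrt (by positivity)] at h5
  have h6 := mul_le_mul_of_nonneg_right h5 (by positivity : 0 ≤ 2025 * (β * n))
  have e : γ ^ 2 * ((1 - β) / (β * n) * (γ * ρ ^ 3 / 45 ^ 2)) * (2025 * (β * n))
      = γ ^ 3 * ρ ^ 3 * (1 - β) := by field_simp; ring
  rw [e] at h6
  linarith

theorem eta_le_omega (h : StepSizes n L ρ ωb δ η γ β) (hL : 0 ≤ L) (hω : 0 < ωb) :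
    57600 * (L ^ 2 * η ^ 2) * ωb ^ 2 ≤ γ ^ 2 * ρ ^ 4 := by
  have h0 := h.gamma_pos
  have hη := h.eta_pos
  rcases hL.eq_or_lt with rfl | hL
  · have : 0 ≤ γ ^ 2 * ρ ^ 4 := by positivity
    simpa using this
  have h3 := ((h.eta_le hL).trans (min_le_left _ _)).trans
    (mul_le_mul_of_nonneg_left (min_le_right _ _) (by positivity : 0 ≤ γ / L))
  have h4 : L * η * (240 * ωb) ≤ γ * ρ ^ 2 := by
    have := mul_le_mul_of_nonneg_left h3 (by positivity : 0 ≤ L * (240 * ωb))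
    have e : L * (240 * ωb) * (γ / L * (ρ ^ 2 / (240 * ωb))) = γ * ρ ^ 2 := by field_simp
    linarith
  have h5 : (L * η * (240 * ωb)) ^ 2 ≤ (γ * ρ ^ 2) ^ 2 := by gcongr
  linarith

theorem betaBar_pos (hρ : 0 < ρ) (hδ : 0 < δ) (hγ : 0 < γ) (hβ : 0 < β) :
    0 < betaBar ρ δ γ β := by
  unfold betaBar
  exact lt_min (by positivity) (lt_min (by positivity) hβ)

theorem eta_sq_cGbar_le (h : StepSizes n L ρ ωb δ η γ β) (hL : 0 ≤ L) (hn : 0 < n)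
    (hρ : 0 < ρ) (hδ : 0 < δ) :
    8 * (η ^ 2 * cGbar n L ρ ωb γ β) ≤ betaBar ρ δ γ β * n := by
  have h0 := h.gamma_pos
  have hη := h.eta_pos
  have hn' : (0 : ℝ) < n := by positivity
  have hb := betaBar_pos hρ hδ h0 h.beta_pos
  rcases hL.eq_or_lt with rfl | hL
  · simp only [cGbar]
    have : 0 < betaBar ρ δ γ β * n := by positivity
    simpa using this.le
  have hC : 0 < cGbar n L ρ ωb γ β := by
    have : 0 < L ^ 2 * n / (ρ * γ) * (96 + 141 / 400 * (ρ ^ 2 / ωb ^ 2)) := by positivity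
    unfold cGbar
    positivity
  have h3 := (h.eta_le hL).trans (min_le_right _ _)
  have h5 : η ^ 2 ≤ √(betaBar ρ δ γ β * n / (8 * cGbar n L ρ ωb γ β)) ^ 2 := by gcongr
  rw [Real.sq_sqrt (by positivity), le_div_iff₀ (by positivity)] at h5
  linarith

/-- ℂ_ḡ ≥ 96L²n/(ργ) and β̄ ≤ ργ/8 turn the second bound on η into 768(ηL)² ≤ (ργ)²/8, far below
what descent requires. -/
theorem eta_mul_L_le (h : StepSizes n L ρ ωb δ η γ β) (hL : 0 ≤ L) (hn : 0 < n)
    (hρ : 0 < ρ) (hδ : 0 < δ) : η * L ≤ 1 / 2 := by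
  have h0 := h.gamma_pos
  have hη := h.eta_pos
  have hn' : (0 : ℝ) < n := by positivity
  have h1 := h.eta_sq_cGbar_le hL hn hρ hδ
  have hp := h.rho_gamma_le hρ
  have hp0 : 0 < ρ * γ := by positivity
  have h2 : betaBar ρ δ γ β ≤ ρ * γ / 8 := min_le_left _ _
  have h3 : 96 * (L ^ 2 * n / (ρ * γ)) ≤ cGbar n L ρ ωb γ β := by
    have a1 : 0 ≤ 8 * (1 - β) ^ 2 * L ^ 2 * (1 - ρ * γ) ^ 2 := by positivity
    have a2 : 0 ≤ L ^ 2 * n / (ρ * γ) * (141 / 400 * (ρ ^ 2 / ωb ^ 2)) := by positivity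
    unfold cGbar
    linarith
  have h4 : 8 * (η ^ 2 * (96 * (L ^ 2 * n / (ρ * γ)))) ≤ ρ * γ / 8 * n := by
    calc _ ≤ 8 * (η ^ 2 * cGbar n L ρ ωb γ β) := by gcongr
      _ ≤ _ := h1
      _ ≤ _ := by gcongr
  have h5 : 8 * (η ^ 2 * (96 * (L ^ 2 * n / (ρ * γ)))) * (ρ * γ) = 768 * (η * L) ^ 2 * n := by
    field_simp
    ring
  have h6 := mul_le_mul_of_nonneg_right h4 hp0.le
  rw [h5] at h6
  have h7 : 768 * (η * L) ^ 2 ≤ ρ * γ / 8 * (ρ * γ) := by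
    refine le_of_mul_le_mul_right ?_ hn'
    linarith
  have h8 : (η * L) ^ 2 ≤ (1 / 2) ^ 2 := by nlinarith
  exact (sq_le_sq₀ (mul_nonneg hη.le hL) (by norm_num)).1 h8

end StepSizes

namespace StepBounds

variable {n : ℕ} {L ρ ωb σ δ η γ β x m e g s r x' m' e' g' s' r' h D E : ℝ}

set_option maxHeartbeats 1600000 in
/-- The Lyapunov function contracts, up to noise and the averaged direction. -/
theorem lyapunov_le (hb : StepBounds n L ρ ωb σ δ η γ β x m e g s r x' m' e' g' s' r' h D E)
    (hst : StepSizes n L ρ ωb δ η γ β) (hn : 2 ≤ n) (hL : 0 ≤ L) (hρ : 0 < ρ) (hω : 0 < ωb)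
    (hρω : ρ ≤ ωb) (hδ : 0 < δ) (hδ1 : δ ≤ 1) (hx : 0 ≤ x) (hm : 0 ≤ m) (he : 0 ≤ e)
    (hg : 0 ≤ g) (hs : 0 ≤ s) (hr : 0 ≤ r) (hh : 0 ≤ h) :
    L ^ 2 * x' + n * m' + (n : ℝ)⁻¹ * e' + lyapA L ρ η γ * g' + lyapB L ρ ωb δ η γ * s'
        + lyapC L ρ ωb δ γ * r'
      ≤ (1 - betaBar ρ δ γ β) * (L ^ 2 * x + n * m + (n : ℝ)⁻¹ * e + lyapA L ρ η γ * g
          + lyapB L ρ ωb δ η γ * s + lyapC L ρ ωb δ γ * r)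
        + cSigma n L ρ ωb δ η γ * (β ^ 2 * σ ^ 2) + η ^ 2 * cGbar n L ρ ωb γ β * h := by
  have h0 := hst.gamma_pos
  have h1 := hst.gamma_lt_one
  have hβ := hst.beta_pos
  have hβ1 := hst.beta_lt_one
  have hη := hst.eta_pos
  have hn0 : (0 : ℝ) < n := by positivity
  have hn2 : (2 : ℝ) ≤ n := by exact_mod_cast hn
  have h1γ : 0 < 1 - γ := by linarith
  set p := ρ * γ with hpdef
  have hp0 : 0 < p := mul_pos hρ h0
  have hp := hst.rho_gamma_le hρ
  have hs2 := hst.gamma_omega_sq_sq_le hω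
  have hs1 := hst.gamma_omega_sq_le_rho hω hρ hδ
  have hs64 := hst.gamma_omega_sq_le hω
  have he1 := hst.eta_le_beta hL (by omega : 0 < n) hρ
  have he2 := hst.eta_le_omega hL hω
  set u := L ^ 2 * η ^ 2 with hu
  have hu0 : 0 ≤ u := by positivity
  set a := lyapA L ρ η γ with ha
  set b := lyapB L ρ ωb δ η γ with hbd
  set c := lyapC L ρ ωb δ γ with hc
  have ha_eq : a = 96 * u / p ^ 2 := by
    rw [ha, lyapA, hu, hpdef]; field_simp
  have hb_eq : b = 3072 * u * ωb ^ 2 / (γ * (1 - γ) * δ * ρ ^ 3) := by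
    rw [hbd, lyapB, hu]; field_simp
  have hc_eq : c = 48 * L ^ 2 * γ * ωb ^ 2 / ((1 - γ) * δ * ρ) := by
    rw [hc, lyapC]; field_simp
  have ha0 : 0 ≤ a := by rw [ha_eq]; positivity
  have hb0 : 0 ≤ b := by rw [hb_eq]; positivity
  have hc0 : 0 ≤ c := by rw [hc_eq]; positivity
  -- the small parameter `γ²ω⁴ / (δ²ρ²(1-γ))`
  set ε := γ ^ 2 * ωb ^ 4 / (δ ^ 2 * ρ ^ 2 * (1 - γ)) with hε
  have hε0 : 0 ≤ ε := by positivity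
  have hε1 : ε ≤ 1 / 67081 := by
    rw [hε, div_le_iff₀ (by positivity)]; linarith
  -- 528 = 48·11 and, below, 33792 = 3072·11. As ε ≤ 1/259², these products are less than 1/100 and
  -- 51/100: the feedback of the residual terms into the other errors is small.
  have k1 : c * (11 / δ) * (γ ^ 2 * ωb ^ 2) = 528 * ε * (L ^ 2 * p) := by
    rw [hc_eq, hε, hpdef]; field_simp; ring
  have k3 : b * (11 / δ) * (γ ^ 2 * ωb ^ 2) = 33792 * ε * (u / p) := by
    rw [hb_eq, hε, hpdef]; field_simp; ring
  have hρω2 : ρ * ρ ≤ ωb ^ 2 := by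
    rw [sq]
    exact mul_self_le_mul_self hρ.le hρω
  -- `ρ / (γ ω²) ≤ 1 / p`
  have hy : ρ / (γ * ωb ^ 2) ≤ 1 / p := by
    rw [div_le_div_iff₀ (by positivity) hp0, hpdef]
    linarith only [mul_le_mul_of_nonneg_right hρω2 h0.le]
  have k2 : c * (11 / δ) * η ^ 2 = 528 * ε * (u * (ρ / (γ * ωb ^ 2))) := by
    rw [hc_eq, hε, hu]; field_simp; ring
  have hup0 : 0 ≤ u / p := by positivity
  have k4 : b * (11 / δ) = 33792 * ε * (u / p) / (γ ^ 2 * ωb ^ 2) := by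
    rw [← k3]; field_simp
  set κ1 := c * (11 / δ) * (γ ^ 2 * ωb ^ 2) with hκ1
  set κ2 := c * (11 / δ) * η ^ 2 with hκ2
  set κ3 := b * (11 / δ) * (γ ^ 2 * ωb ^ 2) with hκ3
  set y := ρ / (γ * ωb ^ 2) with hyd
  have hy0 : 0 ≤ y := by positivity
  have hLp0 : 0 ≤ L ^ 2 * p := by positivity
  have hκ1b : κ1 ≤ L ^ 2 * p / 100 := by
    rw [k1]; linarith only [mul_le_mul_of_nonneg_right hε1 hLp0, hLp0]
  have huy0 : 0 ≤ u * y := by positivity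
  have hκ2y : κ2 ≤ u * y / 100 := by
    rw [k2]; linarith only [mul_le_mul_of_nonneg_right hε1 huy0, huy0]
  have huy : u * y ≤ u / p := by
    rw [div_eq_mul_one_div u p]; gcongr
  have hκ2b : κ2 ≤ u / p / 100 := by linarith
  have hκ3b : κ3 ≤ 51 / 100 * (u / p) := by
    rw [k3]; linarith only [mul_le_mul_of_nonneg_right hε1 hup0, hup0]
  have hκ20 : 0 ≤ κ2 := by rw [k2]; positivity
  have hκ30 : 0 ≤ κ3 := by rw [k3]; positivity
  have hp2 : p ^ 2 ≤ γ ^ 2 * ωb ^ 2 := by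
    rw [hpdef, mul_pow, mul_comm]; gcongr
  have hbk : b * (11 / δ) ≤ 51 / 100 * (u / p ^ 3) := by
    have e1 : b * (11 / δ) = κ3 / (γ ^ 2 * ωb ^ 2) := by rw [hκ3]; field_simp
    have e2 : 51 / 100 * (u / p ^ 3) = 51 / 100 * (u / p) / p ^ 2 := by field_simp
    rw [e1, e2]
    gcongr
  -- relations between the powers `u / p^k`
  set u3 := u / p ^ 3 with hu3
  have hu30 : 0 ≤ u3 := by positivity
  have eu1 : u / p = p ^ 2 * u3 := by rw [hu3]; field_simp
  have ea : a = 96 * (p * u3) := by rw [ha_eq, hu3]; field_simp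
  set y2 := γ * ωb ^ 2 / ρ with hy2
  have hy20 : 0 ≤ y2 := by positivity
  have hy2b : y2 ≤ 1 / 259 := by
    rw [hy2, div_le_iff₀ hρ]
    linarith only [hs1, mul_le_mul_of_nonneg_right hδ1 hρ.le]
  set A := a + 2 * κ2 with hA
  have hp2p : p ^ 2 * u3 ≤ p * u3 / 4 := by
    have : 0 ≤ p * u3 := by positivity
    linarith only [mul_le_mul_of_nonneg_right hp this]
  have hAb : A ≤ 97 * (p * u3) := by
    rw [hA, ea]; rw [eu1] at hκ2b; linarith [mul_nonneg hp0.le hu30]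
  have hA0 : 0 ≤ A := by positivity
  have hpu : p * u3 ≤ u3 / 4 := by linarith only [mul_le_mul_of_nonneg_right hp hu30]
  set Tv := A * (2 / p + 2 * y2) + b * (11 / δ) * (1 + 2 * (γ ^ 2 * ωb ^ 2)) + 4 * κ2 with hTv
  have hTv0 : 0 ≤ Tv := by positivity
  -- The bulk is 97·2 = 194, from the weight of the tracking error; all compression corrections fit
  -- in the remaining 6.
  have hTvb : Tv ≤ 200 * u3 := by
    have t1 : A * (2 / p + 2 * y2) ≤ 97 * (p * u3) * (2 / p + 2 * (1 / 259)) := by gcongr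
    have t2 : 97 * (p * u3) * (2 / p + 2 * (1 / 259)) = 194 * u3 + 194 / 259 * (p * u3) := by
      field_simp; ring
    have t3 : b * (11 / δ) * (1 + 2 * (γ ^ 2 * ωb ^ 2)) = b * (11 / δ) + 2 * κ3 := by
      rw [hκ3]; ring
    rw [hTv, t3]
    rw [eu1] at hκ2b hκ3b
    linarith
  set TD := 4 * (1 - β) ^ 2 * L ^ 2 * (n : ℝ)⁻¹ + 3 * L ^ 2 * Tv with hTD
  have hTD0 : 0 ≤ TD := by positivity
  -- The bound on η through ω̄ says u3 ≤ y/240², and 600/57600 = 1/96.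
  have hu3y : 600 * u3 ≤ y / 96 := by
    have e1 : u ≤ γ ^ 2 * ρ ^ 4 / (57600 * ωb ^ 2) := by
      rw [le_div_iff₀ (by positivity)]; linarith
    have e2 : u3 ≤ γ ^ 2 * ρ ^ 4 / (57600 * ωb ^ 2) / p ^ 3 := by rw [hu3]; gcongr
    have e3 : γ ^ 2 * ρ ^ 4 / (57600 * ωb ^ 2) / p ^ 3 = y / 57600 := by
      rw [hyd, hpdef]; field_simp
    linarith
  have hninv : (n : ℝ)⁻¹ ≤ 1 / 2 := by
    rw [inv_eq_one_div]; gcongr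
  have hβsq : (1 - β) ^ 2 ≤ 1 := pow_le_one₀ (by linarith) (by linarith)
  have hTDb : TD ≤ 4 * (1 - β) ^ 2 * L ^ 2 * (n : ℝ)⁻¹ + L ^ 2 * (y / 96) := by
    have : 3 * L ^ 2 * Tv ≤ 3 * L ^ 2 * (200 * u3) := by gcongr
    have : L ^ 2 * (600 * u3) ≤ L ^ 2 * (y / 96) := by gcongr
    rw [hTD]; linarith
  have hTDb' : TD ≤ 4 * L ^ 2 * (n : ℝ)⁻¹ + L ^ 2 * (y / 96) := by
    have : 4 * (1 - β) ^ 2 * L ^ 2 * (n : ℝ)⁻¹ ≤ 4 * 1 * L ^ 2 * (n : ℝ)⁻¹ := by gcongr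
    linarith
  have hγωy : γ ^ 2 * ωb ^ 2 * y = p := by rw [hyd, hpdef]; field_simp
  have hγωn : 64 * (γ ^ 2 * ωb ^ 2 * (n : ℝ)⁻¹) ≤ p := by
    have e1 : 64 * (γ ^ 2 * ωb ^ 2 * (n : ℝ)⁻¹) = γ * (64 * (γ * ωb ^ 2)) * (n : ℝ)⁻¹ := by ring
    have e2 : γ * (64 * (γ * ωb ^ 2)) * (n : ℝ)⁻¹ ≤ γ * (ρ * n) * (n : ℝ)⁻¹ := by gcongr
    have e3 : γ * (ρ * n) * (n : ℝ)⁻¹ = p := by rw [hpdef]; field_simp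
    linarith
  have hγωTD : γ ^ 2 * ωb ^ 2 * TD
      ≤ 4 * L ^ 2 * (γ ^ 2 * ωb ^ 2 * (n : ℝ)⁻¹) + L ^ 2 * p / 96 := by
    have e1 : γ ^ 2 * ωb ^ 2 * TD
        ≤ γ ^ 2 * ωb ^ 2 * (4 * L ^ 2 * (n : ℝ)⁻¹ + L ^ 2 * (y / 96)) := by gcongr
    have e2 : γ ^ 2 * ωb ^ 2 * (4 * L ^ 2 * (n : ℝ)⁻¹ + L ^ 2 * (y / 96))
        = 4 * L ^ 2 * (γ ^ 2 * ωb ^ 2 * (n : ℝ)⁻¹) + L ^ 2 * (γ ^ 2 * ωb ^ 2 * y) / 96 := by ring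
    rw [e2, hγωy] at e1
    exact e1
  have hηTD : η ^ 2 * TD ≤ 4 * (1 - β) ^ 2 * u * (n : ℝ)⁻¹ + u * y / 96 := by
    have e1 := mul_le_mul_of_nonneg_left hTDb (sq_nonneg η)
    refine e1.trans (le_of_eq ?_)
    rw [hu]; ring
  have hcomb := hb.combine (by omega : 0 < n) hρ h0 hδ ha0 hb0 hc0 hA hTv hTD
  set B := betaBar ρ δ γ β with hB
  have hB1 : B ≤ p / 8 := min_le_left _ _
  have hB2 : B ≤ δ * γ / 8 := (min_le_right _ _).trans (min_le_left _ _)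
  have hB3 : B ≤ β := (min_le_right _ _).trans (min_le_right _ _)
  have hB2' : B ≤ δ / 8 := by linarith only [hB2, mul_le_mul_of_nonneg_left h1.le hδ.le]
  refine hcomb.trans ?_
  -- From here on, each coefficient is compared with 1 - β̄ times its weight. The decay p/2 must
  -- cover p/8 for β̄, p/25 for `κ1`, and 3(1/16 + 1/96)p for the displacement.
  have cx : L ^ 2 * (1 - p / 2) + 4 * κ1 + 3 * γ ^ 2 * ωb ^ 2 * TD ≤ (1 - B) * L ^ 2 := by
    have e1 : B * L ^ 2 ≤ p / 8 * L ^ 2 := by gcongr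
    have e2 : L ^ 2 * (64 * (γ ^ 2 * ωb ^ 2 * (n : ℝ)⁻¹)) ≤ L ^ 2 * p := by gcongr
    linarith
  have cm : n * (1 - β) ^ 2 ≤ (1 - B) * n := by
    have : (1 - β) ^ 2 ≤ 1 - B := by
      linarith only [hB3, mul_nonneg hβ.le (by linarith : 0 ≤ 1 - β)]
    linarith only [mul_le_mul_of_nonneg_left this hn0.le]
  -- Of the two powers of 1 - β one is spent: the drift term is at most β(1-β)/n by the β-dependent
  -- bound on η, and (1-β)² + β(1-β) = 1 - β.
  have ce : (1 - β) ^ 2 * (n : ℝ)⁻¹ + 3 * β ^ 2 * Tv ≤ (1 - B) * (n : ℝ)⁻¹ := by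
    have e1 : 3 * β ^ 2 * Tv ≤ 3 * β ^ 2 * (200 * u3) := by gcongr
    have e2 : u3 * (2025 * (β * n)) ≤ 1 - β := by
      rw [hu3, div_mul_eq_mul_div, div_le_iff₀ (by positivity), hpdef]
      linarith
    have e3 : 3 * β ^ 2 * (200 * u3) ≤ β * (1 - β) * (n : ℝ)⁻¹ := by
      have e4 : 3 * β ^ 2 * (200 * u3) = 600 / 2025 * β * (u3 * (2025 * (β * n))) * (n : ℝ)⁻¹ := by
        field_simp; ring
      rw [e4]
      have e5 : 600 / 2025 * β * (u3 * (2025 * (β * n))) ≤ 600 / 2025 * β * (1 - β) := by gcongr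
      have e6 : 0 ≤ β * (1 - β) := mul_nonneg hβ.le (by linarith)
      have e7 : 600 / 2025 * β * (u3 * (2025 * (β * n))) ≤ β * (1 - β) := by linarith
      gcongr
    have e4 : (1 - β) ^ 2 * (n : ℝ)⁻¹ + β * (1 - β) * (n : ℝ)⁻¹ = (1 - β) * (n : ℝ)⁻¹ := by ring
    have e5 : (1 - β) * (n : ℝ)⁻¹ ≤ (1 - B) * (n : ℝ)⁻¹ := by gcongr
    linarith
  have hub : u ≤ p * u3 * (p / 4) := by
    have e1 : u = p * u3 * p * p := by rw [hu3]; field_simp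
    rw [e1]
    have : 0 ≤ p * u3 * p := by positivity
    linarith only [mul_le_mul_of_nonneg_left hp this]
  -- In units of p²u3 the decay of the weight `a` is 48, of which β̄ takes 12; the other terms stay
  -- well below 36. This is what the constant 96 in `a` is for.
  have cg : L ^ 2 * (2 / p) * η ^ 2 + A * (1 - p / 2) + 2 * κ3 + 4 * κ1 * η ^ 2
      + 3 * η ^ 2 * TD ≤ (1 - B) * a := by
    have e1 : L ^ 2 * (2 / p) * η ^ 2 = 2 * (p ^ 2 * u3) := by rw [← eu1, hu]; ring
    have e2 : κ1 * η ^ 2 ≤ p ^ 2 * u3 / 100 := by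
      have e3 : κ1 * η ^ 2 ≤ L ^ 2 * p / 100 * η ^ 2 := by gcongr
      have e4 : L ^ 2 * p / 100 * η ^ 2 = u * p / 100 := by rw [hu]; ring
      have e5 : u * p ≤ u / p := by
        rw [le_div_iff₀ hp0]
        have : p * p ≤ 1 := mul_le_one₀ (by linarith) hp0.le (by linarith)
        linarith only [mul_le_mul_of_nonneg_left this hu0]
      rw [eu1] at e5
      linarith
    have e3 : A * (1 - p / 2) ≤ a * (1 - p / 2) + 2 * κ2 := by
      rw [hA]; linarith only [mul_nonneg hκ20 hp0.le]
    have e4 : η ^ 2 * TD ≤ 2 * u + p ^ 2 * u3 / 96 := by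
      have e5 : 4 * (1 - β) ^ 2 * u * (n : ℝ)⁻¹ ≤ 4 * 1 * u * (1 / 2) := by gcongr
      rw [eu1] at huy
      linarith
    have e5 : B * a ≤ p / 8 * a := by gcongr
    have e6 : p * a = 96 * (p ^ 2 * u3) := by rw [ea]; ring
    have e7 : u ≤ p ^ 2 * u3 / 4 := by linarith
    rw [eu1] at hκ2b hκ3b
    have : 0 ≤ p ^ 2 * u3 := by positivity
    linarith
  -- β̄ ≤ δ/8 leaves 3δ/8 of the decay, that is at least 3072·3/8 = 1152 units against 194. `cr` is
  -- the analogous comparison for `c`, whose constant is 48.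
  have cs : 2 * A * y2 + b * (1 - δ / 2) ≤ (1 - B) * b := by
    have e1 : b * δ ≥ 3072 * (u * ωb ^ 2 / (γ * ρ ^ 3)) := by
      have e2 : b * δ = 3072 * (u * ωb ^ 2 / (γ * ρ ^ 3)) / (1 - γ) := by
        rw [hb_eq]; field_simp
      rw [e2, ge_iff_le, le_div_iff₀ h1γ]
      have : 0 ≤ 3072 * (u * ωb ^ 2 / (γ * ρ ^ 3)) := by positivity
      linarith only [mul_nonneg this h0.le]
    have e2 : 2 * A * y2 ≤ 194 * (u * ωb ^ 2 / (γ * ρ ^ 3)) := by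
      have e3 : 2 * A * y2 ≤ 2 * (97 * (p * u3)) * y2 := by gcongr
      refine e3.trans (le_of_eq ?_)
      rw [hu3, hy2, hpdef]; field_simp; ring
    have e3 : B * b ≤ δ / 8 * b := by gcongr
    have : 0 ≤ u * ωb ^ 2 / (γ * ρ ^ 3) := by positivity
    linarith
  have cr : L ^ 2 * y2 + c * (1 - δ / 2) + 3 * γ ^ 2 * ωb ^ 2 * TD ≤ (1 - B) * c := by
    have hLy : 0 ≤ L ^ 2 * y2 := by positivity
    have e1 : 48 * (L ^ 2 * y2) ≤ c * δ := by
      have e2 : c * δ = 48 * (L ^ 2 * y2) / (1 - γ) := by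
        rw [hc_eq, hy2]; field_simp
      rw [e2, le_div_iff₀ h1γ]
      linarith only [mul_nonneg hLy h0.le]
    have e3 : p ≤ y2 := by
      rw [hpdef, hy2, le_div_iff₀ hρ]
      linarith only [mul_le_mul_of_nonneg_right hρω2 h0.le]
    have e4 : L ^ 2 * (64 * (γ ^ 2 * ωb ^ 2 * (n : ℝ)⁻¹)) ≤ L ^ 2 * p := by gcongr
    have e5 : L ^ 2 * p ≤ L ^ 2 * y2 := by gcongr
    have e6 : B * c ≤ δ / 8 * c := by gcongr
    linarith
  have cσ : 4 + 3 * n * Tv ≤ cSigma n L ρ ωb δ η γ := by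
    have e1 : 3 * n * Tv ≤ 3 * n * (200 * u3) := by gcongr
    have e2 : η ^ 2 / γ ^ 3 * (672 * L ^ 2 * n / ρ ^ 3) = 672 * (n * u3) := by
      rw [hu3, hu, hpdef]; field_simp
    have e3 : 0 ≤ n * u3 := by positivity
    have e4 : 0 ≤ η ^ 2 / γ * (6 * L ^ 2 * n * ρ ^ 4 * δ / (25 * ωb ^ 2)) := by positivity
    have e5 : 0 ≤ η ^ 2 / γ ^ 2 * (4 * L ^ 2 * n / ωb ^ 2) := by positivity
    unfold cSigma
    linarith
  -- ργ ≤ 1/4 gives 8(1 - ργ)² ≥ 9/2 against the required 4, and the terms in n·u·y have coefficient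
  -- 1/25 + 1/96 ≤ 141/400.
  have ch : 4 * κ2 * n + n * η ^ 2 * TD ≤ η ^ 2 * cGbar n L ρ ωb γ β := by
    have e1 : n * (η ^ 2 * TD) ≤ n * (4 * (1 - β) ^ 2 * u * (n : ℝ)⁻¹ + u * y / 96) := by gcongr
    have e2 : n * (4 * (1 - β) ^ 2 * u * (n : ℝ)⁻¹ + u * y / 96)
        = 4 * (1 - β) ^ 2 * u + n * (u * y) / 96 := by field_simp
    have e3 : η ^ 2 * cGbar n L ρ ωb γ β = 8 * ((1 - β) ^ 2 * u) * (1 - p) ^ 2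
        + 96 * (n * u / p) + 141 / 400 * (n * (u * y)) := by
      rw [cGbar, hu, hyd, hpdef]; field_simp; ring
    have e4 : 9 / 16 ≤ (1 - p) ^ 2 := by linarith only [hp, sq_nonneg (p - 1 / 4)]
    have e5 : 0 ≤ (1 - β) ^ 2 * u := by positivity
    have e6 : 8 * ((1 - β) ^ 2 * u) * (9 / 16) ≤ 8 * ((1 - β) ^ 2 * u) * (1 - p) ^ 2 := by gcongr
    have e7 : 0 ≤ n * u / p := by positivity
    have e8 : κ2 * n ≤ u * y / 100 * n := by gcongr
    have e9 : 0 ≤ n * (u * y) := by positivity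
    rw [e3]
    linarith
  have f1 := mul_le_mul_of_nonneg_right cx hx
  have f2 := mul_le_mul_of_nonneg_right cm hm
  have f3 := mul_le_mul_of_nonneg_right ce he
  have f4 := mul_le_mul_of_nonneg_right cg hg
  have f5 := mul_le_mul_of_nonneg_right cs hs
  have f6 := mul_le_mul_of_nonneg_right cr hr
  have f7 := mul_le_mul_of_nonneg_right cσ (by positivity : 0 ≤ β ^ 2 * σ ^ 2)
  have f8 := mul_le_mul_of_nonneg_right ch hh
  linarith

end StepBounds

/-! ### The recursion for the Lyapunov function and the optimality gap -/

theorem le_geometric_of_succ_le {a : ℕ → ℝ} {q c : ℝ} (hq : 0 < q) (hq1 : q ≤ 1) (hc : 0 ≤ c)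
    (h : ∀ t, a (t + 1) ≤ (1 - q) * a t + c) (t : ℕ) : a t ≤ (1 - q) ^ t * a 0 + c / q := by
  induction t with
  | zero => simpa using div_nonneg hc hq.le
  | succ t ih =>
    have h1 := mul_le_mul_of_nonneg_left ih (by linarith : 0 ≤ 1 - q)
    have h2 : (1 - q) * (c / q) + c = c / q := by field_simp; ring
    calc a (t + 1) ≤ (1 - q) * a t + c := h t
      _ ≤ (1 - q) * ((1 - q) ^ t * a 0 + c / q) + c := by linarith
      _ = (1 - q) ^ (t + 1) * a 0 + ((1 - q) * (c / q) + c) := by ring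
      _ = _ := by rw [h2]

theorem cSigma_ge_four (n : ℕ) (L ρ ωb δ η γ : ℝ) (hρ : 0 < ρ) (hδ : 0 < δ) (hγ : 0 < γ) :
    4 ≤ cSigma n L ρ ωb δ η γ := by
  have h1 : 0 ≤ η ^ 2 / γ ^ 3 * (672 * L ^ 2 * n / ρ ^ 3) := by positivity
  have h2 : 0 ≤ η ^ 2 / γ * (6 * L ^ 2 * n * ρ ^ 4 * δ / (25 * ωb ^ 2)) := by positivity
  have h3 : 0 ≤ η ^ 2 / γ ^ 2 * (4 * L ^ 2 * n / ωb ^ 2) := by positivity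
  unfold cSigma
  linarith

theorem lyapState_eq {n d : ℕ} {Z : Type u} [MeasurableSpace Z] {F : Fin n → Vec d → Z → ℝ}
    {D : Fin n → Measure Z} {U : Matrix (Fin n) (Fin (n - 1)) ℝ} {L ρ ωb δ η γ : ℝ}
    (s : AgentState n d) :
    lyapState F D U L ρ ωb δ η γ s = L ^ 2 * frobSq (leftMul U.transpose s.θ)
      + n * ‖rowAvg s.v - rowAvg (fullGrad F D s.θ)‖ ^ 2
      + (n : ℝ)⁻¹ * frobSq (s.v - fullGrad F D s.θ)
      + lyapA L ρ η γ * frobSq (leftMul U.transpose s.g)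
      + lyapB L ρ ωb δ η γ * frobSq (s.g - s.ghat)
      + lyapC L ρ ωb δ γ * frobSq (thetaResidual η s) := rfl

/-! ### Exact dynamics of the averages -/

section Averages

variable {n d b : ℕ} {Z : Type u} {Ξ : Type v} {Ω : Type w}
  {G : SimpleGraph (Fin n)} {U : Matrix (Fin n) (Fin (n - 1)) ℝ} {ρ ωb : ℝ}
  {F : Fin n → Vec d → Z → ℝ} {W : Matrix (Fin n) (Fin n) ℝ} {Q : Vec d → Ξ → Vec d}
  {η γ β : ℝ} {θ₀ : Vec d} {R : Draws Ω Z Ξ n b}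

local notation "𝐬" => docom F W Q θ₀ η γ β R

/-- The gradient tracking invariant: both start from the same batch gradients, receive the same
increment v' - v, and gossip leaves the average alone. -/
theorem rowAvg_v_docom (hmix : IsMixing G W U ρ ωb) (t : ℕ) (o : Ω) :
    rowAvg (𝐬 t o).v = rowAvg (𝐬 t o).g := by
  induction t with
  | zero => rfl
  | succ t ih =>
    have := rowAvg_gNext hmix Q γ (𝐬 t o) (𝐬 (t + 1) o).v (fun i => R.ξg t i o)
    rw [rowAvg_sub, ih] at this
    rw [show (𝐬 (t + 1) o).g = gNext W Q γ (𝐬 t o) (𝐬 (t + 1) o).v (fun i => R.ξg t i o) from rfl,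
      this]
    abel

theorem thetaBar_succ (hmix : IsMixing G W U ρ ωb) (t : ℕ) (o : Ω) :
    thetaBar F W Q θ₀ η γ β R (t + 1) o
      = thetaBar F W Q θ₀ η γ β R t o - η • rowAvg (𝐬 t o).g :=
  rowAvg_thetaNext hmix Q η γ (𝐬 t o) fun i => R.ξθ t i o

end Averages

section Recursion

variable {n d b : ℕ} {Z : Type u} [MeasurableSpace Z] {Ξ : Type v} [MeasurableSpace Ξ]
  {G : SimpleGraph (Fin n)} {U : Matrix (Fin n) (Fin (n - 1)) ℝ} {ρ ωb : ℝ}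
  {F : Fin n → Vec d → Z → ℝ} {D : Fin n → Measure Z} [∀ i, IsProbabilityMeasure (D i)]
  {W : Matrix (Fin n) (Fin n) ℝ} {κ : Kernel (Vec d) Ξ} [IsMarkovKernel κ]
  {Q : Vec d → Ξ → Vec d} {L σ δ μ η γ β : ℝ} {θ₀ : Vec d}
  {Ω : Type w} [mΩ : MeasurableSpace Ω] {P : Measure Ω} [IsProbabilityMeasure P]
  {R : Draws Ω Z Ξ n b}

local notation "𝐬" => docom F W Q θ₀ η γ β R

theorem integrable_lyapState_and_integral_eq (hprob : IsStochasticProblem F D)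
    (hlip : HasLipschitzSampleGradients F D L) (hgrad : HasUnbiasedGradients F D σ)
    {s : Ω → AgentState n d} (hs : StateMemLp P s) :
    Integrable (fun o => lyapState F D U L ρ ωb δ η γ (s o)) P ∧
    ∫ o, lyapState F D U L ρ ωb δ η γ (s o) ∂P
      = L ^ 2 * ∫ o, frobSq (leftMul U.transpose (s o).θ) ∂P
        + n * ∫ o, ‖rowAvg (s o).v - rowAvg (fullGrad F D (s o).θ)‖ ^ 2 ∂P
        + (n : ℝ)⁻¹ * ∫ o, frobSq ((s o).v - fullGrad F D (s o).θ) ∂P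
        + lyapA L ρ η γ * ∫ o, frobSq (leftMul U.transpose (s o).g) ∂P
        + lyapB L ρ ωb δ η γ * ∫ o, frobSq ((s o).g - (s o).ghat) ∂P
        + lyapC L ρ ωb δ γ * ∫ o, frobSq (thetaResidual η (s o)) ∂P := by
  have hF := memLp_fullGrad hprob hlip hgrad hs.θ
  have i1 := (integrable_frobSq (memLp_leftMul U.transpose hs.θ)).const_mul (L ^ 2)
  have i2 : Integrable (fun o => n * ‖rowAvg (s o).v - rowAvg (fullGrad F D (s o).θ)‖ ^ 2) P :=
    (integrable_norm_sq ((memLp_rowAvg hs.v).sub (memLp_rowAvg hF))).const_mul (n : ℝ)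
  have i3 : Integrable (fun o => (n : ℝ)⁻¹ * frobSq ((s o).v - fullGrad F D (s o).θ)) P :=
    (integrable_frobSq fun i => (hs.v i).sub (hF i)).const_mul _
  have i4 := (integrable_frobSq (memLp_leftMul U.transpose hs.g)).const_mul (lyapA L ρ η γ)
  have i5 : Integrable (fun o => lyapB L ρ ωb δ η γ * frobSq ((s o).g - (s o).ghat)) P :=
    (integrable_frobSq fun i => (hs.g i).sub (hs.ghat i)).const_mul _
  have i6 : Integrable (fun o => lyapC L ρ ωb δ γ * frobSq (thetaResidual η (s o))) P :=
    (integrable_frobSq hs.thetaResidual).const_mul _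
  simp only [lyapState_eq]
  refine ⟨((((i1.add i2).add i3).add i4).add i5).add i6, ?_⟩
  have j2 := i1.add i2
  have j3 := j2.add i3
  have j4 := j3.add i4
  have j5 := j4.add i5
  simp only [Pi.add_def] at j2 j3 j4 j5
  rw [integral_add j5 i6, integral_add j4 i5, integral_add j3 i4, integral_add j2 i3,
    integral_add i1 i2]
  simp only [integral_const_mul]

/-- The objective lies between its infimum and the quadratic upper model at 0. -/
theorem integrable_avgObj_comp (hn : 0 < n) (hprob : IsStochasticProblem F D)
    (hlip : HasLipschitzSampleGradients F D L) (hgrad : HasUnbiasedGradients F D σ)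
    {X : Ω → Vec d} (hX : MemLp X 2 P) : Integrable (fun o => avgObj F D (X o)) P := by
  have hdiff := hprob.differentiable_avgObj
  have hX1 : Integrable X P := hX.integrable (by norm_num)
  refine integrable_of_le_of_le (g₁ := fun _ => optVal F D)
    (g₂ := fun o => avgObj F D 0 + inner ℝ (gradient (avgObj F D) 0) (X o) + L / 2 * ‖X o‖ ^ 2)
    (hdiff.continuous.comp_aestronglyMeasurable hX.1)
    (ae_of_all _ fun o => optVal_le hprob _) (ae_of_all _ fun o => ?_) (integrable_const _)
    (((integrable_const _).add (hX1.const_inner _)).add ((integrable_norm_sq hX).const_mul _))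
  have := le_add_inner_gradient_add_sq hdiff
    (norm_gradient_avgObj_sub_le hn hprob hlip hgrad) 0 (X o)
  rwa [zero_add] at this

/-- For n ≥ 2 the Lyapunov function itself is the witness. For n = 1 the inequality ρ ≤ ω̄ may fail,
but `U` has no columns, disagreement vanishes, and the two estimator errors form a closed recursion;
their sum is the witness and lies below the Lyapunov function at time 0. -/
theorem exists_lyapunov (hn : 0 < n) (hprob : IsStochasticProblem F D)
    (hlip : HasLipschitzSampleGradients F D L) (hmix : IsMixing G W U ρ ωb)
    (hgrad : HasUnbiasedGradients F D σ) (hcomp : IsCompressor κ Q δ)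
    (hst : StepSizes n L ρ ωb δ η γ β) (hS : IsSampling P F D W κ Q θ₀ η γ β R) :
    ∃ V : ℕ → ℝ, V 0 ≤ ∫ o, lyapState F D U L ρ ωb δ η γ (𝐬 0 o) ∂P ∧
      (∀ t, n * (∫ o, ‖rowAvg (𝐬 t o).v - rowAvg (fullGrad F D (𝐬 t o).θ)‖ ^ 2 ∂P)
        + L ^ 2 * ∫ o, frobSq (leftMul U.transpose (𝐬 t o).θ) ∂P ≤ V t) ∧
      ∀ t, V (t + 1) ≤ (1 - betaBar ρ δ γ β) * V t + cSigma n L ρ ωb δ η γ * (β ^ 2 * σ ^ 2)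
        + η ^ 2 * cGbar n L ρ ωb γ β * ∫ o, ‖rowAvg (𝐬 t o).g‖ ^ 2 ∂P := by
  have hL := hlip.nonneg
  have hρ := hmix.rho_pos
  have hω := hmix.omega_pos
  have hδ := hcomp.delta_pos
  have hγ := hst.gamma_pos
  have hγ1 := hst.gamma_lt_one
  have hp := hst.rho_gamma_le hρ
  have h1γ : 0 < 1 - γ := by linarith
  have hm := fun t => stateMemLp_docom hprob hlip hgrad hcomp hS t
  have hI := fun t => (integrable_lyapState_and_integral_eq (U := U) (ρ := ρ) (ωb := ωb)
    (δ := δ) (η := η) (γ := γ) hprob hlip hgrad (hm t)).2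
  have hsb := fun t => stepBounds_docom hn hprob hlip hmix hgrad hcomp hγ hst.gamma_le_one
    (by linarith) (hst.gamma_omega_le hω) hS t
  have ha : 0 ≤ lyapA L ρ η γ := by unfold lyapA; positivity
  have hb : 0 ≤ lyapB L ρ ωb δ η γ := by unfold lyapB; positivity
  have hc : 0 ≤ lyapC L ρ ωb δ γ := by unfold lyapC; positivity
  have n1 : ∀ (t : ℕ), 0 ≤ ∫ o, frobSq (leftMul U.transpose (𝐬 t o).θ) ∂P :=
    fun t => integral_nonneg fun _ => frobSq_nonneg _
  have n2 : ∀ (t : ℕ), 0 ≤ ∫ o, ‖rowAvg (𝐬 t o).v - rowAvg (fullGrad F D (𝐬 t o).θ)‖ ^ 2 ∂P :=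
    fun t => integral_nonneg fun _ => sq_nonneg _
  have n3 : ∀ (t : ℕ), 0 ≤ ∫ o, frobSq ((𝐬 t o).v - fullGrad F D (𝐬 t o).θ) ∂P :=
    fun t => integral_nonneg fun _ => frobSq_nonneg _
  have n4 : ∀ (t : ℕ), 0 ≤ ∫ o, frobSq (leftMul U.transpose (𝐬 t o).g) ∂P :=
    fun t => integral_nonneg fun _ => frobSq_nonneg _
  have n5 : ∀ (t : ℕ), 0 ≤ ∫ o, frobSq ((𝐬 t o).g - (𝐬 t o).ghat) ∂P :=
    fun t => integral_nonneg fun _ => frobSq_nonneg _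
  have n6 : ∀ (t : ℕ), 0 ≤ ∫ o, frobSq (thetaResidual η (𝐬 t o)) ∂P :=
    fun t => integral_nonneg fun _ => frobSq_nonneg _
  have n7 : ∀ (t : ℕ), 0 ≤ ∫ o, ‖rowAvg (𝐬 t o).g‖ ^ 2 ∂P :=
    fun t => integral_nonneg fun _ => sq_nonneg _
  have m3 : ∀ t, 0 ≤ (n : ℝ)⁻¹ * ∫ o, frobSq ((𝐬 t o).v - fullGrad F D (𝐬 t o).θ) ∂P :=
    fun t => mul_nonneg (by positivity) (n3 t)
  rcases (by omega : n = 1 ∨ 2 ≤ n) with h1 | h2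
  · have hn1 : (n : ℝ) = 1 := by exact_mod_cast h1
    have hz : ∀ X : Fin n → Vec d, frobSq (leftMul U.transpose X) = 0 := fun X => by
      have : IsEmpty (Fin (n - 1)) := ⟨fun i => by have := i.2; omega⟩
      simp [frobSq]
    refine ⟨fun t => (∫ o, ‖rowAvg (𝐬 t o).v - rowAvg (fullGrad F D (𝐬 t o).θ)‖ ^ 2 ∂P)
      + ∫ o, frobSq ((𝐬 t o).v - fullGrad F D (𝐬 t o).θ) ∂P, ?_, fun t => ?_, fun t => ?_⟩
    · have h5 := mul_nonneg hb (n5 0)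
      have h6 := mul_nonneg hc (n6 0)
      rw [hI 0]
      simp only [hz, integral_zero, mul_zero, hn1, inv_one, one_mul]
      linarith
    · have := n3 t
      simp only [hz, integral_zero, mul_zero, hn1, one_mul]
      linarith
    -- A single agent does not gossip, so its displacement is exactly -ηḡ and no compression error
    -- enters.
    · have hD : ∫ o, frobSq ((𝐬 (t + 1) o).θ - (𝐬 t o).θ) ∂P
          = η ^ 2 * ∫ o, ‖rowAvg (𝐬 t o).g‖ ^ 2 ∂P := by
        rw [← integral_const_mul]
        congr 1
        funext o
        have e : rowAvg ((𝐬 (t + 1) o).θ - (𝐬 t o).θ) = -(η • rowAvg (𝐬 t o).g) := by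
          rw [rowAvg_sub]
          have := thetaBar_succ (F := F) (Q := Q) (θ₀ := θ₀) (η := η) (γ := γ) (β := β) (R := R)
            hmix t o
          simp only [thetaBar] at this
          rw [this]
          abel
        rw [hmix.frobSq_eq, hz, e, norm_neg, norm_smul, mul_pow, Real.norm_eq_abs, sq_abs, hn1,
          one_mul, add_zero]
      have k1 := (hsb t).gradErr
      have k2 := (hsb t).avgErr
      rw [hD] at k1 k2
      simp only [hn1, inv_one, one_mul, one_pow, mul_one] at k1 k2
      have hβ := hst.beta_pos
      have hβ1 := hst.beta_lt_one
      have hB : betaBar ρ δ γ β ≤ β := (min_le_right _ _).trans (min_le_right _ _)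
      have hB2 : (1 - β) ^ 2 ≤ 1 - betaBar ρ δ γ β := by
        linarith only [hB, mul_nonneg hβ.le (by linarith : 0 ≤ 1 - β)]
      have hσ := mul_le_mul_of_nonneg_right (cSigma_ge_four n L ρ ωb δ η γ hρ hδ hγ)
        (by positivity : 0 ≤ β ^ 2 * σ ^ 2)
      have hG : 4 * ((1 - β) ^ 2 * L ^ 2) ≤ cGbar n L ρ ωb γ β := by
        have e1 : 0 ≤ L ^ 2 * n / (ρ * γ) * (96 + 141 / 400 * (ρ ^ 2 / ωb ^ 2)) := by
          positivity
        have e2 : 1 / 2 ≤ (1 - ρ * γ) ^ 2 := by linarith only [hp, sq_nonneg (ρ * γ - 1 / 4)]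
        have e3 := mul_le_mul_of_nonneg_left e2 (by positivity : 0 ≤ 8 * (1 - β) ^ 2 * L ^ 2)
        unfold cGbar
        linarith
      have hG' := mul_le_mul_of_nonneg_right hG (mul_nonneg (sq_nonneg η) (n7 t))
      have hV := mul_le_mul_of_nonneg_right hB2 (add_nonneg (n2 t) (n3 t))
      linarith
  · refine ⟨fun t => ∫ o, lyapState F D U L ρ ωb δ η γ (𝐬 t o) ∂P, le_rfl, fun t => ?_,
      fun t => ?_⟩
    · have h4 := mul_nonneg ha (n4 t)
      have h5 := mul_nonneg hb (n5 t)
      have h6 := mul_nonneg hc (n6 t)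
      have h3 := m3 t
      beta_reduce
      rw [hI t]
      linarith
    · beta_reduce
      rw [hI t, hI (t + 1)]
      exact (hsb t).lyapunov_le hst h2 hL hρ hω (hmix.rho_le_omega h2) hδ hcomp.delta_le (n1 t)
        (n2 t) (n3 t) (n4 t) (n5 t) (n6 t) (n7 t)

theorem StepSizes.betaTilde_pos (hst : StepSizes n L ρ ωb δ η γ β) (hρ : 0 < ρ) (hδ : 0 < δ)
    (hμ : 0 < μ) : 0 < betaTilde ρ δ μ η γ β :=
  lt_min (mul_pos hst.eta_pos hμ)
    (half_pos (StepSizes.betaBar_pos hρ hδ hst.gamma_pos hst.beta_pos))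

theorem StepSizes.betaTilde_lt_one (hst : StepSizes n L ρ ωb δ η γ β) :
    betaTilde ρ δ μ η γ β < 1 := by
  have h1 : betaTilde ρ δ μ η γ β ≤ betaBar ρ δ γ β / 2 := min_le_right _ _
  have h2 : betaBar ρ δ γ β ≤ β := (min_le_right _ _).trans (min_le_right _ _)
  have h3 := hst.beta_lt_one
  have h4 := hst.beta_pos
  linarith

/-- The descent inequality and the contraction of V are added with weight w = 2η/(β̄n), giving a
scalar recursion with rate 1 - β̃ for Δ + wV. Its last term dominates the consensus error with the
stated coefficient wL². -/
theorem optimality_gap_le (hn : 0 < n) (hprob : IsStochasticProblem F D)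
    (hlip : HasLipschitzSampleGradients F D L) (hmix : IsMixing G W U ρ ωb)
    (hgrad : HasUnbiasedGradients F D σ) (hcomp : IsCompressor κ Q δ) (hpl : IsPL F D μ)
    (hst : StepSizes n L ρ ωb δ η γ β) (hS : IsSampling P F D W κ Q θ₀ η γ β R) (t : ℕ) :
    ((∫ o, avgObj F D (thetaBar F W Q θ₀ η γ β R t o) ∂P) - optVal F D)
        + 2 * L ^ 2 * η / (betaBar ρ δ γ β * n)
          * ∑ i, ∫ o, ‖(𝐬 t o).θ i - thetaBar F W Q θ₀ η γ β R t o‖ ^ 2 ∂P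
      ≤ (1 - betaTilde ρ δ μ η γ β) ^ t
          * (((∫ o, avgObj F D (thetaBar F W Q θ₀ η γ β R 0 o) ∂P) - optVal F D)
            + 2 * η / (betaBar ρ δ γ β * n)
              * ∫ o, lyapState F D U L ρ ωb δ η γ (𝐬 0 o) ∂P)
        + η * β ^ 2 / (betaBar ρ δ γ β * betaTilde ρ δ μ η γ β)
          * (2 * cSigma n L ρ ωb δ η γ * σ ^ 2 / n) := by
  have hL := hlip.nonneg
  have hρ := hmix.rho_pos
  have hδ := hcomp.delta_pos
  have hη := hst.eta_pos
  have hn0 : (0 : ℝ) < n := by positivity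
  have hB := StepSizes.betaBar_pos hρ hδ hst.gamma_pos hst.beta_pos
  have hq := hst.betaTilde_pos hρ hδ hpl.pos
  have hq1 := hst.betaTilde_lt_one (μ := μ)
  have hC := cSigma_ge_four n L ρ ωb δ η γ hρ hδ hst.gamma_pos
  have hCG := hst.eta_sq_cGbar_le hL hn hρ hδ
  obtain ⟨V, hV0, hV1, hV2⟩ := exists_lyapunov hn hprob hlip hmix hgrad hcomp hst hS
  have hm := fun t => stateMemLp_docom hprob hlip hgrad hcomp hS t
  have hobj := fun t => integrable_avgObj_comp hn hprob hlip hgrad (memLp_rowAvg (hm t).θ)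
  set q := betaTilde ρ δ μ η γ β with hqdef
  set B := betaBar ρ δ γ β with hBdef
  set w := 2 * η / (B * n) with hw
  have hw0 : 0 < w := by positivity
  have hq2 : q ≤ η * μ := min_le_left _ _
  have hq3 : q ≤ B / 2 := min_le_right _ _
  set Δ : ℕ → ℝ := fun t => (∫ o, avgObj F D (thetaBar F W Q θ₀ η γ β R t o) ∂P) - optVal F D
    with hΔ
  have hΔ0 : ∀ t, 0 ≤ Δ t := fun t => by
    have := integral_mono (integrable_const (optVal F D)) (hobj t)
      fun o => optVal_le hprob (rowAvg (𝐬 t o).θ)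
    simp only [integral_const, probReal_univ, one_smul] at this
    exact sub_nonneg.2 this
  have hcons : ∀ t, ∑ i, ∫ o, ‖(𝐬 t o).θ i - thetaBar F W Q θ₀ η γ β R t o‖ ^ 2 ∂P
      = ∫ o, frobSq (leftMul U.transpose (𝐬 t o).θ) ∂P := fun t => by
    have hi : ∀ i, Integrable
        (fun o => ‖(𝐬 t o).θ i - thetaBar F W Q θ₀ η γ β R t o‖ ^ 2) P := fun i =>
      integrable_norm_sq (((hm t).θ i).sub (memLp_rowAvg (hm t).θ))
    rw [← integral_finsetSum _ fun i _ => hi i]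
    simp only [hmix.frobSq_transpose_eq_sum]
    rfl
  have hm0 : ∀ t, 0 ≤ ∫ o, ‖rowAvg (𝐬 t o).v - rowAvg (fullGrad F D (𝐬 t o).θ)‖ ^ 2 ∂P :=
    fun t => integral_nonneg fun _ => sq_nonneg _
  have hdesc : ∀ t, Δ (t + 1) ≤ (1 - η * μ) * Δ t - η / 4 * (∫ o, ‖rowAvg (𝐬 t o).g‖ ^ 2 ∂P)
      + η / n * V t := fun t => by
    have i1 := integrable_norm_sq (memLp_rowAvg (hm t).g)
    have i2 := integrable_norm_sq ((memLp_rowAvg (hm t).v).sub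
      (memLp_rowAvg (memLp_fullGrad hprob hlip hgrad (hm t).θ)))
    have i3 := integrable_frobSq (memLp_leftMul U.transpose (hm t).θ)
    have h := integral_le_linear_comb₄ (c₁ := 1 - η * μ) (c₂ := -(η / 4)) (c₃ := η / n * n)
      (c₄ := η / n * L ^ 2) ((hobj (t + 1)).sub (integrable_const (optVal F D)))
      ((hobj t).sub (integrable_const (optVal F D))) i1 i2 i3 (fun o => by
        have h1 := avgObj_step_le hn hprob hlip hgrad hpl hη (hst.eta_mul_L_le hL hn hρ hδ)
          (𝐬 t o).θ (𝐬 t o).v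
        have h2 := thetaBar_succ (F := F) (Q := Q) (θ₀ := θ₀) (η := η) (γ := γ) (β := β) (R := R)
            hmix t o
        simp only [thetaBar] at h2
        rw [← hmix.frobSq_transpose_eq_sum, rowAvg_v_docom hmix, ← h2] at h1
        simp only [Pi.sub_apply, rowAvg_v_docom hmix]
        linarith)
    simp only [Pi.sub_apply] at h
    rw [integral_sub (hobj (t + 1)) (integrable_const _), integral_sub (hobj t)
      (integrable_const _)] at h
    simp only [integral_const, probReal_univ, one_smul] at h
    have h3 := mul_le_mul_of_nonneg_left (hV1 t) (by positivity : 0 ≤ η / n)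
    simp only [hΔ, thetaBar]
    linarith
  have hstep : ∀ t, Δ (t + 1) + w * V (t + 1) ≤ (1 - q) * (Δ t + w * V t)
      + w * (cSigma n L ρ ωb δ η γ * (β ^ 2 * σ ^ 2)) := fun t => by
    have hh : 0 ≤ ∫ o, ‖rowAvg (𝐬 t o).g‖ ^ 2 ∂P := integral_nonneg fun _ => sq_nonneg _
    have hVt : 0 ≤ V t := by
      have h1 : 0 ≤ ∫ o, frobSq (leftMul U.transpose (𝐬 t o).θ) ∂P :=
        integral_nonneg fun _ => frobSq_nonneg _
      exact (add_nonneg (mul_nonneg hn0.le (hm0 t)) (mul_nonneg (sq_nonneg L) h1)).trans (hV1 t)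
    have h1 := mul_le_mul_of_nonneg_left (hV2 t) hw0.le
    -- The purpose of the second bound on η: what V loses to ‖ḡ‖² is regained from the descent.
    have h2 : w * (η ^ 2 * cGbar n L ρ ωb γ β) ≤ η / 4 := by
      have := mul_le_mul_of_nonneg_left hCG hw0.le
      have e : w * (B * n) = 2 * η := by rw [hw]; field_simp
      linarith
    have h3 := mul_le_mul_of_nonneg_right h2 hh
    -- Half of the decay of wV absorbs the error term of the descent; the other half, at least β̃,
    -- remains.
    have h4 : η / n = w * (B / 2) := by rw [hw]; field_simp
    have h5 := hdesc t
    rw [h4] at h5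
    have h6 := mul_le_mul_of_nonneg_right hq2 (hΔ0 t)
    have h7 := mul_le_mul_of_nonneg_right hq3 (mul_nonneg hw0.le hVt)
    linarith
  have hgeo := le_geometric_of_succ_le (a := fun t => Δ t + w * V t) hq hq1.le
    (by positivity : 0 ≤ w * (cSigma n L ρ ωb δ η γ * (β ^ 2 * σ ^ 2))) hstep t
  have hfirst : Δ 0 + w * V 0
      ≤ Δ 0 + w * ∫ o, lyapState F D U L ρ ωb δ η γ (𝐬 0 o) ∂P := by gcongr
  have hnoise : w * (cSigma n L ρ ωb δ η γ * (β ^ 2 * σ ^ 2)) / q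
      = η * β ^ 2 / (B * q) * (2 * cSigma n L ρ ωb δ η γ * σ ^ 2 / n) := by
    rw [hw]; field_simp
  have hlast : 2 * L ^ 2 * η / (B * n) * ∑ i,
      ∫ o, ‖(𝐬 t o).θ i - thetaBar F W Q θ₀ η γ β R t o‖ ^ 2 ∂P ≤ w * V t := by
    rw [hcons, show 2 * L ^ 2 * η / (B * n) = w * L ^ 2 by rw [hw]; ring, mul_assoc]
    have := hV1 t
    have := mul_nonneg hn0.le (hm0 t)
    gcongr
    linarith
  have hpow := mul_le_mul_of_nonneg_left hfirst (pow_nonneg (by linarith : 0 ≤ 1 - q) t)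
  rw [hnoise] at hgeo
  change Δ t + _ ≤ _ * (Δ 0 + _) + _
  linarith

end Recursion

/-! ### The initial value of the Lyapunov function -/

theorem MeasureTheory.MeasurePreserving.integral_comp_of_aestronglyMeasurable {A B E : Type*}
    [MeasurableSpace A] [MeasurableSpace B] [NormedAddCommGroup E] [NormedSpace ℝ E]
    {μ : Measure A} {ν : Measure B} {g : A → B} (h : MeasurePreserving g μ ν) {f : B → E}
    (hf : AEStronglyMeasurable f ν) : ∫ x, f (g x) ∂μ = ∫ y, f y ∂ν := by
  rw [← h.map_eq] at hf ⊢
  exact (integral_map h.measurable.aemeasurable hf).symm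

section Initial

variable {n d b : ℕ} {Z : Type u} [MeasurableSpace Z] {Ξ : Type v} [MeasurableSpace Ξ]
  {G : SimpleGraph (Fin n)} {U : Matrix (Fin n) (Fin (n - 1)) ℝ} {ρ ωb : ℝ}
  {F : Fin n → Vec d → Z → ℝ} {D : Fin n → Measure Z} [∀ i, IsProbabilityMeasure (D i)]
  {W : Matrix (Fin n) (Fin n) ℝ} {κ : Kernel (Vec d) Ξ}
  {Q : Vec d → Ξ → Vec d} {L σ δ μ η γ β : ℝ} {θ₀ : Vec d}
  {Ω : Type w} [mΩ : MeasurableSpace Ω] {P : Measure Ω}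
  {R : Draws Ω Z Ξ n b}

local notation "𝐬" => docom F W Q θ₀ η γ β R

/-- The error of the batch gradient of agent `i`. -/
noncomputable def batchErr (F : Fin n → Vec d → Z → ℝ) (D : Fin n → Measure Z) (θ₀ : Vec d)
    (i : Fin n) (z : Fin b → Z) : Vec d :=
  (b : ℝ)⁻¹ • ∑ r, (stochGrad F i θ₀ (z r) - gradient (localObj F D i) θ₀)

theorem batchGrad_eq {n d b : ℕ} {Z : Type u} [MeasurableSpace Z] (F : Fin n → Vec d → Z → ℝ)
    (D : Fin n → Measure Z) (hb : 0 < b) (θ₀ : Vec d) (i : Fin n) (z : Fin b → Z) :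
    (b : ℝ)⁻¹ • ∑ r, stochGrad F i θ₀ (z r)
      = gradient (localObj F D i) θ₀ + batchErr F D θ₀ i z := by
  have hb' : (b : ℝ) ≠ 0 := by positivity
  simp only [batchErr, Finset.sum_sub_distrib, Finset.sum_const,
    Finset.card_univ, Fintype.card_fin, smul_sub, ← Nat.cast_smul_eq_nsmul ℝ]
  rw [smul_smul, inv_mul_cancel₀ hb', one_smul]
  abel

theorem batchErr_moments (hb : 0 < b) (hprob : IsStochasticProblem F D)
    (hgrad : HasUnbiasedGradients F D σ) (θ₀ : Vec d) (i : Fin n) :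
    MemLp (batchErr F D θ₀ i) 2 (Measure.pi fun _ : Fin b => D i) ∧
    ∫ z, batchErr F D θ₀ i z ∂(Measure.pi fun _ : Fin b => D i) = 0 ∧
    ∫ z, ‖batchErr F D θ₀ i z‖ ^ 2 ∂(Measure.pi fun _ : Fin b => D i) ≤ σ ^ 2 / b := by
  obtain ⟨h1, h2⟩ := hgrad.memLp_sub hprob i θ₀
  have hb' : (0 : ℝ) < b := by positivity
  have h0 : ∫ z, (stochGrad F i θ₀ z - gradient (localObj F D i) θ₀) ∂(D i) = 0 := by
    rw [integral_sub (hgrad.integrable hprob i θ₀) (integrable_const _), hgrad.unbiased]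
    simp
  have hpi := memLp_comp_eval_pi (ι := Fin b) (ν := fun _ => D i) fun _ => h1
  refine ⟨(memLp_finsetSum _ fun r _ => hpi r).const_smul (b : ℝ)⁻¹, ?_, ?_⟩
  · unfold batchErr
    rw [integral_smul, integral_finsetSum _ fun r _ => (hpi r).integrable (by norm_num),
      Finset.sum_eq_zero, smul_zero]
    intro r _
    rw [integral_comp_eval (μ := fun _ : Fin b => D i) (i := r)
      (f := fun z => stochGrad F i θ₀ z - gradient (localObj F D i) θ₀)
      h1.aestronglyMeasurable, h0]
  · unfold batchErr
    simp only [norm_smul, mul_pow, Real.norm_eq_abs, sq_abs]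
    rw [integral_const_mul, integral_norm_sum_pi_sq (ν := fun _ : Fin b => D i)
      (w := fun _ z => stochGrad F i θ₀ z - gradient (localObj F D i) θ₀) (fun _ => h1)
      fun _ => h0]
    simp only [Finset.sum_const, Finset.card_univ, Fintype.card_fin, nsmul_eq_mul]
    have := mul_le_mul_of_nonneg_left h2 (by positivity : 0 ≤ (b : ℝ)⁻¹ ^ 2 * b)
    calc _ = (b : ℝ)⁻¹ ^ 2 * b
          * ∫ z, ‖stochGrad F i θ₀ z - gradient (localObj F D i) θ₀‖ ^ 2 ∂(D i) := by ring
      _ ≤ _ := this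
      _ = σ ^ 2 / b := by field_simp

theorem integral_batchErr_ζ0 (hb : 0 < b) (hprob : IsStochasticProblem F D)
    (hgrad : HasUnbiasedGradients F D σ) (hS : IsSampling P F D W κ Q θ₀ η γ β R) (i : Fin n) :
    MemLp (fun o => batchErr F D θ₀ i fun r => R.ζ0 i r o) 2 P ∧
    ∫ o, ‖batchErr F D θ₀ i fun r => R.ζ0 i r o‖ ^ 2 ∂P ≤ σ ^ 2 / b := by
  obtain ⟨h1, -, h2⟩ := batchErr_moments hb hprob hgrad θ₀ i
  have hpres : MeasurePreserving (fun o r => R.ζ0 i r o) P (Measure.pi fun _ : Fin b => D i) :=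
    (measurePreserving_eval (fun i : Fin n => Measure.pi fun _ : Fin b => D i) i).comp
      hS.measurePreserving_ζ0
  refine ⟨h1.comp_measurePreserving hpres, ?_⟩
  rwa [hpres.integral_comp_of_aestronglyMeasurable (f := fun z => ‖batchErr F D θ₀ i z‖ ^ 2)
    (h1.aestronglyMeasurable.norm.pow 2)]

theorem integral_sum_batchErr_ζ0 (hb : 0 < b) (hprob : IsStochasticProblem F D)
    (hgrad : HasUnbiasedGradients F D σ) (hS : IsSampling P F D W κ Q θ₀ η γ β R) :
    ∫ o, ‖∑ i, batchErr F D θ₀ i fun r => R.ζ0 i r o‖ ^ 2 ∂P ≤ n * (σ ^ 2 / b) := by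
  have hB := fun i => batchErr_moments hb hprob hgrad θ₀ i
  have hpi := memLp_comp_eval_pi (ν := fun i : Fin n => Measure.pi fun _ : Fin b => D i)
    (w := fun i z => batchErr F D θ₀ i z) (fun i => (hB i).1)
  rw [hS.measurePreserving_ζ0.integral_comp_of_aestronglyMeasurable
      (f := fun z => ‖∑ i, batchErr F D θ₀ i (z i)‖ ^ 2)
      ((memLp_finsetSum _ fun i _ => hpi i).aestronglyMeasurable.norm.pow 2),
    integral_norm_sum_pi_sq (ν := fun i : Fin n => Measure.pi fun _ : Fin b => D i)
      (w := fun i z => batchErr F D θ₀ i z) (fun i => (hB i).1) fun i => (hB i).2.1]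
  calc _ ≤ ∑ _i : Fin n, σ ^ 2 / b := Finset.sum_le_sum fun i _ => (hB i).2.2
    _ = _ := by simp

variable [IsProbabilityMeasure P]

theorem integral_norm_g_zero_sq_le (hb : 0 < b) (hprob : IsStochasticProblem F D)
    (hgrad : HasUnbiasedGradients F D σ) (hS : IsSampling P F D W κ Q θ₀ η γ β R) (i : Fin n) :
    ∫ o, ‖(𝐬 0 o).g i‖ ^ 2 ∂P ≤ 2 * ‖gradient (localObj F D i) θ₀‖ ^ 2 + 2 * σ ^ 2 := by
  obtain ⟨h1, h2⟩ := integral_batchErr_ζ0 hb hprob hgrad hS i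
  have hb1 : (1 : ℝ) ≤ b := by exact_mod_cast hb
  have h3 : ∫ o, ‖(𝐬 0 o).g i‖ ^ 2 ∂P ≤ ∫ o, (2 * ‖gradient (localObj F D i) θ₀‖ ^ 2
      + 2 * ‖batchErr F D θ₀ i fun r => R.ζ0 i r o‖ ^ 2) ∂P := by
    refine integral_mono_of_nonneg (ae_of_all _ fun o => sq_nonneg _)
      ((integrable_const _).add ((integrable_norm_sq h1).const_mul 2)) (ae_of_all _ fun o => ?_)
    simp only [docom, initState]
    rw [batchGrad_eq F D hb]
    exact norm_add_sq_le_two _ _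
  rw [integral_add (integrable_const _) ((integrable_norm_sq h1).const_mul 2)] at h3
  simp only [integral_const, integral_const_mul, probReal_univ, one_smul] at h3
  have h4 : σ ^ 2 / b ≤ σ ^ 2 := div_le_self (sq_nonneg σ) hb1
  linarith

/-- Initially all three weighted terms are multiples of ‖G⁰‖². The first weight supplies 96 and the
others are small because γω̄² ≤ δρ/259. -/
theorem StepSizes.lyap_weights_le (hst : StepSizes n L ρ ωb δ η γ β) (hρ : 0 < ρ) (hω : 0 < ωb)
    (hδ : 0 < δ) :
    lyapA L ρ η γ + lyapB L ρ ωb δ η γ + lyapC L ρ ωb δ γ * η ^ 2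
      ≤ 192 * L ^ 2 / (ρ ^ 2 * γ ^ 2 * (1 - γ)) * η ^ 2 := by
  have hγ := hst.gamma_pos
  have h1γ : 0 < 1 - γ := by linarith [hst.gamma_lt_one]
  have hp := hst.rho_gamma_le hρ
  have h1 := hst.gamma_omega_sq_le_rho hω hρ hδ
  set K := L ^ 2 * η ^ 2 / (ρ ^ 2 * γ ^ 2 * (1 - γ)) with hK
  have hK0 : 0 ≤ K := by positivity
  set y := γ * ωb ^ 2 / (δ * ρ) with hy
  have hy0 : 0 ≤ y := by positivity
  have hy1 : y ≤ 1 / 259 := by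
    rw [hy, div_le_iff₀ (by positivity)]
    linarith
  have ea : lyapA L ρ η γ = 96 * (K * (1 - γ)) := by rw [lyapA, hK]; field_simp
  have eb : lyapB L ρ ωb δ η γ = 3072 * (K * y) := by rw [lyapB, hK, hy]; field_simp
  have ec : lyapC L ρ ωb δ γ * η ^ 2 = 48 * (K * y * (ρ * γ) ^ 2) := by
    rw [lyapC, hK, hy]; field_simp
  have er : 192 * L ^ 2 / (ρ ^ 2 * γ ^ 2 * (1 - γ)) * η ^ 2 = 192 * K := by rw [hK]; ring
  have h2 := mul_le_mul_of_nonneg_left hy1 hK0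
  have h3 : (ρ * γ) ^ 2 ≤ 1 := pow_le_one₀ (by positivity) (by linarith)
  have h4 := mul_le_mul_of_nonneg_left h3 (mul_nonneg hK0 hy0)
  have h5 := mul_nonneg hK0 hγ.le
  rw [ea, eb, ec, er]
  linarith

variable [IsMarkovKernel κ]

/-- At the common start there is no disagreement in Θ, ĝ = 0, and the θ-residual is -ηg. The two
batch errors contribute σ²/b each: per agent by averaging over the batch, and for the mean by
independence across agents as well. -/
theorem integral_lyapState_zero_le (hn : 0 < n) (hb : 0 < b) (hprob : IsStochasticProblem F D)
    (hlip : HasLipschitzSampleGradients F D L) (hmix : IsMixing G W U ρ ωb)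
    (hgrad : HasUnbiasedGradients F D σ) (hcomp : IsCompressor κ Q δ)
    (hst : StepSizes n L ρ ωb δ η γ β) (hS : IsSampling P F D W κ Q θ₀ η γ β R) :
    ∫ o, lyapState F D U L ρ ωb δ η γ (𝐬 0 o) ∂P
      ≤ 2 * σ ^ 2 / b + 192 * L ^ 2 * n / (ρ ^ 2 * γ ^ 2 * (1 - γ))
        * ((n : ℝ)⁻¹ * ∑ i, ∫ o, ‖(𝐬 0 o).g i‖ ^ 2 ∂P) * η ^ 2 := by
  have hρ := hmix.rho_pos
  have hω := hmix.omega_pos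
  have hδ := hcomp.delta_pos
  have hγ := hst.gamma_pos
  have h1γ : 0 < 1 - γ := by linarith [hst.gamma_lt_one]
  have hn0 : (0 : ℝ) < n := by positivity
  have hm := stateMemLp_docom hprob hlip hgrad hcomp hS 0
  rw [(integrable_lyapState_and_integral_eq hprob hlip hgrad hm).2]
  have hE := fun i => integral_batchErr_ζ0 hb hprob hgrad hS i
  have hv : ∀ o, (𝐬 0 o).v - fullGrad F D (𝐬 0 o).θ
      = fun i => batchErr F D θ₀ i fun r => R.ζ0 i r o := fun o => by
    funext i
    simp only [docom, initState, Pi.sub_apply]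
    rw [batchGrad_eq F D hb]
    exact add_sub_cancel_left _ _
  have hx : ∀ o, frobSq (leftMul U.transpose (𝐬 0 o).θ) = 0 := fun o => by
    rw [hmix.frobSq_transpose_eq_sum]
    refine Finset.sum_eq_zero fun i _ => ?_
    have : rowAvg (fun _ : Fin n => θ₀) = θ₀ := by
      rw [rowAvg, Finset.sum_const, Finset.card_univ, Fintype.card_fin,
        ← Nat.cast_smul_eq_nsmul ℝ, smul_smul, inv_mul_cancel₀ hn0.ne', one_smul]
    simp only [docom, initState, this, sub_self]
    simp
  have he : ∫ o, frobSq ((𝐬 0 o).v - fullGrad F D (𝐬 0 o).θ) ∂P ≤ n * (σ ^ 2 / b) := by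
    simp only [hv, frobSq]
    rw [integral_finsetSum _ fun i _ => integrable_norm_sq (hE i).1]
    calc _ ≤ ∑ _i : Fin n, σ ^ 2 / b := Finset.sum_le_sum fun i _ => (hE i).2
      _ = _ := by simp
  have hmv : ∫ o, ‖rowAvg (𝐬 0 o).v - rowAvg (fullGrad F D (𝐬 0 o).θ)‖ ^ 2 ∂P
      ≤ (n : ℝ)⁻¹ ^ 2 * (n * (σ ^ 2 / b)) := by
    have e : ∀ o, ‖rowAvg (𝐬 0 o).v - rowAvg (fullGrad F D (𝐬 0 o).θ)‖ ^ 2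
        = (n : ℝ)⁻¹ ^ 2 * ‖∑ i, batchErr F D θ₀ i fun r => R.ζ0 i r o‖ ^ 2 := fun o => by
      rw [← rowAvg_sub, hv, rowAvg, norm_smul, mul_pow, Real.norm_eq_abs, sq_abs]
    simp only [e]
    rw [integral_const_mul]
    have := integral_sum_batchErr_ζ0 hb hprob hgrad hS
    gcongr
  have ig : Integrable (fun o => frobSq (𝐬 0 o).g) P := integrable_frobSq hm.g
  have hg : ∫ o, frobSq (leftMul U.transpose (𝐬 0 o).g) ∂P ≤ ∫ o, frobSq (𝐬 0 o).g ∂P :=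
    integral_mono (integrable_frobSq (memLp_leftMul U.transpose hm.g)) ig
      fun o => hmix.frobSq_transpose_le _
  have hs : ∀ o, frobSq ((𝐬 0 o).g - (𝐬 0 o).ghat) = frobSq (𝐬 0 o).g := fun o => by
    simp only [docom, initState, frobSq, Pi.sub_apply, sub_zero]
  have hr : ∀ o, frobSq (thetaResidual η (𝐬 0 o)) = η ^ 2 * frobSq (𝐬 0 o).g := fun o => by
    rw [← frobSq_smul, ← frobSq_neg]
    congr 1
    funext i
    simp only [thetaResidual, docom, initState, Pi.neg_apply, Pi.smul_apply]
    abel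
  have hG : ∑ i, ∫ o, ‖(𝐬 0 o).g i‖ ^ 2 ∂P = ∫ o, frobSq (𝐬 0 o).g ∂P :=
    (integral_finsetSum _ fun i _ => integrable_norm_sq (hm.g i)).symm
  have hG0 : 0 ≤ ∫ o, frobSq (𝐬 0 o).g ∂P := integral_nonneg fun _ => frobSq_nonneg _
  have ha : 0 ≤ lyapA L ρ η γ := by unfold lyapA; positivity
  simp only [hx, hs, hr, integral_zero, mul_zero, integral_const_mul, hG]
  have k1 := mul_le_mul_of_nonneg_left hmv hn0.le
  have k2 := mul_le_mul_of_nonneg_left he (inv_nonneg.2 hn0.le)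
  have k3 := mul_le_mul_of_nonneg_left hg ha
  have k4 := mul_le_mul_of_nonneg_right (hst.lyap_weights_le hρ hω hδ) hG0
  have e1 : (n : ℝ) * ((n : ℝ)⁻¹ ^ 2 * (n * (σ ^ 2 / b))) = σ ^ 2 / b := by field_simp
  have e2 : (n : ℝ)⁻¹ * (n * (σ ^ 2 / b)) = σ ^ 2 / b := by field_simp
  have e3 : 192 * L ^ 2 * n / (ρ ^ 2 * γ ^ 2 * (1 - γ))
      * ((n : ℝ)⁻¹ * ∫ o, frobSq (𝐬 0 o).g ∂P) * η ^ 2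
      = 192 * L ^ 2 / (ρ ^ 2 * γ ^ 2 * (1 - γ)) * η ^ 2 * ∫ o, frobSq (𝐬 0 o).g ∂P := by
    field_simp
  have e4 : 2 * σ ^ 2 / b = σ ^ 2 / b + σ ^ 2 / b := by ring
  rw [e1] at k1
  rw [e2] at k2
  rw [e3, e4]
  linarith

end Initial

/-! ### Explicit bounds that do not depend on the batch size -/

section Uniform

variable {n d b : ℕ} {Z : Type u} [MeasurableSpace Z] {Ξ : Type v} [MeasurableSpace Ξ]
  {G : SimpleGraph (Fin n)} {U : Matrix (Fin n) (Fin (n - 1)) ℝ} {ρ ωb : ℝ}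
  {F : Fin n → Vec d → Z → ℝ} {D : Fin n → Measure Z} [∀ i, IsProbabilityMeasure (D i)]
  {W : Matrix (Fin n) (Fin n) ℝ} {κ : Kernel (Vec d) Ξ} [IsMarkovKernel κ]
  {Q : Vec d → Ξ → Vec d} {L σ δ μ η γ β : ℝ} {θ₀ : Vec d}
  {Ω : Type w} [mΩ : MeasurableSpace Ω] {P : Measure Ω} [IsProbabilityMeasure P]
  {R : Draws Ω Z Ξ n b}

local notation "𝐬" => docom F W Q θ₀ η γ β R

/-- A bound on the mean square of the initial directions that does not depend on the batch size. -/
noncomputable def initDirBound (F : Fin n → Vec d → Z → ℝ) (D : Fin n → Measure Z) (σ : ℝ)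
    (θ₀ : Vec d) : ℝ :=
  (n : ℝ)⁻¹ * ∑ i, (2 * ‖gradient (localObj F D i) θ₀‖ ^ 2 + 2 * σ ^ 2)

theorem integrable_avgObj_docom (hn : 0 < n) (hprob : IsStochasticProblem F D)
    (hlip : HasLipschitzSampleGradients F D L) (hgrad : HasUnbiasedGradients F D σ)
    (hcomp : IsCompressor κ Q δ) (hS : IsSampling P F D W κ Q θ₀ η γ β R) (t : ℕ) :
    Integrable (fun o => avgObj F D (thetaBar F W Q θ₀ η γ β R t o)) P :=
  integrable_avgObj_comp hn hprob hlip hgrad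
    (memLp_rowAvg (stateMemLp_docom hprob hlip hgrad hcomp hS t).θ)

theorem optVal_le_integral_avgObj (hn : 0 < n) (hprob : IsStochasticProblem F D)
    (hlip : HasLipschitzSampleGradients F D L) (hgrad : HasUnbiasedGradients F D σ)
    (hcomp : IsCompressor κ Q δ) (hS : IsSampling P F D W κ Q θ₀ η γ β R) (t : ℕ) :
    optVal F D ≤ ∫ o, avgObj F D (thetaBar F W Q θ₀ η γ β R t o) ∂P := by
  have := integral_mono (integrable_const (optVal F D))
    (integrable_avgObj_docom hn hprob hlip hgrad hcomp hS t)
    fun o => optVal_le hprob (thetaBar F W Q θ₀ η γ β R t o)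
  simpa only [integral_const, probReal_univ, one_smul] using this

theorem thetaBar_zero {n d b : ℕ} {Z : Type u} {Ξ : Type v} {Ω : Type w}
    (hn : 0 < n) (F : Fin n → Vec d → Z → ℝ) (W : Matrix (Fin n) (Fin n) ℝ)
    (Q : Vec d → Ξ → Vec d) (θ₀ : Vec d) (η γ β : ℝ) (R : Draws Ω Z Ξ n b) (o : Ω) :
    thetaBar F W Q θ₀ η γ β R 0 o = θ₀ := by
  have hn0 : (n : ℝ) ≠ 0 := by positivity
  simp only [thetaBar, docom, initState, rowAvg, Finset.sum_const, Finset.card_univ,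
    Fintype.card_fin]
  rw [← Nat.cast_smul_eq_nsmul ℝ, smul_smul, inv_mul_cancel₀ hn0, one_smul]

/-- The batch enters only through the initial value, where b ≥ 1 bounds it by quantities depending
on θ⁰ and σ. Hence the constants in the rates can be chosen before the batch and the run. -/
theorem optimality_gap_le_uniform (hn : 0 < n) (hb : 0 < b) (hprob : IsStochasticProblem F D)
    (hlip : HasLipschitzSampleGradients F D L) (hmix : IsMixing G W U ρ ωb)
    (hgrad : HasUnbiasedGradients F D σ) (hcomp : IsCompressor κ Q δ) (hpl : IsPL F D μ)
    (hst : StepSizes n L ρ ωb δ η γ β) (hS : IsSampling P F D W κ Q θ₀ η γ β R) (t : ℕ) :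
    ((∫ o, avgObj F D (thetaBar F W Q θ₀ η γ β R t o) ∂P) - optVal F D)
        + 2 * L ^ 2 * η / (betaBar ρ δ γ β * n)
          * ∑ i, ∫ o, ‖(𝐬 t o).θ i - thetaBar F W Q θ₀ η γ β R t o‖ ^ 2 ∂P
      ≤ (1 - betaTilde ρ δ μ η γ β) ^ t
          * (avgObj F D θ₀ - optVal F D + 2 * η / (betaBar ρ δ γ β * n)
              * (2 * σ ^ 2 + 192 * L ^ 2 * n / (ρ ^ 2 * γ ^ 2 * (1 - γ))
                * initDirBound F D σ θ₀ * η ^ 2))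
        + η * β ^ 2 / (betaBar ρ δ γ β * betaTilde ρ δ μ η γ β)
          * (2 * cSigma n L ρ ωb δ η γ * σ ^ 2 / n) := by
  have hB := StepSizes.betaBar_pos hmix.rho_pos hcomp.delta_pos hst.gamma_pos hst.beta_pos
  have hq1 := hst.betaTilde_lt_one (μ := μ)
  have hη := hst.eta_pos
  have hγ := hst.gamma_pos
  have hρ := hmix.rho_pos
  have h1γ : 0 < 1 - γ := by linarith [hst.gamma_lt_one]
  have h := optimality_gap_le hn hprob hlip hmix hgrad hcomp hpl hst hS t
  have h1 := integral_lyapState_zero_le hn hb hprob hlip hmix hgrad hcomp hst hS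
  have hb1 : (1 : ℝ) ≤ b := by exact_mod_cast hb
  have h2 : 2 * σ ^ 2 / b ≤ 2 * σ ^ 2 := div_le_self (by positivity) hb1
  have h3 : (n : ℝ)⁻¹ * ∑ i, ∫ o, ‖(𝐬 0 o).g i‖ ^ 2 ∂P ≤ initDirBound F D σ θ₀ :=
    mul_le_mul_of_nonneg_left
      (Finset.sum_le_sum fun i _ => integral_norm_g_zero_sq_le hb hprob hgrad hS i)
      (by positivity)
  have h4 : ∫ o, lyapState F D U L ρ ωb δ η γ (𝐬 0 o) ∂P
      ≤ 2 * σ ^ 2 + 192 * L ^ 2 * n / (ρ ^ 2 * γ ^ 2 * (1 - γ))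
          * initDirBound F D σ θ₀ * η ^ 2 := by
    refine h1.trans (add_le_add h2 ?_)
    gcongr
  have h0 : ∫ o, avgObj F D (thetaBar F W Q θ₀ η γ β R 0 o) ∂P = avgObj F D θ₀ := by
    simp only [thetaBar_zero hn, integral_const, probReal_univ, one_smul]
  rw [h0] at h
  refine h.trans (add_le_add_left ?_ _)
  have : 0 ≤ 1 - betaTilde ρ δ μ η γ β := by linarith
  gcongr

end Uniform

/-! ### Choice of the step sizes -/

section Choice

variable {n : ℕ} {L ρ ωb δ μ : ℝ}

theorem cGbar_pos (hn : 0 < n) (hL : 0 < L) (ωb β : ℝ) {γ : ℝ} (hρ : 0 < ρ) (hγ : 0 < γ) :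
    0 < cGbar n L ρ ωb γ β := by
  have : 0 < L ^ 2 * n / (ρ * γ) * (96 + 141 / 400 * (ρ ^ 2 / ωb ^ 2)) := by positivity
  unfold cGbar
  positivity

theorem exists_stepSizes (hn : 0 < n) (hρ : 0 < ρ) (hω : 0 < ωb) (hδ : 0 < δ)
    {β : ℝ} (hβ : 0 < β) (hβ1 : β < 1) : ∃ η γ : ℝ, StepSizes n L ρ ωb δ η γ β := by
  have hn0 : (0 : ℝ) < n := by positivity
  obtain ⟨γ, hγ, hγ2, hγ3⟩ : ∃ γ : ℝ, 0 < γ ∧ γ ≤ 1 / 2 ∧ γ ≤ gammaInf n ρ ωb δ (1 / 2) := by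
    refine ⟨min (1 / 2) (gammaInf n ρ ωb δ (1 / 2)), lt_min (by norm_num) ?_, min_le_left _ _,
      min_le_right _ _⟩
    have : (0 : ℝ) < √(1 - 1 / 2) := Real.sqrt_pos.2 (by norm_num)
    unfold gammaInf
    exact lt_min (by positivity) (lt_min (by positivity) (lt_min (by positivity) (by positivity)))
  -- The condition on γ refers to γ itself through √(1 - γ); capping γ at 1/2 bounds that root from
  -- below and breaks the circle.
  have hγ4 : γ ≤ gammaInf n ρ ωb δ γ := by
    refine hγ3.trans ?_
    unfold gammaInf
    gcongr
  have hB := StepSizes.betaBar_pos hρ hδ hγ hβ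
  by_cases hL : 0 < L
  · refine ⟨min (etaInf n L ρ ωb γ β)
      (√(betaBar ρ δ γ β * n / (8 * cGbar n L ρ ωb γ β))), γ, ?_, hγ, by linarith, hβ, hβ1, hγ4,
      fun _ => le_rfl⟩
    have h1 : 0 < √((1 - β) / (β * n)) :=
      Real.sqrt_pos.2 (div_pos (by linarith) (by positivity))
    have h2 : 0 < √(γ * ρ ^ 3) := Real.sqrt_pos.2 (by positivity)
    have h3 := cGbar_pos hn hL ωb β hρ hγ
    refine lt_min ?_ (Real.sqrt_pos.2 (by positivity))
    exact mul_pos (by positivity) (lt_min (by positivity) (by positivity))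
  · exact ⟨1, γ, one_pos, hγ, by linarith, hβ, hβ1, hγ4, fun h => absurd h hL⟩

theorem tendsto_log_div_natCast : Tendsto (fun T : ℕ => Real.log T / T) atTop (nhds 0) :=
  Real.isLittleO_log_id_atTop.tendsto_div_nhds_zero.comp tendsto_natCast_atTop_atTop

theorem eventually_const_mul_log_div_le (c : ℝ) {ε : ℝ} (hε : 0 < ε) :
    ∀ᶠ T : ℕ in atTop, c * (Real.log T / T) ≤ ε := by
  have h := tendsto_log_div_natCast.const_mul c
  rw [mul_zero] at h
  filter_upwards [h.eventually_lt_const hε] with T hT using hT.le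

theorem cGbar_le (hL : 0 < L) (hρ : 0 < ρ) {γ β : ℝ} (hγ : 0 < γ) (hp : ρ * γ ≤ 1)
    (hβ : 0 < β) (hβ1 : β < 1) : cGbar n L ρ ωb γ β
      ≤ 8 * L ^ 2 + L ^ 2 * n / (ρ * γ) * (96 + 141 / 400 * (ρ ^ 2 / ωb ^ 2)) := by
  have h1 : (1 - β) ^ 2 ≤ 1 := pow_le_one₀ (by linarith) (by linarith)
  have hp0 : 0 < ρ * γ := by positivity
  have h2 : (1 - ρ * γ) ^ 2 ≤ 1 := pow_le_one₀ (by linarith) (by linarith)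
  have h3 : 8 * (1 - β) ^ 2 * L ^ 2 * (1 - ρ * γ) ^ 2 ≤ 8 * 1 * L ^ 2 * 1 := by gcongr
  unfold cGbar
  linarith

/-- Both η and β tend to 0, so fixed thresholds are eventually met, β becomes the minimum defining
β̄, and the β-dependent thresholds have to be compared with powers of log T / T. -/
theorem eventually_stepSizes (hn : 0 < n) (hL : 0 < L) (hρ : 0 < ρ) (hρ1 : ρ ≤ 1) (hω : 0 < ωb)
    (hδ : 0 < δ) (hμ : 0 < μ) {γ : ℝ} (hγ : 0 < γ) (hγ1 : γ ≤ 1)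
    (hγi : γ ≤ gammaInf n ρ ωb δ γ) {η β : ℕ → ℝ} {cη cβ : ℝ}
    (hη : ∀ᶠ T : ℕ in atTop, Real.log T / (μ * T) ≤ η T ∧ η T ≤ cη * (Real.log T / T))
    (hβ : ∀ᶠ T : ℕ in atTop, 2 * (Real.log T / T) ≤ β T ∧ β T ≤ cβ * (Real.log T / T)) :
    ∀ᶠ T : ℕ in atTop, StepSizes n L ρ ωb δ (η T) γ (β T) ∧ betaBar ρ δ γ (β T) = β T ∧
      η T ≤ 1 := by
  have hn0 : (0 : ℝ) < n := by positivity
  have hp : ρ * γ ≤ 1 := mul_le_one₀ hρ1 hγ.le hγ1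
  set K := 8 * L ^ 2 + L ^ 2 * n / (ρ * γ) * (96 + 141 / 400 * (ρ ^ 2 / ωb ^ 2)) with hK
  have hK0 : 0 < K := by positivity
  have c1 : 0 < γ / L * (√(γ * ρ ^ 3) / 45) := by
    have : 0 < √(γ * ρ ^ 3) := Real.sqrt_pos.2 (by positivity)
    positivity
  filter_upwards [hη, hβ, eventually_ge_atTop 3, eventually_const_mul_log_div_le cη one_pos,
    eventually_const_mul_log_div_le cη c1,
    eventually_const_mul_log_div_le cη (by positivity : 0 < γ / L * (ρ ^ 2 / (240 * ωb))),
    eventually_const_mul_log_div_le cβ (by norm_num : (0 : ℝ) < 1 / 2),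
    eventually_const_mul_log_div_le cβ (by positivity : 0 < 1 / (2 * (n : ℝ))),
    eventually_const_mul_log_div_le cβ (by positivity : 0 < ρ * γ / 8),
    eventually_const_mul_log_div_le cβ (by positivity : 0 < δ * γ / 8),
    eventually_const_mul_log_div_le (8 * K * cη ^ 2) (by positivity : 0 < 2 * (n : ℝ))]
    with T hηT hβT hT e1 e2 e3 e4 e5 e6 e7 e8
  have hT3 : (3 : ℝ) ≤ T := by exact_mod_cast hT
  have hlog : 0 < Real.log T := Real.log_pos (by linarith)
  set x := Real.log T / T with hx
  have hx0 : 0 < x := by positivity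
  have hη0 : 0 < η T := lt_of_lt_of_le (by positivity) hηT.1
  have hβ0 : 0 < β T := by linarith
  have hβ1 : β T < 1 := by linarith
  have hB : betaBar ρ δ γ (β T) = β T := by
    have h7 : min (δ * γ / 8) (β T) = β T := min_eq_right (by linarith)
    rw [betaBar, h7]
    exact min_eq_right (by linarith)
  refine ⟨⟨hη0, hγ, hγ1, hβ0, hβ1, hγi, fun _ => le_min ?_ ?_⟩, hB, by linarith⟩
  · rw [etaInf, mul_min_of_nonneg _ _ (by positivity)]
    refine le_min ?_ (by linarith)
    -- Once β ≤ 1/2 and βn ≤ 1/2 this factor only helps, and the threshold becomes constant.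
    have h1 : 1 ≤ √((1 - β T) / (β T * n)) := by
      rw [Real.one_le_sqrt, le_div_iff₀ (by positivity)]
      have h2 : β T ≤ 1 / (2 * n) := by linarith
      rw [le_div_iff₀ (by positivity)] at h2
      linarith
    have h2 : γ / L * (√(γ * ρ ^ 3) / 45)
        ≤ γ / L * (√((1 - β T) / (β T * n)) * (√(γ * ρ ^ 3) / 45)) := by
      gcongr
      exact le_mul_of_one_le_left (by positivity) h1
    linarith
  · have hC := cGbar_pos hn hL ωb (β T) hρ hγ
    have hCK := cGbar_le (n := n) (ωb := ωb) hL hρ hγ hp hβ0 hβ1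
    rw [hB]
    refine Real.le_sqrt_of_sq_le ?_
    rw [le_div_iff₀ (by positivity)]
    have h1 : η T ^ 2 ≤ (cη * x) ^ 2 := by
      have := hηT.2
      gcongr
    -- η² is of second order in log T / T while β is of first order, so the condition with ℂ_ḡ holds
    -- eventually.
    have h2 : (8 * K * cη ^ 2 * x) * x ≤ 2 * n * x := by gcongr
    have h3 : 2 * x * n ≤ β T * n := by
      have := hβT.1
      gcongr
    calc η T ^ 2 * (8 * cGbar n L ρ ωb γ (β T)) ≤ (cη * x) ^ 2 * (8 * K) := by gcongr
      _ = (8 * K * cη ^ 2 * x) * x := by ring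
      _ ≤ β T * n := by linarith

/-- (1 - log T / T)^T ≤ exp(-log T) = 1/T, and log T ≥ 1 from T = 3 on. -/
theorem one_sub_pow_le_log_div {T : ℕ} (hT : 3 ≤ T) {q : ℝ} (hq : Real.log T / T ≤ q)
    (hq1 : q ≤ 1) : (1 - q) ^ T ≤ Real.log T / T := by
  have hT3 : (3 : ℝ) ≤ T := by exact_mod_cast hT
  have hT0 : (0 : ℝ) < T := by linarith
  have hlog : 1 ≤ Real.log T := by
    rw [Real.le_log_iff_exp_le hT0]
    linarith [Real.exp_one_lt_d9]
  calc (1 - q) ^ T ≤ Real.exp (-(Real.log T / T)) ^ T := by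
        refine pow_le_pow_left₀ (by linarith) ?_ T
        linarith [Real.one_sub_le_exp_neg (Real.log T / T)]
    _ = 1 / T := by
        rw [← Real.exp_nat_mul, mul_neg, mul_div_cancel₀ _ hT0.ne', Real.exp_neg,
          Real.exp_log hT0, one_div]
    _ ≤ Real.log T / T := by gcongr

theorem cSigma_le_of_le_one {η γ : ℝ} (hρ : 0 < ρ) (hδ : 0 < δ) (hγ : 0 < γ) (hη : 0 ≤ η)
    (hη1 : η ≤ 1) : cSigma n L ρ ωb δ η γ ≤ cSigma n L ρ ωb δ 1 γ := by
  unfold cSigma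
  gcongr

end Choice

/-! ### Rates of convergence -/

theorem HasLipschitzSampleGradients.mono {n d : ℕ} {Z : Type u} [MeasurableSpace Z]
    {F : Fin n → Vec d → Z → ℝ} {D : Fin n → Measure Z} {L L' : ℝ}
    (h : HasLipschitzSampleGradients F D L)
    (hL : L ≤ L') : HasLipschitzSampleGradients F D L' where
  nonneg := h.nonneg.trans hL
  differentiable := h.differentiable
  lipschitz i := by
    filter_upwards [h.lipschitz i] with z hz θ θ'
    exact (hz θ θ').trans (mul_le_mul_of_nonneg_right hL (norm_nonneg _))

section Rates

variable {n d : ℕ} {Z : Type u} [MeasurableSpace Z] {Ξ : Type v} [MeasurableSpace Ξ]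
  {G : SimpleGraph (Fin n)} {U : Matrix (Fin n) (Fin (n - 1)) ℝ} {ρ ωb : ℝ}
  {F : Fin n → Vec d → Z → ℝ} {D : Fin n → Measure Z} [∀ i, IsProbabilityMeasure (D i)]
  {W : Matrix (Fin n) (Fin n) ℝ} {κ : Kernel (Vec d) Ξ} [IsMarkovKernel κ]
  {Q : Vec d → Ξ → Vec d} {L σ δ μ : ℝ}

theorem exists_linear_rate (hn : 0 < n) (hprob : IsStochasticProblem F D)
    (hlip : HasLipschitzSampleGradients F D L) (hmix : IsMixing G W U ρ ωb)
    (hgrad : HasUnbiasedGradients F D σ) (hcomp : IsCompressor κ Q δ) (hpl : IsPL F D μ)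
    (θ₀ : Vec d) (hσ : σ = 0) {η γ β : ℝ} (hst : StepSizes n L ρ ωb δ η γ β) :
    ∃ C : ℝ, ∀ b : ℕ, 0 < b → ∀ (Ω : Type w) [MeasurableSpace Ω] (P : Measure Ω)
      [IsProbabilityMeasure P] (R : Draws Ω Z Ξ n b),
      IsSampling P F D W κ Q θ₀ η γ β R →
      ∀ T : ℕ, (∫ o, avgObj F D (thetaBar F W Q θ₀ η γ β R T o) ∂P) - optVal F D
        ≤ C * (1 - betaTilde ρ δ μ η γ β) ^ T := by
  refine ⟨avgObj F D θ₀ - optVal F D + 2 * η / (betaBar ρ δ γ β * n)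
    * (2 * σ ^ 2 + 192 * L ^ 2 * n / (ρ ^ 2 * γ ^ 2 * (1 - γ)) * initDirBound F D σ θ₀ * η ^ 2),
    fun b hb Ω _ P _ R hS T => ?_⟩
  have h := optimality_gap_le_uniform hn hb hprob hlip hmix hgrad hcomp hpl hst hS T
  have hB := StepSizes.betaBar_pos hmix.rho_pos hcomp.delta_pos hst.gamma_pos hst.beta_pos
  have hη := hst.eta_pos
  have h1 : 0 ≤ 2 * L ^ 2 * η / (betaBar ρ δ γ β * n) * ∑ i,
      ∫ o, ‖(docom F W Q θ₀ η γ β R T o).θ i - thetaBar F W Q θ₀ η γ β R T o‖ ^ 2 ∂P :=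
    mul_nonneg (by positivity)
      (Finset.sum_nonneg fun i _ => integral_nonneg fun _ => sq_nonneg _)
  have h2 : η * β ^ 2 / (betaBar ρ δ γ β * betaTilde ρ δ μ η γ β)
      * (2 * cSigma n L ρ ωb δ η γ * σ ^ 2 / n) = 0 := by
    rw [hσ]; simp
  rw [h2] at h
  linarith

theorem exists_log_rate_of_pos (hn : 0 < n) (hprob : IsStochasticProblem F D) (hL : 0 < L)
    (hlip : HasLipschitzSampleGradients F D L) (hmix : IsMixing G W U ρ ωb)
    (hgrad : HasUnbiasedGradients F D σ) (hcomp : IsCompressor κ Q δ) (hpl : IsPL F D μ)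
    (θ₀ : Vec d) {γ : ℝ} (hγ : 0 < γ) (hγ1 : γ ≤ 1) (hγi : γ ≤ gammaInf n ρ ωb δ γ)
    {η β : ℕ → ℝ} {cη cβ : ℝ}
    (hη : ∀ᶠ T : ℕ in atTop, Real.log T / (μ * T) ≤ η T ∧ η T ≤ cη * (Real.log T / T))
    (hβ : ∀ᶠ T : ℕ in atTop, 2 * (Real.log T / T) ≤ β T ∧ β T ≤ cβ * (Real.log T / T)) :
    ∃ (C : ℝ) (T₀ : ℕ), ∀ T : ℕ, T₀ ≤ T →
      StepSizes n L ρ ωb δ (η T) γ (β T) ∧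
      ∀ b : ℕ, 0 < b → ∀ (Ω : Type w) [MeasurableSpace Ω] (P : Measure Ω)
        [IsProbabilityMeasure P] (R : Draws Ω Z Ξ n b),
        IsSampling P F D W κ Q θ₀ (η T) γ (β T) R →
        (∫ o, avgObj F D (thetaBar F W Q θ₀ (η T) γ (β T) R T o) ∂P) - optVal F D
          ≤ C * (Real.log T / T) ∧
        (n : ℝ)⁻¹ * ∑ i, ∫ o, ‖(docom F W Q θ₀ (η T) γ (β T) R T o).θ i
            - thetaBar F W Q θ₀ (η T) γ (β T) R T o‖ ^ 2 ∂P
          ≤ C * (Real.log T / T) := by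
  have hρ := hmix.rho_pos
  have hω := hmix.omega_pos
  have hδ := hcomp.delta_pos
  have hμ := hpl.pos
  have hn0 : (0 : ℝ) < n := by positivity
  set V := 2 * σ ^ 2 + 192 * L ^ 2 * n / (ρ ^ 2 * γ ^ 2 * (1 - γ)) * initDirBound F D σ θ₀ with hV
  set N := 2 * cSigma n L ρ ωb δ 1 γ * σ ^ 2 / n with hN
  set C₁ := avgObj F D θ₀ - optVal F D + cη / n * V + cη * cβ * N with hC₁
  obtain ⟨T₀, hT₀⟩ := eventually_atTop.1 ((eventually_stepSizes hn hL hρ hmix.rho_le hω hδ hμ hγ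
    hγ1 hγi hη hβ).and (hη.and (hβ.and (eventually_ge_atTop 3))))
  refine ⟨C₁ + μ * cβ / (2 * L ^ 2) * C₁, T₀, fun T hT => ?_⟩
  obtain ⟨⟨hst, hB, hη1⟩, hηT, hβT, hT3⟩ := hT₀ T hT
  refine ⟨hst, fun b hb Ω _ P _ R hS => ?_⟩
  have hη0 := hst.eta_pos
  have hβ0 := hst.beta_pos
  have h1γ : 0 < 1 - γ := by linarith [hst.gamma_lt_one]
  have hTr : (3 : ℝ) ≤ T := by exact_mod_cast hT3
  have hlog : 0 < Real.log T := Real.log_pos (by linarith)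
  have hgap := optimality_gap_le_uniform hn hb hprob hlip hmix hgrad hcomp hpl hst hS T
  have hΔ := optVal_le_integral_avgObj hn hprob hlip hgrad hcomp hS T
  have hΔ0 := optVal_le hprob θ₀
  have hq1 := hst.betaTilde_lt_one (μ := μ)
  have hG : 0 ≤ initDirBound F D σ θ₀ := by unfold initDirBound; positivity
  have hV0 : 0 ≤ V := by positivity
  have hN0 : 0 ≤ N := by
    have := cSigma_ge_four n L ρ ωb δ 1 γ hρ hδ hγ
    positivity
  -- The two lower bounds on the step sizes are made for this: ημ ≥ log T / T and β/2 ≥ log T / T.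
  have hq : Real.log T / T ≤ betaTilde ρ δ μ (η T) γ (β T) := by
    refine le_min ?_ (by rw [hB]; linarith)
    have := mul_le_mul_of_nonneg_right hηT.1 hμ.le
    have e : Real.log T / (μ * T) * μ = Real.log T / T := by field_simp
    rwa [e] at this
  have hpow := one_sub_pow_le_log_div hT3 hq hq1.le
  set x := Real.log T / T with hx
  have hx0 : 0 < x := by positivity
  set q := betaTilde ρ δ μ (η T) γ (β T) with hqd
  have hq0 : 0 < q := hx0.trans_le hq
  have hcβ : 0 < cβ := pos_of_mul_pos_left (hβ0.trans_le hβT.2) hx0.le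
  have hcη : 0 < cη := pos_of_mul_pos_left (hη0.trans_le hηT.2) hx0.le
  have hC₁0 : 0 ≤ C₁ := by
    have : 0 ≤ avgObj F D θ₀ - optVal F D := sub_nonneg.2 hΔ0
    positivity
  rw [hB] at hgap
  set S := ∑ i, ∫ o, ‖(docom F W Q θ₀ (η T) γ (β T) R T o).θ i
    - thetaBar F W Q θ₀ (η T) γ (β T) R T o‖ ^ 2 ∂P with hS'
  have hS0 : 0 ≤ S := Finset.sum_nonneg fun i _ => integral_nonneg fun _ => sq_nonneg _
  -- η and β are of the same order, so the weight of the initial Lyapunov value stays bounded.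
  have hw : 2 * η T / (β T * n) ≤ cη / n := by
    rw [div_le_div_iff₀ (by positivity) hn0]
    have h1 : 2 * η T ≤ cη * β T := by
      have := mul_le_mul_of_nonneg_left hβT.1 hcη.le
      linarith [hηT.2]
    calc 2 * η T * n ≤ cη * β T * n := by gcongr
      _ = cη * (β T * n) := by ring
  have hinit : (1 - q) ^ T * (avgObj F D θ₀ - optVal F D + 2 * η T / (β T * n)
      * (2 * σ ^ 2 + 192 * L ^ 2 * n / (ρ ^ 2 * γ ^ 2 * (1 - γ))
        * initDirBound F D σ θ₀ * η T ^ 2))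
      ≤ x * (avgObj F D θ₀ - optVal F D + cη / n * V) := by
    have hηsq : η T ^ 2 ≤ 1 := pow_le_one₀ hη0.le hη1
    have h1 : 2 * σ ^ 2 + 192 * L ^ 2 * n / (ρ ^ 2 * γ ^ 2 * (1 - γ))
        * initDirBound F D σ θ₀ * η T ^ 2 ≤ V := by
      rw [hV]
      have : 192 * L ^ 2 * n / (ρ ^ 2 * γ ^ 2 * (1 - γ)) * initDirBound F D σ θ₀ * η T ^ 2
          ≤ 192 * L ^ 2 * n / (ρ ^ 2 * γ ^ 2 * (1 - γ)) * initDirBound F D σ θ₀ * 1 := by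
        gcongr
      linarith
    have h2 : 0 ≤ avgObj F D θ₀ - optVal F D := sub_nonneg.2 hΔ0
    have h3 : 0 ≤ 1 - q := by linarith
    gcongr
  have hnoise : η T * β T ^ 2 / (β T * q) * (2 * cSigma n L ρ ωb δ (η T) γ * σ ^ 2 / n)
      ≤ cη * cβ * x * N := by
    have h1 : 2 * cSigma n L ρ ωb δ (η T) γ * σ ^ 2 / n ≤ N := by
      rw [hN]
      have := cSigma_le_of_le_one (n := n) (L := L) (ωb := ωb) hρ hδ hγ hη0.le hη1
      gcongr
    have h2 : η T * β T ^ 2 / (β T * q) ≤ cη * cβ * x := by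
      rw [div_le_iff₀ (by positivity)]
      calc η T * β T ^ 2 = η T * β T * β T := by ring
        _ ≤ cη * x * (cβ * x) * β T := by
          have := hηT.2
          have := hβT.2
          gcongr
        _ = cη * cβ * x * (β T * x) := by ring
        _ ≤ cη * cβ * x * (β T * q) := by gcongr
    have h3 := cSigma_ge_four n L ρ ωb δ (η T) γ hρ hδ hγ
    exact mul_le_mul h2 h1 (by positivity) (by positivity)
  have htot : ((∫ o, avgObj F D (thetaBar F W Q θ₀ (η T) γ (β T) R T o) ∂P) - optVal F D)
      + 2 * L ^ 2 * η T / (β T * n) * S ≤ C₁ * x := by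
    rw [hC₁]
    linarith
  have hSw : 0 ≤ 2 * L ^ 2 * η T / (β T * n) * S := by positivity
  have hC₂ : 0 ≤ μ * cβ / (2 * L ^ 2) * C₁ := by positivity
  constructor
  · have := mul_nonneg hC₂ hx0.le
    linarith
  -- Comparability in the other direction keeps the consensus coefficient 2L²η/(βn) away from zero,
  -- so one may divide by it.
  · have h1 : β T ≤ μ * cβ * η T := by
      have h2 := mul_le_mul_of_nonneg_left hηT.1 (by positivity : 0 ≤ μ * cβ)
      have e : μ * cβ * (Real.log T / (μ * T)) = cβ * x := by rw [hx]; field_simp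
      linarith [hβT.2]
    have h2 : (n : ℝ)⁻¹ * S
        ≤ μ * cβ / (2 * L ^ 2) * (2 * L ^ 2 * η T / (β T * n) * S) := by
      have e : μ * cβ / (2 * L ^ 2) * (2 * L ^ 2 * η T / (β T * n) * S)
          = μ * cβ * η T / β T * ((n : ℝ)⁻¹ * S) := by field_simp
      rw [e]
      refine le_mul_of_one_le_left (by positivity) ?_
      rwa [one_le_div hβ0]
    have h3 : 2 * L ^ 2 * η T / (β T * n) * S ≤ C₁ * x := by linarith
    have h4 : μ * cβ / (2 * L ^ 2) * (2 * L ^ 2 * η T / (β T * n) * S)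
        ≤ μ * cβ / (2 * L ^ 2) * (C₁ * x) := by gcongr
    have := mul_nonneg hC₁0 hx0.le
    linarith

theorem StepSizes.zero_lipschitz {η γ β : ℝ} (h : StepSizes n L ρ ωb δ η γ β) :
    StepSizes n 0 ρ ωb δ η γ β :=
  { h with eta_le := fun h0 => absurd h0 (lt_irrefl 0) }

/-- For L = 0 the gap inequality says nothing about consensus, because its coefficient vanishes. But
then L = 1 is also a Lipschitz constant, and admissibility for L = 1 implies it for L = 0. -/
theorem exists_log_rate (hn : 0 < n) (hprob : IsStochasticProblem F D)
    (hlip : HasLipschitzSampleGradients F D L) (hmix : IsMixing G W U ρ ωb)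
    (hgrad : HasUnbiasedGradients F D σ) (hcomp : IsCompressor κ Q δ) (hpl : IsPL F D μ)
    (θ₀ : Vec d) {γ : ℝ} (hγ : 0 < γ) (hγ1 : γ ≤ 1) (hγi : γ ≤ gammaInf n ρ ωb δ γ)
    {η β : ℕ → ℝ} {cη cβ : ℝ}
    (hη : ∀ᶠ T : ℕ in atTop, Real.log T / (μ * T) ≤ η T ∧ η T ≤ cη * (Real.log T / T))
    (hβ : ∀ᶠ T : ℕ in atTop, 2 * (Real.log T / T) ≤ β T ∧ β T ≤ cβ * (Real.log T / T)) :
    ∃ (C : ℝ) (T₀ : ℕ), ∀ T : ℕ, T₀ ≤ T →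
      StepSizes n L ρ ωb δ (η T) γ (β T) ∧
      ∀ b : ℕ, 0 < b → ∀ (Ω : Type w) [MeasurableSpace Ω] (P : Measure Ω)
        [IsProbabilityMeasure P] (R : Draws Ω Z Ξ n b),
        IsSampling P F D W κ Q θ₀ (η T) γ (β T) R →
        (∫ o, avgObj F D (thetaBar F W Q θ₀ (η T) γ (β T) R T o) ∂P) - optVal F D
          ≤ C * (Real.log T / T) ∧
        (n : ℝ)⁻¹ * ∑ i, ∫ o, ‖(docom F W Q θ₀ (η T) γ (β T) R T o).θ i
            - thetaBar F W Q θ₀ (η T) γ (β T) R T o‖ ^ 2 ∂P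
          ≤ C * (Real.log T / T) := by
  rcases hlip.nonneg.eq_or_lt with rfl | hL
  · obtain ⟨C, T₀, h⟩ := exists_log_rate_of_pos hn hprob one_pos (hlip.mono zero_le_one) hmix
      hgrad hcomp hpl θ₀ hγ hγ1 hγi hη hβ
    exact ⟨C, T₀, fun T hT => ⟨(h T hT).1.zero_lipschitz, (h T hT).2⟩⟩
  · exact exists_log_rate_of_pos hn hprob hL hlip hmix hgrad hcomp hpl θ₀ hγ hγ1 hγi hη hβ

end Rates

/-! ### Assembly of the three claims -/

theorem corollary1 {n d : ℕ} (hn : 0 < n)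
    {Z : Type u} [MeasurableSpace Z] {Ξ : Type v} [MeasurableSpace Ξ]
    (G : SimpleGraph (Fin n)) (W : Matrix (Fin n) (Fin n) ℝ)
    (U : Matrix (Fin n) (Fin (n - 1)) ℝ)
    (F : Fin n → Vec d → Z → ℝ) (D : Fin n → Measure Z) [∀ i, IsProbabilityMeasure (D i)]
    (κ : Kernel (Vec d) Ξ) [IsMarkovKernel κ] (Q : Vec d → Ξ → Vec d)
    (L ρ ωb σ δ μ : ℝ)
    (hprob : IsStochasticProblem F D)
    (hlip : HasLipschitzSampleGradients F D L)
    (hmix : IsMixing G W U ρ ωb)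
    (hgrad : HasUnbiasedGradients F D σ)
    (hcomp : IsCompressor κ Q δ)
    (hpl : IsPL F D μ)
    (θ₀ : Vec d) :
    -- the bound for all admissible step sizes and all runs, with the bound on `V⁰`
    (∀ η γ β : ℝ, StepSizes n L ρ ωb δ η γ β →
      ∀ b : ℕ, 0 < b → ∀ (Ω : Type w) [MeasurableSpace Ω] (P : Measure Ω)
        [IsProbabilityMeasure P] (R : Draws Ω Z Ξ n b),
        IsSampling P F D W κ Q θ₀ η γ β R →
        (∀ t : ℕ, Integrable (fun o => avgObj F D (thetaBar F W Q θ₀ η γ β R t o)) P) ∧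
        (∀ (t : ℕ) (i : Fin n), Integrable (fun o =>
          ‖(docom F W Q θ₀ η γ β R t o).θ i - thetaBar F W Q θ₀ η γ β R t o‖ ^ 2) P) ∧
        (∀ i : Fin n, Integrable (fun o => ‖(docom F W Q θ₀ η γ β R 0 o).g i‖ ^ 2) P) ∧
        Integrable (fun o =>
          lyapState F D U L ρ ωb δ η γ (docom F W Q θ₀ η γ β R 0 o)) P ∧
        (∀ t : ℕ, 1 ≤ t →
          ((∫ o, avgObj F D (thetaBar F W Q θ₀ η γ β R t o) ∂P) - optVal F D)
            + 2 * L ^ 2 * η / (betaBar ρ δ γ β * n)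
              * ∑ i, ∫ o, ‖(docom F W Q θ₀ η γ β R t o).θ i
                  - thetaBar F W Q θ₀ η γ β R t o‖ ^ 2 ∂P
          ≤ (1 - betaTilde ρ δ μ η γ β) ^ t
              * (((∫ o, avgObj F D (thetaBar F W Q θ₀ η γ β R 0 o) ∂P) - optVal F D)
                + 2 * η / (betaBar ρ δ γ β * n)
                  * ∫ o, lyapState F D U L ρ ωb δ η γ (docom F W Q θ₀ η γ β R 0 o) ∂P)
            + η * β ^ 2 / (betaBar ρ δ γ β * betaTilde ρ δ μ η γ β)
              * (2 * cSigma n L ρ ωb δ η γ * σ ^ 2 / n)) ∧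
        (∫ o, lyapState F D U L ρ ωb δ η γ (docom F W Q θ₀ η γ β R 0 o) ∂P
          ≤ 2 * σ ^ 2 / b
            + 192 * L ^ 2 * n / (ρ ^ 2 * γ ^ 2 * (1 - γ))
              * ((n : ℝ)⁻¹ * ∑ i, ∫ o, ‖(docom F W Q θ₀ η γ β R 0 o).g i‖ ^ 2 ∂P)
              * η ^ 2)) ∧
    -- the `O(log T / T)` rate when `η` and `β` are of order `log T / T`
    (∀ γ : ℝ, 0 < γ → γ ≤ 1 → γ ≤ gammaInf n ρ ωb δ γ →
      ∀ (η β : ℕ → ℝ) (cη cβ : ℝ),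
        (∀ᶠ T : ℕ in atTop, Real.log T / (μ * T) ≤ η T ∧ η T ≤ cη * (Real.log T / T)) →
        (∀ᶠ T : ℕ in atTop, 2 * (Real.log T / T) ≤ β T ∧ β T ≤ cβ * (Real.log T / T)) →
        ∃ (C : ℝ) (T₀ : ℕ), ∀ T : ℕ, T₀ ≤ T →
          StepSizes n L ρ ωb δ (η T) γ (β T) ∧
          ∀ b : ℕ, 0 < b → ∀ (Ω : Type w) [MeasurableSpace Ω] (P : Measure Ω)
            [IsProbabilityMeasure P] (R : Draws Ω Z Ξ n b),
            IsSampling P F D W κ Q θ₀ (η T) γ (β T) R →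
            (∫ o, avgObj F D (thetaBar F W Q θ₀ (η T) γ (β T) R T o) ∂P) - optVal F D
              ≤ C * (Real.log T / T) ∧
            (n : ℝ)⁻¹ * ∑ i, ∫ o, ‖(docom F W Q θ₀ (η T) γ (β T) R T o).θ i
                - thetaBar F W Q θ₀ (η T) γ (β T) R T o‖ ^ 2 ∂P
              ≤ C * (Real.log T / T)) ∧
    -- constant step sizes exist, and give linear convergence in the deterministic case
    (∀ β : ℝ, 0 < β → β < 1 → ∃ η γ : ℝ, StepSizes n L ρ ωb δ η γ β) ∧
    (σ = 0 → ∀ η γ β : ℝ, StepSizes n L ρ ωb δ η γ β →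
      0 < betaTilde ρ δ μ η γ β ∧ betaTilde ρ δ μ η γ β < 1 ∧
      ∃ C : ℝ, ∀ b : ℕ, 0 < b → ∀ (Ω : Type w) [MeasurableSpace Ω] (P : Measure Ω)
        [IsProbabilityMeasure P] (R : Draws Ω Z Ξ n b),
        IsSampling P F D W κ Q θ₀ η γ β R →
        ∀ T : ℕ,
          (∫ o, avgObj F D (thetaBar F W Q θ₀ η γ β R T o) ∂P) - optVal F D
            ≤ C * (1 - betaTilde ρ δ μ η γ β) ^ T) := by
  refine ⟨fun η γ β hst b hb Ω _ P _ R hS => ?_, fun γ hγ hγ1 hγi η β cη cβ hη hβ =>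
    exists_log_rate hn hprob hlip hmix hgrad hcomp hpl θ₀ hγ hγ1 hγi hη hβ, fun β hβ hβ1 =>
    exists_stepSizes hn hmix.rho_pos hmix.omega_pos hcomp.delta_pos hβ hβ1,
    fun hσ η γ β hst => ⟨hst.betaTilde_pos hmix.rho_pos hcomp.delta_pos hpl.pos,
      hst.betaTilde_lt_one, exists_linear_rate hn hprob hlip hmix hgrad hcomp hpl θ₀ hσ hst⟩⟩
  have hm := fun t => stateMemLp_docom hprob hlip hgrad hcomp hS t
  exact ⟨fun t => integrable_avgObj_docom hn hprob hlip hgrad hcomp hS t,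
    fun t i => integrable_norm_sq (((hm t).θ i).sub (memLp_rowAvg (hm t).θ)),
    fun i => integrable_norm_sq ((hm 0).g i),
    (integrable_lyapState_and_integral_eq hprob hlip hgrad (hm 0)).1,
    fun t _ => optimality_gap_le hn hprob hlip hmix hgrad hcomp hpl hst hS t,
    integral_lyapState_zero_le hn hb hprob hlip hmix hgrad hcomp hst hS⟩
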